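/- Let $-1<\rho<1$, $\alpha=(\alpha_1,\alpha_2)\in\mathbb R^2$, and let $Z=(Z_1,Z_2)\sim SN_2(\alpha,R)$, i.e. $Z$ has the density $2\phi_2(z,R)\Phi(\alpha^{\top}z)$, where $\phi_2(\cdot,R)$ is the centred bivariate normal density with correlation matrix $R=\begin{pmatrix}1&\rho\\ \rho&1\end{pmatrix}$ and $\Phi$ is the standard normal distribution function. Let $F_1,F_2$ be the marginal distribution functions, $C(u,v)=P(Z_1\le F_1^{-1}(u),Z_2\le F_2^{-1}(v))$ the copula of $Z$, and for $\{i,j\}=\{1,2\}$ put $$\lambda_i=\frac{\alpha_i+\rho\alpha_j}{\sqrt{1+\alpha_j^2(1-\rho^2)}},\qquad \kappa_i=\begin{cases}\sqrt{1+\lambda_i^2},&\lambda_i>0,\\1,&\lambda_i\le0,\end{cases}\qquad \gamma_i=\frac{\kappa_j}{\kappa_i},\qquad \beta_i=\frac{\gamma_i-\rho}{1-\rho^2}+\alpha_i(\alpha_i\gamma_i+\alpha_j).$$ The sign of $\lambda_i$ is the sign of $\alpha_i+\rho\alpha_j$. For every $0<u<1$ the diagonal $u\mapsto C(u,u)$ is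 differentiable and $$\frac{dC(u,u)}{du}=P(Z_1\le F_1^{-1}(u)\mid Z_2=F_2^{-1}(u))+P(Z_2\le F_2^{-1}(u)\mid Z_1=F_1^{-1}(u)),$$ where the conditional probabilities are those given by the conditional densities. Moreover, for $\{i,j\}=\{1,2\}$, in each of the cases below, $dC(u,u)/du=u^{\theta}L(u)$ for $0<u<1$, where $\theta>0$, $L$ is slowly varying at $0+$ and $L(u)\sim c\,(-\log u)^{\tau}$, and consequently $C(u,u)\sim u^{\theta+1}L(u)/(\theta+1)$, as $u\to0^+$, with the following constants. 1. If $\lambda_i<0$ and $\lambda_j<0$: $\theta=\frac{1-\rho}{1+\rho}=\frac2{1+\rho}-1$, $\tau=-\frac{\rho}{1+\rho}$, $c=\sqrt{\frac{1+\rho}{1-\rho}}\,\pi^{-\rho/(1+\rho)}$. 2. If $\lambda_i=0$ and $\lambda_j<0$: $\theta=\frac{1-\rho}{1+\rho}=\frac2{1+\rho}-1$, $\tau=-\frac{\rho}{1+\rho}$, $c=\sqrt{\frac{1+\rho}{1-\rho}}\,\pi^{-\rho/(1+\rho)}\,2^{1/(1+\rho)}$. In cases 3 and 4 write $l=\lambda_j>0$,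 $w=\sqrt{1+l^2}$, $g=1/w$, $r=1-\rho^2$, $d=g-\rho$, $b=\alpha_i+\alpha_jg$; here $\frac{d^2}{r}=\frac{r+(w-\rho)^2}{r(1+l^2)}-1$. 3. Let $\lambda_i<0$ and $\lambda_j>0$. (a) If $b>0$: $\theta=\frac{d^2}{r}+b^2$, $\tau=\frac{d^2}{2r}+\frac{gd}{2r}+b^2-\frac{\alpha_ib}{2}-1$, $$c=\frac{(2l)^{b^2-\alpha_ib+gd/r}}{4\sqrt r\,|b|}\;\pi^{\,b^2-\alpha_ib/2+gd/(2r)+d^2/(2r)-1}\left[\frac1{|\beta_j|}+\frac1{|\beta_i|}\right].$$ (b) If $b=0$: $\theta=\frac{d^2}{r}$, $\tau=\frac{d^2}{2r}+\frac{gd}{2r}-\frac12$, $$c=\frac{\sqrt r}{4}\,(2l)^{gd/r}\,\pi^{\,d^2/(2r)+gd/(2r)-1/2}\left[\frac1{w-\rho}+\frac1{|g-\rho|}\right].$$ (c) If $b<0$: $\theta$ and $\tau$ as in (b), and $c$ is twice the value in (b). 4. Let $\lambda_i=0$ and $\lambda_j>0$. (a) If $b>0$: $\theta$ and $\tau$ as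 in 3(a), $$c=\frac{(2\pi l)^{b^2}(l\sqrt\pi)^{gd/r-\alpha_ib}(2\sqrt\pi)^{d^2/r}}{2\sqrt{\pi r}\,|b|}\left[\frac1{\sqrt\pi\,\beta_j}+\frac1{\sqrt\pi\,\beta_i}\right].$$ (b) If $b=0$: $\theta$ and $\tau$ as in 3(b), $$c=\frac{\sqrt r}{2\sqrt\pi}(l\sqrt\pi)^{gd/r}(2\sqrt\pi)^{d^2/r}\left[\frac1{w-\rho}+\frac1{|g-\rho|}\right].$$ (c) If $b<0$: $\theta$ and $\tau$ as in 3(b), and $c$ is twice the value in (b). 5. Let $\lambda_i>0$ and $\lambda_j>0$, and put $g_i=1/\sqrt{1+\lambda_i^2}$, $g_j=1/\sqrt{1+\lambda_j^2}$, $b=\alpha_ig_i+\alpha_jg_j$, $r=1-\rho^2$. Then $$\theta=\frac{(g_j-\rho g_i)^2}{r}+b^2-\frac{\lambda_i^2}{1+\lambda_i^2}=\frac1r\left(\frac{1+\alpha_i^2r}{1+\lambda_i^2}+\frac{1+\alpha_j^2r}{1+\lambda_j^2}+\frac{2(\alpha_i\alpha_jr-\rho)}{\sqrt{(1+\lambda_i^2)(1+\lambda_j^2)}}\right)-1,\qquad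 \tau=\theta-\tfrac12,$$ $$c=\left[\frac1{\beta_i}+\frac1{\beta_j}\right]\frac{(2\pi)^{\theta-1/2}}{\sqrt{2r}\,|b|}\;\lambda_i^{\,g_i(g_i-\rho g_j)/r+\alpha_ig_ib}\;\lambda_j^{\,g_j(g_j-\rho g_i)/r+\alpha_jg_jb}.$$ In particular, let $\alpha_1=\alpha_2=a$ and $\lambda_L(u)=P(Z_1\le F_1^{-1}(u)\mid Z_2\le F_2^{-1}(u))$. If $a>0$, then with $l=\frac{a(1+\rho)}{\sqrt{1+a^2(1-\rho^2)}}$ and $\beta=\sqrt{\frac{(1-\rho)(1+2a^2(1+\rho))}{1+\rho}}$, $$\lambda_L(u)\sim u^{\beta^2}\frac{(2\pi l)^{\beta^2}}{\sqrt\pi\,\beta(1+\beta^2)^2}(-\log u)^{\beta^2-1/2},$$ and if $a<0$, then $$\lambda_L(u)\sim u^{\frac{1-\rho}{1+\rho}}\;\frac{1+\rho}{2}\sqrt{\frac{1+\rho}{1-\rho}}\;(-\pi\log u)^{-\frac{\rho}{1+\rho}},\qquad u\to0^+.$$ -/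

import Mathlib

open MeasureTheory ProbabilityTheory Set Filter Topology Asymptotics

noncomputable section

namespace SkewNormal

/-- The standard normal distribution function `Φ`. -/
def Phi (x : ℝ) : ℝ := cdf (gaussianReal 0 1) x

/-- The centred bivariate normal density with unit variances and correlation `ρ`. -/
def phi2 (ρ : ℝ) (z : Fin 2 → ℝ) : ℝ :=
  1 / (2 * Real.pi * √(1 - ρ ^ 2)) *
    Real.exp (-(z 0 ^ 2 - 2 * ρ * z 0 * z 1 + z 1 ^ 2) / (2 * (1 - ρ ^ 2)))

/-- The density `2 φ₂(z, R) Φ(αᵀ z)` of the bivariate skew normal distribution `SN₂(α, R)`. -/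
def density (α : Fin 2 → ℝ) (ρ : ℝ) (z : Fin 2 → ℝ) : ℝ :=
  2 * phi2 ρ z * Phi (α 0 * z 0 + α 1 * z 1)

/-- The bivariate skew normal distribution `SN₂(α, R)`. -/
def law (α : Fin 2 → ℝ) (ρ : ℝ) : Measure (Fin 2 → ℝ) :=
  volume.withDensity fun z => ENNReal.ofReal (density α ρ z)

/-- The skewness parameter `λ_i` of the `i`-th margin; `1 - i` is the other index. -/
def lam (α : Fin 2 → ℝ) (ρ : ℝ) (i : Fin 2) : ℝ :=
  (α i + ρ * α (1 - i)) / √(1 + α (1 - i) ^ 2 * (1 - ρ ^ 2))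

/-- `√(1 + λ_i²)` if `λ_i > 0` and `1` otherwise. -/
def tailScale (α : Fin 2 → ℝ) (ρ : ℝ) (i : Fin 2) : ℝ :=
  if 0 < lam α ρ i then √(1 + lam α ρ i ^ 2) else 1

/-- The constant `γ_i`, the limit of the ratio of the `i`-th marginal quantile to the other one. -/
def gam (α : Fin 2 → ℝ) (ρ : ℝ) (i : Fin 2) : ℝ :=
  tailScale α ρ (1 - i) / tailScale α ρ i

/-- The constant `β_i`. -/
def bet (α : Fin 2 → ℝ) (ρ : ℝ) (i : Fin 2) : ℝ :=
  (gam α ρ i - ρ) / (1 - ρ ^ 2) + α i * (α i * gam α ρ i + α (1 - i))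

/-- The point of the plane with `i`-th coordinate `x` and other coordinate `y`. -/
def point (i : Fin 2) (x y : ℝ) : Fin 2 → ℝ := fun k => if k = i then x else y

/-- The conditional probability `P(Z_i ≤ x | Z_{1-i} = y)` for `Z ∼ SN₂(α, R)`: the integral up to
`x` of the conditional density of `Z_i` given that the other coordinate is `y`, which is the joint
density divided by the marginal density. -/
def condProb (α : Fin 2 → ℝ) (ρ : ℝ) (i : Fin 2) (x y : ℝ) : ℝ :=
  (∫ t in Iic x, density α ρ (point i t y)) / ∫ t, density α ρ (point i t y)

section RandomVector

variable {Ω : Type*} [MeasurableSpace Ω] (P : Measure Ω) (Z : Ω → Fin 2 → ℝ)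

/-- The distribution function `F_i` of the `i`-th coordinate. -/
def margCDF (i : Fin 2) (x : ℝ) : ℝ := P.real {ω | Z ω i ≤ x}

/-- The quantile function `F_i⁻¹` of the `i`-th coordinate. -/
def quantile (i : Fin 2) (u : ℝ) : ℝ := sInf {x | u ≤ margCDF P Z i x}

/-- The copula `C(u, v) = P(Z_1 ≤ F_1⁻¹(u), Z_2 ≤ F_2⁻¹(v))` (for `0 < u, v < 1`). -/
def copula (u v : ℝ) : ℝ :=
  P.real {ω | Z ω 0 ≤ quantile P Z 0 u ∧ Z ω 1 ≤ quantile P Z 1 v}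

/-- `λ_L(u) = P(Z_1 ≤ F_1⁻¹(u) | Z_2 ≤ F_2⁻¹(u))`. -/
def lowerTail (u : ℝ) : ℝ :=
  (cond P {ω | Z ω 1 ≤ quantile P Z 1 u}).real {ω | Z ω 0 ≤ quantile P Z 0 u}

end RandomVector

/-- Slow variation at `0+`. -/
def SlowlyVaryingAtZero (L : ℝ → ℝ) : Prop :=
  Measurable L ∧ (∀ᶠ u in 𝓝[>] 0, 0 < L u) ∧
    ∀ a : ℝ, 0 < a → Tendsto (fun u => L (a * u) / L u) (𝓝[>] 0) (𝓝 1)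

/-- `δ'(u) = u^θ L(u)` on `(0, 1)`, with `θ > 0` and `L` slowly varying at `0+`,
`L(u) ∼ c (-log u)^τ`, and moreover `δ(u) ∼ u^(θ+1) L(u) / (θ + 1)`, as `u → 0+`. -/
def DiagonalAsymptotics (δ : ℝ → ℝ) (θ c τ : ℝ) : Prop :=
  0 < θ ∧ ∃ L : ℝ → ℝ, SlowlyVaryingAtZero L ∧
    (∀ u ∈ Ioo (0 : ℝ) 1, deriv δ u = u ^ θ * L u) ∧
    (L ~[𝓝[>] 0] fun u => c * (-Real.log u) ^ τ) ∧
    (δ ~[𝓝[>] 0] fun u => u ^ (θ + 1) * L u / (θ + 1))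

end SkewNormal

end

/-! Write `q_i` for the marginal quantile functions, `κ_i` for `tailScale`, `L = -log u`, `r = 1 -
ρ²`. The diagonal is the joint distribution function evaluated along the curve `(q_0(u), q_1(u))`.
Its partial derivatives are integrals of the density over half-lines, and `q_i' = 1 / f_i(q_i)` with
`f_i` the marginal density. The chain rule therefore gives the sum of the two conditional
probabilities (`hasDerivAt_copula_diag`).

With one coordinate fixed, the density is a Gaussian kernel times `Φ` of an affine function.
Laplace's method at the endpoint (`tendsto_integral_Iic_skewKernel`), based on the log-concavity of
`Φ`, shows that its integral up to `x` is the endpoint value divided by the exponential rate.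
Applied to the conditional density the rate is `decayRate` times `-q_j`. Applied to the marginal
density it gives `f_j(q_j) ∼ κ_j² (-q_j) u`. Since `κ_j² q_j² ∼ 2 L`, each conditional probability
is asymptotic to the joint density at the quantile vector divided by `2 u L · decayRate`
(`IsMarginalQuantile.tendsto_condProb`).

It remains to expand the joint density on the curve. Taking logarithms in the marginal tail gives
`κ² q² = 2 L - p log L - c + o(1)` (`tendsto_sq_quantile_expansion`), and hence `κ_i q_i - κ_j q_j →
0`. A quadratic form in the quantiles then becomes a combination of the two squares up to `o(1)`,
and its exponential an explicit power of `u` times a power of `L`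
(`IsMarginalQuantile.tendsto_exp_quadratic`). The factor `Φ(αᵀq)` depends on the sign of `skewDir`,
the scalar product of `α` with `(1/κ_0, 1/κ_1)`. It tends to `1` or `1/2` if this is negative or
zero. If it is positive, Mills' ratio applies and `(αᵀq)²` joins the quadratic form.

L'Hôpital's rule passes from the derivative to the diagonal (`diagonalAsymptotics_of_tendsto`). The
rest is algebra: positivity of `β_i` and of `θ`, and the closed form of the constant in each sign
case. -/

namespace SkewNormal

/-! ### The standard normal law: Mills' ratio and log-concavity of `Φ`. -/

/-- The standard normal density. -/
noncomputable def stdPDF (x : ℝ) : ℝ := (√(2 * Real.pi))⁻¹ * Real.exp (-x ^ 2 / 2)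

/-- The reversed hazard rate `φ / Φ` of the standard normal distribution. -/
noncomputable def revHazard (x : ℝ) : ℝ := stdPDF x / Phi x

lemma stdPDF_pos (x : ℝ) : 0 < stdPDF x := by unfold stdPDF; positivity

lemma gaussianPDFReal_eq_stdPDF : gaussianPDFReal 0 1 = stdPDF := by
  ext x; simp [gaussianPDFReal, stdPDF]

lemma continuous_stdPDF : Continuous stdPDF := by unfold stdPDF; fun_prop

lemma integrable_stdPDF : Integrable stdPDF := by
  rw [← gaussianPDFReal_eq_stdPDF]; exact integrable_gaussianPDFReal _ _

lemma hasDerivAt_stdPDF (x : ℝ) : HasDerivAt stdPDF (-x * stdPDF x) x := by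
  have h : HasDerivAt (fun y : ℝ => -y ^ 2 / 2) (-x) x := by
    have := ((hasDerivAt_pow 2 x).neg).div_const 2
    exact this.congr_deriv (by push_cast; ring)
  exact (h.exp.const_mul (√(2 * Real.pi))⁻¹).congr_deriv (by unfold stdPDF; ring)

lemma Phi_eq_integral (x : ℝ) : Phi x = ∫ t in Iic x, stdPDF t := by
  rw [Phi, cdf_eq_real, measureReal_def, gaussianReal_apply_eq_integral _ one_ne_zero,
    gaussianPDFReal_eq_stdPDF, ENNReal.toReal_ofReal]
  exact integral_nonneg fun t => (stdPDF_pos t).le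

lemma hasDerivAt_integral_Iic {f : ℝ → ℝ} (hf : Integrable f) (hc : Continuous f) (x : ℝ) :
    HasDerivAt (fun y => ∫ t in Iic y, f t) (f x) x := by
  have h := (intervalIntegral.integral_hasDerivAt_right (a := 0) (b := x)
    hf.intervalIntegrable (hc.stronglyMeasurableAtFilter _ _) hc.continuousAt).const_add
      (∫ t in Iic 0, f t)
  refine h.congr_of_eventuallyEq (Eventually.of_forall fun y => ?_)
  have := intervalIntegral.integral_Iic_sub_Iic (a := 0) (b := y) hf.integrableOn hf.integrableOn
  simp only
  linarith

lemma hasDerivAt_Phi (x : ℝ) : HasDerivAt Phi (stdPDF x) x := by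
  have : Phi = fun y => ∫ t in Iic y, stdPDF t := funext Phi_eq_integral
  rw [this]
  exact hasDerivAt_integral_Iic integrable_stdPDF continuous_stdPDF x

lemma continuous_Phi : Continuous Phi :=
  continuous_iff_continuousAt.2 fun x => (hasDerivAt_Phi x).continuousAt

lemma tendsto_Phi_atBot : Tendsto Phi atBot (𝓝 0) := tendsto_cdf_atBot _

lemma tendsto_Phi_atTop : Tendsto Phi atTop (𝓝 1) := tendsto_cdf_atTop _

lemma pos_of_hasDerivAt_of_tendsto_atBot {f f' : ℝ → ℝ} (hf : ∀ x, HasDerivAt f (f' x) x)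
    (hf' : ∀ x, 0 < f' x) (h0 : Tendsto f atBot (𝓝 0)) (x : ℝ) : 0 < f x := by
  have hm : StrictMono f := strictMono_of_deriv_pos fun x => by rw [(hf x).deriv]; exact hf' x
  have h1 : 0 ≤ f (x - 1) := by
    refine le_of_tendsto h0 ?_
    filter_upwards [eventually_le_atBot (x - 1)] with y hy using hm.monotone hy
  exact h1.trans_lt (hm (by linarith))

lemma Phi_pos (x : ℝ) : 0 < Phi x :=
  pos_of_hasDerivAt_of_tendsto_atBot hasDerivAt_Phi stdPDF_pos tendsto_Phi_atBot x

lemma Phi_le_one (x : ℝ) : Phi x ≤ 1 := cdf_le_one _ _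

lemma stdPDF_neg (x : ℝ) : stdPDF (-x) = stdPDF x := by simp [stdPDF]

lemma Phi_neg (x : ℝ) : Phi (-x) = 1 - Phi x := by
  have h1 : Phi (-x) = ∫ t in Ioi x, stdPDF t := by
    rw [Phi_eq_integral, ← integral_comp_neg_Ioi]
    simp [stdPDF_neg]
  have h2 : (∫ t in Iic x, stdPDF t) + ∫ t in Ioi x, stdPDF t = 1 := by
    rw [← compl_Iic, integral_add_compl measurableSet_Iic integrable_stdPDF,
      ← gaussianPDFReal_eq_stdPDF, integral_gaussianPDFReal_eq_one _ one_ne_zero]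
  rw [h1, Phi_eq_integral]; linarith

lemma Phi_zero : Phi 0 = 1 / 2 := by
  have := Phi_neg 0
  rw [neg_zero] at this; linarith

lemma tendsto_mul_stdPDF_atBot : Tendsto (fun x => x * stdPDF x) atBot (𝓝 0) := by
  have h : Tendsto (fun x : ℝ => x * Real.exp (-(1 / 2) * x ^ 2)) atTop (𝓝 0) := by
    have := (rexp_neg_quadratic_isLittleO_rpow_atTop (a := -(1 / 2)) (by norm_num) 0 (-1))
    have h2 := this.tendsto_div_nhds_zero
    refine h2.congr' ?_
    filter_upwards [eventually_gt_atTop 0] with x hx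
    rw [Real.rpow_neg_one]; simp; ring
  have h2 := (h.comp tendsto_neg_atBot_atTop).const_mul (-(√(2 * Real.pi))⁻¹)
  rw [mul_zero] at h2
  refine h2.congr fun x => ?_
  simp only [Function.comp, stdPDF]
  rw [show -(1 / 2) * (-x) ^ 2 = -x ^ 2 / 2 by ring]; ring

lemma tendsto_stdPDF_atBot : Tendsto stdPDF atBot (𝓝 0) := by
  have h : Tendsto (fun x : ℝ => x⁻¹ * (x * stdPDF x)) atBot (𝓝 (0 * 0)) :=
    tendsto_inv_atBot_zero.mul tendsto_mul_stdPDF_atBot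
  rw [mul_zero] at h
  refine h.congr' ?_
  filter_upwards [eventually_lt_atBot 0] with x hx
  rw [inv_mul_cancel_left₀ hx.ne]

lemma integrable_neg_mul_stdPDF : Integrable fun t => -t * stdPDF t := by
  have := (integrable_mul_exp_neg_mul_sq (b := 1 / 2) (by norm_num)).const_mul
    (-(√(2 * Real.pi))⁻¹)
  refine this.congr (Eventually.of_forall fun t => ?_)
  simp only [stdPDF]
  rw [show -(1 / 2) * t ^ 2 = -t ^ 2 / 2 by ring]; ring

lemma integral_Iic_neg_mul_stdPDF (x : ℝ) : ∫ t in Iic x, -t * stdPDF t = stdPDF x := by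
  rw [integral_Iic_of_hasDerivAt_of_tendsto' (fun t _ => hasDerivAt_stdPDF t) integrable_neg_mul_stdPDF.integrableOn
    tendsto_stdPDF_atBot, sub_zero]

/-- `φ(x)` is the integral of `-t φ(t)` up to `x`, and `-x ≤ -t` on that range. -/
lemma neg_mul_Phi_le_stdPDF (x : ℝ) : -x * Phi x ≤ stdPDF x := by
  rw [Phi_eq_integral, ← integral_Iic_neg_mul_stdPDF, ← integral_const_mul]
  refine setIntegral_mono_on (integrable_stdPDF.const_mul _).integrableOn integrable_neg_mul_stdPDF.integrableOn
    measurableSet_Iic fun t ht => ?_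
  exact mul_le_mul_of_nonneg_right (neg_le_neg ht) (stdPDF_pos t).le

/-- The difference of the two sides vanishes at `-∞` and has the positive derivative `2 φ / (1 +
x²)²`. This is the other half of Mills' inequality. -/
lemma stdPDF_mul_lt_Phi (x : ℝ) : stdPDF x * (-x / (1 + x ^ 2)) < Phi x := by
  have hd : ∀ x, HasDerivAt (fun x => Phi x - stdPDF x * (-x / (1 + x ^ 2)))
      (2 * stdPDF x / (1 + x ^ 2) ^ 2) x := fun x => by
    have h1 : HasDerivAt (fun x : ℝ => 1 + x ^ 2) (2 * x) x := by
      simpa using (hasDerivAt_pow 2 x).const_add 1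
    have h2 := ((hasDerivAt_id x).neg).div h1 (by positivity)
    refine ((hasDerivAt_Phi x).sub ((hasDerivAt_stdPDF x).mul h2)).congr_deriv ?_
    simp only [id, Pi.neg_apply, Pi.div_apply]
    field_simp
    ring
  have hl : Tendsto (fun x => stdPDF x * (-x / (1 + x ^ 2))) atBot (𝓝 0) := by
    have h := tendsto_mul_stdPDF_atBot.norm
    rw [norm_zero] at h
    refine squeeze_zero_norm (fun x => ?_) h
    rw [norm_mul, norm_mul, norm_div, norm_neg, mul_comm]
    gcongr
    refine div_le_self (norm_nonneg _) ?_
    rw [Real.norm_eq_abs, abs_of_pos (by positivity)]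
    nlinarith [sq_nonneg x]
  have := pos_of_hasDerivAt_of_tendsto_atBot hd (fun x => by have := stdPDF_pos x; positivity)
    (by simpa using tendsto_Phi_atBot.sub hl) x
  linarith

lemma revHazard_nonneg (x : ℝ) : 0 ≤ revHazard x := by
  have := stdPDF_pos x; have := Phi_pos x; unfold revHazard; positivity

lemma neg_le_revHazard (x : ℝ) : -x ≤ revHazard x :=
  (le_div_iff₀ (Phi_pos x)).2 (neg_mul_Phi_le_stdPDF x)

lemma revHazard_lt_of_neg {x : ℝ} (hx : x < 0) : revHazard x < -x + (-x)⁻¹ := by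
  have h := stdPDF_mul_lt_Phi x
  rw [revHazard, div_lt_iff₀ (Phi_pos x)]
  have h2 : (-x + (-x)⁻¹) * (-x / (1 + x ^ 2)) = 1 := by
    have : x ≠ 0 := hx.ne
    field_simp
    ring
  have h3 : 0 < -x + (-x)⁻¹ := by have : 0 < -x := by linarith
                                  positivity
  calc stdPDF x = (-x + (-x)⁻¹) * (stdPDF x * (-x / (1 + x ^ 2))) := by
        rw [mul_left_comm, h2, mul_one]
    _ < _ := mul_lt_mul_of_pos_left h h3

lemma hasDerivAt_revHazard (x : ℝ) :
    HasDerivAt revHazard (-(revHazard x) * (x + revHazard x)) x := by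
  refine ((hasDerivAt_stdPDF x).div (hasDerivAt_Phi x) (Phi_pos x).ne').congr_deriv ?_
  have := Phi_pos x
  unfold revHazard
  field_simp
  ring

/-- The derivative is `-h (x + h)` for `h = φ/Φ`, and Mills' inequality says `x + h ≥ 0`. This is
the log-concavity of `Φ`, since `h = (log Φ)'`. -/
lemma antitone_revHazard : Antitone revHazard :=
  antitone_of_deriv_nonpos (fun x => (hasDerivAt_revHazard x).differentiableAt) fun x => by
    rw [(hasDerivAt_revHazard x).deriv]
    have := neg_le_revHazard x
    have := revHazard_nonneg x
    nlinarith

/-- A crude bound, uniform in `x`: the reversed hazard stays within `2` of the negative part of `x`,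
an error that disappears after division by a scale tending to infinity. -/
lemma revHazard_le (x : ℝ) : revHazard x ≤ max (-x) 0 + 2 := by
  rcases le_total x (-1) with h | h
  · have h1 := revHazard_lt_of_neg (x := x) (by linarith)
    have h2 : (-x)⁻¹ ≤ 1 := inv_le_one_of_one_le₀ (by linarith)
    have := le_max_left (-x) 0
    linarith
  · have h1 := revHazard_lt_of_neg (x := -1) (by norm_num)
    have h2 := antitone_revHazard h
    norm_num at h1
    have := le_max_right (-x) 0
    linarith

lemma max_neg_zero_le_revHazard (x : ℝ) : max (-x) 0 ≤ revHazard x :=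
  max_le (neg_le_revHazard x) (revHazard_nonneg x)

/-- Log-concavity of `Φ`, as a bound by the exponential of the tangent of `log Φ`. -/
lemma Phi_add_le (m δ : ℝ) : Phi (m + δ) ≤ Phi m * Real.exp (δ * revHazard m) := by
  have hd : ∀ x, HasDerivAt (fun y => Real.log (Phi y)) (revHazard x) x := fun x =>
    (hasDerivAt_Phi x).log (Phi_pos x).ne'
  have key : Real.log (Phi (m + δ)) - Real.log (Phi m) ≤ δ * revHazard m := by
    rcases lt_trichotomy δ 0 with h | rfl | h
    · obtain ⟨c, hc, h1⟩ := exists_hasDerivAt_eq_slope (fun y => Real.log (Phi y)) revHazard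
        (show m + δ < m by linarith) (fun x _ => (hd x).continuousAt.continuousWithinAt)
        fun x _ => hd x
      have h2 := antitone_revHazard hc.2.le
      rw [eq_div_iff (by linarith)] at h1
      nlinarith
    · simp
    · obtain ⟨c, hc, h1⟩ := exists_hasDerivAt_eq_slope (fun y => Real.log (Phi y)) revHazard
        (show m < m + δ by linarith) (fun x _ => (hd x).continuousAt.continuousWithinAt)
        fun x _ => hd x
      have h2 := antitone_revHazard hc.1.le
      rw [eq_div_iff (by linarith)] at h1
      nlinarith
  have h0 := Phi_pos m
  rw [← Real.log_le_log_iff (Phi_pos _) (mul_pos h0 (Real.exp_pos _)),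
    Real.log_mul h0.ne' (Real.exp_pos _).ne', Real.log_exp]
  linarith

lemma tendsto_Phi_mul_neg_div_stdPDF :
    Tendsto (fun x => Phi x * -x / stdPDF x) atBot (𝓝 1) := by
  have hl : Tendsto (fun x : ℝ => (-x) / (-x + (-x)⁻¹)) atBot (𝓝 1) := by
    have h : Tendsto (fun x : ℝ => 1 / (1 + x⁻¹ * x⁻¹)) atBot (𝓝 (1 / (1 + 0 * 0))) :=
      tendsto_const_nhds.div (tendsto_const_nhds.add
        (tendsto_inv_atBot_zero.mul tendsto_inv_atBot_zero)) (by norm_num)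
    rw [mul_zero, add_zero, div_one] at h
    refine h.congr' ?_
    filter_upwards [eventually_lt_atBot 0] with x hx
    have := hx.ne
    have h1 : -x + (-x)⁻¹ ≠ 0 := by
      have h3 : 0 < -x := by linarith
      have : 0 < -x + (-x)⁻¹ := by positivity
      exact this.ne'
    rw [div_eq_div_iff (by nlinarith [mul_self_nonneg x⁻¹]) h1]
    field_simp
    ring
  refine tendsto_of_tendsto_of_tendsto_of_le_of_le' hl tendsto_const_nhds ?_ ?_
  · filter_upwards [eventually_lt_atBot 0] with x hx
    have h1 := revHazard_lt_of_neg hx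
    have h3 : 0 < -x := by linarith
    have h4 := Phi_pos x
    have h5 := stdPDF_pos x
    rw [revHazard, div_lt_iff₀ h4] at h1
    rw [div_le_div_iff₀ (by positivity) h5]
    nlinarith
  · filter_upwards with x
    have := neg_mul_Phi_le_stdPDF x
    rw [div_le_one (stdPDF_pos x)]; linarith

/-! ### Laplace's method for a Gaussian kernel times `Φ`. -/

section Laplace

variable {ι : Type*} {l : Filter ι} {s : ι → ℝ}

lemma tendsto_revHazard_div (hs : Tendsto s l atTop) {m : ι → ℝ} {b : ℝ}
    (hm : Tendsto (fun n => m n / s n) l (𝓝 (-b))) :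
    Tendsto (fun n => revHazard (m n) / s n) l (𝓝 (max b 0)) := by
  have h1 : Tendsto (fun n => max (-(m n / s n)) 0) l (𝓝 (max b 0)) := by
    simpa using hm.neg.max tendsto_const_nhds
  have h2 : Tendsto (fun n => max (-(m n / s n)) 0 + 2 / s n) l (𝓝 (max b 0)) := by
    simpa using h1.add (hs.const_div_atTop 2)
  have h3 : ∀ᶠ n in l, max (-m n) 0 / s n = max (-(m n / s n)) 0 := by
    filter_upwards [hs.eventually_gt_atTop 0] with n hn
    rw [← max_div_div_right hn.le, neg_div, zero_div]
  refine tendsto_of_tendsto_of_tendsto_of_le_of_le' h1 h2 ?_ ?_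
  · filter_upwards [h3, hs.eventually_gt_atTop 0] with n h3 hn
    rw [← h3]
    exact div_le_div_of_nonneg_right (max_neg_zero_le_revHazard _) hn.le
  · filter_upwards [h3, hs.eventually_gt_atTop 0] with n h3 hn
    rw [← h3, ← add_div]
    exact div_le_div_of_nonneg_right (revHazard_le _) hn.le

/-- The tangent bound for `log Φ` taken at `m` bounds the ratio above; taken at `m + δ` with
increment `-δ` it bounds it below. Both exponents have the same limit, so no distinction on the sign
of `b` is needed. -/
lemma tendsto_Phi_add_div_Phi (hs : Tendsto s l atTop) {m δ : ι → ℝ} {b d : ℝ}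
    (hm : Tendsto (fun n => m n / s n) l (𝓝 (-b)))
    (hδ : Tendsto (fun n => δ n * s n) l (𝓝 d)) :
    Tendsto (fun n => Phi (m n + δ n) / Phi (m n)) l (𝓝 (Real.exp (d * max b 0))) := by
  have hm' : Tendsto (fun n => (m n + δ n) / s n) l (𝓝 (-b)) := by
    have h := hm.add ((hδ.mul (hs.const_div_atTop 1)).mul (hs.const_div_atTop 1))
    simp only [mul_zero, add_zero] at h
    refine h.congr' ?_
    filter_upwards [hs.eventually_gt_atTop 0] with n hn
    field_simp
  have e : ∀ m' : ι → ℝ, ∀ᶠ n in l, δ n * s n * (revHazard (m' n) / s n)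
      = δ n * revHazard (m' n) := fun m' => by
    filter_upwards [hs.eventually_gt_atTop 0] with n hn
    field_simp
  have h1 := ((hδ.mul (tendsto_revHazard_div hs hm)).congr' (e m)).rexp
  have h2 := ((hδ.mul (tendsto_revHazard_div hs hm')).congr' (e _)).rexp
  refine tendsto_of_tendsto_of_tendsto_of_le_of_le h2 h1 (fun n => ?_) fun n => ?_
  · have h := Phi_add_le (m n + δ n) (-δ n)
    rw [add_neg_cancel_right, neg_mul, Real.exp_neg, ← div_eq_mul_inv,
      le_div_iff₀ (Real.exp_pos _)] at h
    rw [le_div_iff₀ (Phi_pos _)]; linarith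
  · rw [div_le_iff₀ (Phi_pos _), mul_comm]
    exact Phi_add_le _ _

/-- A Gaussian kernel with mean `μ` and variance `r`, times `Φ` of an affine function. -/
noncomputable def skewKernel (r μ a p t : ℝ) : ℝ :=
  Real.exp (-(t - μ) ^ 2 / (2 * r)) * Phi (a * t + p)

lemma skewKernel_pos (r μ a p t : ℝ) : 0 < skewKernel r μ a p t :=
  mul_pos (Real.exp_pos _) (Phi_pos _)

lemma continuous_skewKernel (r μ a p : ℝ) : Continuous (skewKernel r μ a p) := by
  unfold skewKernel
  have := continuous_Phi
  fun_prop

lemma integrable_skewKernel {r : ℝ} (hr : 0 < r) (μ a p : ℝ) :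
    Integrable (skewKernel r μ a p) := by
  have h := (integrable_exp_neg_mul_sq (b := (2 * r)⁻¹) (by positivity)).comp_sub_right μ
  refine h.mono' (continuous_skewKernel _ _ _ _).aestronglyMeasurable
    (Eventually.of_forall fun t => ?_)
  rw [Real.norm_of_nonneg (skewKernel_pos _ _ _ _ _).le, skewKernel]
  refine (mul_le_of_le_one_right (Real.exp_pos _).le (Phi_le_one _)).trans_eq ?_
  congr 1; field_simp

lemma skewKernel_sub_eq {r : ℝ} (hr : 0 < r) (μ a p x w : ℝ) :
    skewKernel r μ a p (x - w) = Real.exp ((x - μ) / r * w - w ^ 2 / (2 * r)) *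
      (Phi (a * x + p + -a * w) / Phi (a * x + p)) * skewKernel r μ a p x := by
  have h := (Phi_pos (a * x + p)).ne'
  unfold skewKernel
  rw [show a * (x - w) + p = a * x + p + -a * w by ring]
  have h2 : -(x - w - μ) ^ 2 / (2 * r)
      = ((x - μ) / r * w - w ^ 2 / (2 * r)) + -(x - μ) ^ 2 / (2 * r) := by
    field_simp; ring
  rw [h2, Real.exp_add]
  generalize Phi (a * x + p + -a * w) = y
  generalize Phi (a * x + p) = z at h
  field_simp

/-- The substitution `t = x - v / s` moves the endpoint to `0` and magnifies its neighbourhood by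
`s`. -/
lemma integral_Iic_skewKernel (r μ a p x : ℝ) {s : ℝ} (hs : 0 < s) :
    s * ∫ t in Iic x, skewKernel r μ a p t
      = ∫ v in Ioi (0 : ℝ), skewKernel r μ a p (x - v / s) := by
  have h1 : ∫ t in Iic x, skewKernel r μ a p t
      = ∫ w in Ioi (0 : ℝ), skewKernel r μ a p (x - w) := by
    rw [← integral_Ici_eq_integral_Ioi, ← integral_indicator measurableSet_Iic,
      ← integral_indicator measurableSet_Ici, ← integral_sub_left_eq_self _ volume x]
    congr 1 with w
    simp [indicator]
  have h2 := integral_comp_mul_left_Ioi (fun w => skewKernel r μ a p (x - w)) 0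
    (inv_pos.2 hs)
  simp only [inv_inv, mul_zero, smul_eq_mul] at h2
  rw [h1, ← h2]
  simp only [div_eq_inv_mul]

/-- Laplace's method at the endpoint of a half-line. -/
lemma tendsto_integral_Iic_skewKernel [l.IsCountablyGenerated] (hs : Tendsto s l atTop)
    {x μ p : ι → ℝ} {r a A b : ℝ} (hr : 0 < r)
    (hA : Tendsto (fun n => (x n - μ n) / r / s n) l (𝓝 (-A)))
    (hb : Tendsto (fun n => (a * x n + p n) / s n) l (𝓝 (-b))) (hB : 0 < A + a * max b 0) :
    Tendsto (fun n => s n * (∫ t in Iic (x n), skewKernel r (μ n) a (p n) t) /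
      skewKernel r (μ n) a (p n) (x n)) l (𝓝 (1 / (A + a * max b 0))) := by
  set B := A + a * max b 0 with hBdef
  have hlim : ∫ v in Ioi (0 : ℝ), Real.exp (-B * v) = 1 / B := by
    rw [integral_exp_mul_Ioi (by linarith)]; simp
  rw [← hlim]
  have hint : ∀ᶠ n in l, ∫ v in Ioi (0 : ℝ), skewKernel r (μ n) a (p n) (x n - v / s n) /
      skewKernel r (μ n) a (p n) (x n) = s n * (∫ t in Iic (x n), skewKernel r (μ n) a (p n) t) /
      skewKernel r (μ n) a (p n) (x n) := by
    filter_upwards [hs.eventually_gt_atTop 0] with n hn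
    rw [integral_Iic_skewKernel _ _ _ _ _ hn, integral_div]
  refine Tendsto.congr' hint ?_
  have hratio : ∀ n v, skewKernel r (μ n) a (p n) (x n - v / s n) /
      skewKernel r (μ n) a (p n) (x n) =
      Real.exp ((x n - μ n) / r / s n * v - (1 / s n * v) ^ 2 / (2 * r)) *
      (Phi (a * x n + p n + -a * v / s n) / Phi (a * x n + p n)) := fun n v => by
    rw [skewKernel_sub_eq hr, mul_div_cancel_right₀ _ (skewKernel_pos _ _ _ _ _).ne']
    congr 2
    · rw [one_div_mul_eq_div]; congr 1; ring
    · congr 1; ring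
  -- This is the exponent of the upper bound for the rescaled kernel. Its limit is `-B`, so it is
  -- eventually below `-B/2`, which yields a fixed integrable majorant.
  have hexp : Tendsto (fun n => (x n - μ n) / r / s n +
      -a * (revHazard (a * x n + p n) / s n)) l (𝓝 (-B)) := by
    convert hA.add ((tendsto_revHazard_div hs hb).const_mul (-a)) using 2
    rw [hBdef]; ring
  refine tendsto_integral_filter_of_dominated_convergence (fun v => Real.exp (-(B / 2) * v))
    ?_ ?_ ?_ ?_
  · refine Eventually.of_forall fun n => Continuous.aestronglyMeasurable ?_
    have := continuous_skewKernel r (μ n) a (p n)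
    fun_prop
  · filter_upwards [hexp.eventually_lt_const (show -B < -(B / 2) by linarith),
      hs.eventually_gt_atTop 0] with n hn hsn
    filter_upwards [ae_restrict_mem measurableSet_Ioi] with v hv
    have hv : 0 < v := hv
    rw [Real.norm_of_nonneg (div_pos (skewKernel_pos _ _ _ _ _) (skewKernel_pos _ _ _ _ _)).le,
      hratio]
    have h1 := Phi_add_le (a * x n + p n) (-a * v / s n)
    rw [mul_comm (Phi _), ← div_le_iff₀ (Phi_pos _)] at h1
    calc _ ≤ Real.exp ((x n - μ n) / r / s n * v) *
          Real.exp (-a * v / s n * revHazard (a * x n + p n)) := by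
          have : 0 ≤ (1 / s n * v) ^ 2 / (2 * r) := by positivity
          exact mul_le_mul (Real.exp_le_exp.2 (by linarith)) h1
            (div_pos (Phi_pos _) (Phi_pos _)).le (Real.exp_pos _).le
      _ ≤ _ := by
          rw [← Real.exp_add]
          refine Real.exp_le_exp.2 ?_
          have := mul_lt_mul_of_pos_right hn hv
          refine le_trans (le_of_eq ?_) this.le
          ring
  · exact (integrableOn_exp_mul_Ioi (by linarith) 0)
  · refine Eventually.of_forall fun v => ?_
    simp_rw [hratio]
    have h1 : Tendsto (fun n => (x n - μ n) / r / s n * v - (1 / s n * v) ^ 2 / (2 * r)) l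
        (𝓝 (-A * v - (0 * v) ^ 2 / (2 * r))) :=
      (hA.mul_const v).sub ((((hs.const_div_atTop 1).mul_const v).pow 2).div_const _)
    have h2 := tendsto_Phi_add_div_Phi hs hb (δ := fun n => -a * v / s n) (d := -a * v) (by
      refine tendsto_const_nhds.congr' ?_
      filter_upwards [hs.eventually_gt_atTop 0] with n hn
      field_simp)
    convert h1.rexp.mul h2 using 2
    rw [← Real.exp_add]
    congr 1
    rw [hBdef]; ring

end Laplace

/-! ### Total mass of the kernel and the marginal densities. -/

lemma gaussianReal_real_Iic (m : ℝ) {v : NNReal} (hv : v ≠ 0) (x : ℝ) :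
    (gaussianReal m v).real (Iic x) = Phi ((x - m) / √v) := by
  have hv' : (0 : ℝ) < √v := Real.sqrt_pos.2 (by positivity)
  have h : (gaussianReal 0 1).map (fun y => m + √v * y) = gaussianReal m v := by
    have h1 := gaussianReal_map_const_mul (μ := 0) (v := 1) (√v)
    have h2 := gaussianReal_map_const_add (μ := √v * 0) (v := NNReal.mk (√v ^ 2) (sq_nonneg _) * 1) m
    rw [← h1, Measure.map_map (by fun_prop) (by fun_prop)] at h2
    rw [show (fun y => m + √v * y) = (fun y => m + y) ∘ (fun y => √v * y) from rfl, h2]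
    congr 1
    · simp
    · ext; simp
  rw [← h, map_measureReal_apply (by fun_prop) measurableSet_Iic, Phi, cdf_eq_real]
  congr 1
  ext y
  simp only [mem_preimage, mem_Iic]
  rw [le_div_iff₀ hv']
  constructor <;> intro h <;> linarith

/-- For independent `T ∼ N(m, v)` and `N ∼ N(0, 1)` the integral is `P(N ≤ aT + p) = P(-aT + N ≤
p)`, and `-aT + N` is Gaussian with mean `-am` and variance `a²v + 1`. -/
lemma integral_Phi_affine_gaussianReal (m : ℝ) (v : NNReal) (a p : ℝ) :
    ∫ t, Phi (a * t + p) ∂(gaussianReal m v) = Phi ((a * m + p) / √(1 + a ^ 2 * v)) := by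
  have h1 := gaussianReal_map_const_mul (μ := m) (v := v) (-a)
  have h2 := gaussianReal_conv_gaussianReal (m₁ := -a * m) (v₁ := NNReal.mk ((-a) ^ 2) (sq_nonneg _) * v)
    (m₂ := 0) (v₂ := 1)
  have h3 := gaussianReal_real_Iic (-a * m + 0) (v := NNReal.mk ((-a) ^ 2) (sq_nonneg _) * v + 1)
    (by positivity) p
  rw [← h2, ← h1, Measure.conv, map_measureReal_apply (by fun_prop) measurableSet_Iic,
    measureReal_def, Measure.prod_apply (measurableSet_Iic.preimage (by fun_prop)),
    lintegral_map (measurable_measure_prodMk_left (measurableSet_Iic.preimage (by fun_prop)))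
      (by fun_prop)] at h3
  rw [integral_eq_lintegral_of_nonneg_ae (Eventually.of_forall fun t => (Phi_pos _).le)
    (by have := continuous_Phi; fun_prop)]
  convert h3 using 3
  · ext t
    rw [Phi, ofReal_cdf]
    congr 1
    ext y
    simp only [mem_preimage, mem_Iic]
    constructor <;> intro h <;> linarith
  · ring
  · congr 1
    push_cast
    simp
    ring

/-- The total mass of a Gaussian kernel times `Φ` of an affine function. -/
lemma integral_skewKernel {r : ℝ} (hr : 0 < r) (μ a p : ℝ) :
    ∫ t, skewKernel r μ a p t = √(2 * Real.pi * r) * Phi ((a * μ + p) / √(1 + a ^ 2 * r)) := by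
  have h := integral_Phi_affine_gaussianReal μ (NNReal.mk r hr.le) a p
  rw [integral_gaussianReal_eq_integral_smul (v := NNReal.mk r hr.le)
    fun h0 => hr.ne' (congrArg NNReal.toReal h0)] at h
  simp only [NNReal.coe_mk] at h
  rw [← h, ← integral_const_mul]
  congr 1 with t
  have : √(2 * Real.pi * r) ≠ 0 := by positivity
  simp only [gaussianPDFReal, NNReal.coe_mk, skewKernel, smul_eq_mul]
  field_simp

variable {α : Fin 2 → ℝ} {ρ : ℝ}

lemma one_sub_sq_pos (hρ₁ : -1 < ρ) (hρ₂ : ρ < 1) : 0 < 1 - ρ ^ 2 := by nlinarith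

/-- Completing the square in `t`: given the other coordinate `y`, the Gaussian part has mean `ρ y`
and variance `1 - ρ²`. -/
lemma density_point (hr : 0 < 1 - ρ ^ 2) (i : Fin 2) (t y : ℝ) :
    density α ρ (point i t y) = 1 / (Real.pi * √(1 - ρ ^ 2)) * Real.exp (-y ^ 2 / 2) *
      skewKernel (1 - ρ ^ 2) (ρ * y) (α i) (α (1 - i) * y) t := by
  have h : -(t ^ 2 - 2 * ρ * t * y + y ^ 2) / (2 * (1 - ρ ^ 2))
      = -y ^ 2 / 2 + -(t - ρ * y) ^ 2 / (2 * (1 - ρ ^ 2)) := by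
    field_simp; ring
  have h' : -(y ^ 2 - 2 * ρ * y * t + t ^ 2) / (2 * (1 - ρ ^ 2))
      = -y ^ 2 / 2 + -(t - ρ * y) ^ 2 / (2 * (1 - ρ ^ 2)) := by
    rw [← h]; ring
  fin_cases i
  · simp only [density, phi2, skewKernel, point, Fin.isValue, Fin.zero_eta, if_true, one_ne_zero,
      if_false, h, Real.exp_add, sub_zero]
    field_simp
  · simp only [density, phi2, skewKernel, point, Fin.isValue, Fin.mk_one, if_true, zero_ne_one,
      if_false, h', Real.exp_add, sub_self]
    rw [add_comm (α 0 * y)]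
    field_simp

lemma point_one_sub (i : Fin 2) (x y : ℝ) : point (1 - i) x y = point i y x := by
  ext k; fin_cases i <;> fin_cases k <;> simp [point]

/-- The density of the skew normal distribution with parameter `l`. -/
noncomputable def skewPDF (l y : ℝ) : ℝ := 2 * stdPDF y * Phi (l * y)

lemma skewPDF_pos (l y : ℝ) : 0 < skewPDF l y := by
  have := stdPDF_pos y; have := Phi_pos (l * y); unfold skewPDF; positivity

lemma continuous_skewPDF (l : ℝ) : Continuous (skewPDF l) := by
  have := continuous_stdPDF; have := continuous_Phi; unfold skewPDF; fun_prop

lemma skewPDF_eq (l y : ℝ) : skewPDF l y = 2 / √(2 * Real.pi) * skewKernel 1 0 l 0 y := by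
  simp only [skewPDF, stdPDF, skewKernel, sub_zero, add_zero, mul_one]; ring

lemma integrable_skewPDF (l : ℝ) : Integrable (skewPDF l) := by
  have : skewPDF l = fun y => 2 / √(2 * Real.pi) * skewKernel 1 0 l 0 y :=
    funext (skewPDF_eq l)
  rw [this]
  exact (integrable_skewKernel one_pos _ _ _).const_mul _

/-- The marginal densities of the bivariate skew normal distribution. -/
lemma integral_density_point (hr : 0 < 1 - ρ ^ 2) (i : Fin 2) (y : ℝ) :
    ∫ t, density α ρ (point i t y) = skewPDF (lam α ρ (1 - i)) y := by
  simp_rw [density_point hr]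
  rw [integral_const_mul, integral_skewKernel hr, skewPDF, stdPDF, lam, sub_sub_cancel]
  rw [show (α i * (ρ * y) + α (1 - i) * y) / √(1 + α i ^ 2 * (1 - ρ ^ 2))
    = (α (1 - i) + ρ * α i) / √(1 + α i ^ 2 * (1 - ρ ^ 2)) * y by ring]
  rw [Real.sqrt_mul (by positivity)]
  have h1 : √(1 - ρ ^ 2) ≠ 0 := by positivity
  rw [← Real.sqrt_div_self (x := 2 * Real.pi)]
  field_simp

/-! ### The joint distribution function and its differentiability. -/

variable {α : Fin 2 → ℝ} {ρ : ℝ}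

lemma density_nonneg (z : Fin 2 → ℝ) : 0 ≤ density α ρ z := by
  have := Phi_pos (α 0 * z 0 + α 1 * z 1)
  unfold density phi2; positivity

lemma continuous_density : Continuous (density α ρ) := by
  have := continuous_Phi
  unfold density phi2; fun_prop

lemma continuous_point (i : Fin 2) : Continuous fun p : ℝ × ℝ => point i p.1 p.2 := by
  refine continuous_pi fun k => ?_
  unfold point
  split_ifs <;> fun_prop

/-- A product function dominating the density. -/
noncomputable def densityBound (ρ x y : ℝ) : ℝ :=
  1 / (Real.pi * √(1 - ρ ^ 2)) * Real.exp (-(1 / 4) * x ^ 2) * Real.exp (-(1 / 4) * y ^ 2)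

/-- The eigenvalues `1 / (1 ± ρ)` of `R⁻¹` are at least `1/2`, so the exponent of the normal density
is at most `-(x² + y²) / 4`; the factor `Φ` is at most `1`. -/
lemma density_le (hρ₁ : -1 < ρ) (hρ₂ : ρ < 1) (i : Fin 2) (x y : ℝ) :
    density α ρ (point i x y) ≤ densityBound ρ x y := by
  have hr := one_sub_sq_pos hρ₁ hρ₂
  rw [density_point hr, densityBound, mul_assoc, mul_assoc]
  refine mul_le_mul_of_nonneg_left ?_ (by positivity)
  rw [skewKernel, ← mul_assoc, ← Real.exp_add, ← Real.exp_add]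
  refine (mul_le_of_le_one_right (Real.exp_pos _).le (Phi_le_one _)).trans
    (Real.exp_le_exp.2 ?_)
  have h1 : -y ^ 2 / 2 + -(x - ρ * y) ^ 2 / (2 * (1 - ρ ^ 2)) =
    -(x ^ 2 - 2 * ρ * x * y + y ^ 2) / (2 * (1 - ρ ^ 2)) := by field_simp; ring
  rw [h1, div_le_iff₀ (by positivity)]
  nlinarith [sq_nonneg (x - ρ * y), sq_nonneg (y - ρ * x), mul_nonneg (sq_nonneg (x + y))
    (sub_nonneg.2 hρ₂.le), mul_nonneg (sq_nonneg (x - y)) (by linarith : 0 ≤ 1 + ρ),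
    mul_nonneg (sq_nonneg ρ) (sq_nonneg x), mul_nonneg (sq_nonneg ρ) (sq_nonneg y)]

lemma integrable_exp_neg_quarter : Integrable fun x : ℝ => Real.exp (-(1 / 4) * x ^ 2) :=
  integrable_exp_neg_mul_sq (by norm_num)

lemma integrable_density_point (hρ₁ : -1 < ρ) (hρ₂ : ρ < 1) (i : Fin 2) :
    Integrable (fun p : ℝ × ℝ => density α ρ (point i p.1 p.2)) (volume.prod volume) := by
  have h : Integrable (fun p : ℝ × ℝ => densityBound ρ p.1 p.2) (volume.prod volume) :=
    (integrable_exp_neg_quarter.const_mul _).mul_prod integrable_exp_neg_quarter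
  refine h.mono' (continuous_density.comp (continuous_point i)).aestronglyMeasurable
    (Eventually.of_forall fun p => ?_)
  rw [Real.norm_of_nonneg (density_nonneg _)]
  exact density_le hρ₁ hρ₂ i _ _

lemma law_real_rect (hρ₁ : -1 < ρ) (hρ₂ : ρ < 1) (i : Fin 2) {A B : Set ℝ}
    (hA : MeasurableSet A) (hB : MeasurableSet B) :
    (law α ρ).real {z | z i ∈ A ∧ z (1 - i) ∈ B} =
      ∫ x in A, ∫ y in B, density α ρ (point i x y) := by
  have key : ∀ {A B : Set ℝ}, MeasurableSet A → MeasurableSet B →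
      (law α ρ).real {z | z 0 ∈ A ∧ z 1 ∈ B} =
      ∫ x in A, ∫ y in B, density α ρ (point 0 x y) := by
    intro A B hA hB
    have hS : {z : Fin 2 → ℝ | z 0 ∈ A ∧ z 1 ∈ B} =
        MeasurableEquiv.finTwoArrow ⁻¹' (A ×ˢ B) := by
      ext z; simp [MeasurableEquiv.finTwoArrow]
    have hm := (hA.prod hB).preimage (MeasurableEquiv.finTwoArrow (α := ℝ)).measurable
    rw [← hS] at hm
    rw [measureReal_def, law, withDensity_apply _ hm,
      ← integral_eq_lintegral_of_nonneg_ae (Eventually.of_forall density_nonneg)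
        continuous_density.aestronglyMeasurable]
    have h2 := (volume_preserving_finTwoArrow ℝ).setIntegral_preimage_emb
      (MeasurableEquiv.measurableEmbedding _)
      (fun p : ℝ × ℝ => density α ρ (point 0 p.1 p.2)) (A ×ˢ B)
    rw [hS, Measure.volume_eq_prod,
      setIntegral_prod _ (integrable_density_point hρ₁ hρ₂ 0).integrableOn] at *
    rw [← h2]
    congr! 3 with z
    ext k; fin_cases k <;> simp [point, MeasurableEquiv.finTwoArrow]
  fin_cases i
  · exact key hA hB
  · have h := key hB hA
    have h' : {z : Fin 2 → ℝ | z 1 ∈ A ∧ z 0 ∈ B} = {z | z 0 ∈ B ∧ z 1 ∈ A} := by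
      ext; exact and_comm
    simp only [Fin.mk_one, sub_self]
    rw [h', h, integral_integral_swap]
    · simp_rw [← point_one_sub (0 : Fin 2), sub_zero]
    · have := (integrable_density_point (α := α) hρ₁ hρ₂ 0).integrableOn (s := B ×ˢ A)
      rwa [IntegrableOn, ← Measure.prod_restrict] at this

/-- The integral of the density over a half-line, the `i`-th coordinate `x` being fixed. -/
noncomputable def sectionIntegral (α : Fin 2 → ℝ) (ρ : ℝ) (i : Fin 2) (x y : ℝ) : ℝ :=
  ∫ t in Iic y, density α ρ (point i x t)

/-- Joint continuity in the fixed coordinate and the upper limit makes the partial derivatives of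
the joint distribution function continuous. It follows by dominated convergence, the moving limit
being put into an indicator. -/
lemma continuous_sectionIntegral (hρ₁ : -1 < ρ) (hρ₂ : ρ < 1) (i : Fin 2) :
    Continuous fun p : ℝ × ℝ => sectionIntegral α ρ i p.1 p.2 := by
  refine continuous_iff_continuousAt.2 fun p => ?_
  have h : (fun p : ℝ × ℝ => sectionIntegral α ρ i p.1 p.2) = fun p : ℝ × ℝ =>
      ∫ t, (Iic p.2).indicator (fun t => density α ρ (point i p.1 t)) t := by
    ext p; rw [integral_indicator measurableSet_Iic]; rfl
  rw [h]
  have hc : ∀ t, Continuous fun p : ℝ × ℝ => density α ρ (point i p.1 t) := fun t =>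
    continuous_density.comp ((continuous_point i).comp (by fun_prop : Continuous
      fun p : ℝ × ℝ => (p.1, t)))
  refine continuousAt_of_dominated
    (bound := fun t => 1 / (Real.pi * √(1 - ρ ^ 2)) * Real.exp (-(1 / 4) * t ^ 2)) ?_ ?_ ?_ ?_
  · refine Eventually.of_forall fun p => ?_
    exact ((continuous_density.comp ((continuous_point i).comp (by fun_prop : Continuous
      fun t : ℝ => (p.1, t)))).aestronglyMeasurable).indicator measurableSet_Iic
  · refine Eventually.of_forall fun p => Eventually.of_forall fun t => ?_
    refine (norm_indicator_le_norm_self _ _).trans ?_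
    rw [Real.norm_of_nonneg (density_nonneg _)]
    refine (density_le hρ₁ hρ₂ i _ _).trans ?_
    unfold densityBound
    refine mul_le_mul_of_nonneg_right (mul_le_of_le_one_right (by positivity) ?_)
      (Real.exp_pos _).le
    exact Real.exp_le_one_iff.2 (by nlinarith [sq_nonneg p.1])
  · exact integrable_exp_neg_quarter.const_mul _
  -- Away from the null set `t = p.2` the indicator is locally constant in the limit of integration.
  · have h0 : ∀ᵐ t : ℝ, t ≠ p.2 := by simp [ae_iff]
    filter_upwards [h0] with t ht
    rcases lt_or_gt_of_ne ht with ht | ht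
    · refine (hc t).continuousAt.congr ?_
      filter_upwards [(continuous_snd.tendsto p).eventually (lt_mem_nhds ht)] with q hq
      rw [indicator_of_mem (show t ∈ Iic q.2 from le_of_lt hq)]
    · refine (continuousAt_const (y := (0 : ℝ))).congr ?_
      filter_upwards [(continuous_snd.tendsto p).eventually (gt_mem_nhds ht)] with q hq
      rw [indicator_of_notMem (show t ∉ Iic q.2 from not_le.2 hq)]

lemma integrable_sectionIntegral (hρ₁ : -1 < ρ) (hρ₂ : ρ < 1) (i : Fin 2) (y : ℝ) :
    Integrable fun x => sectionIntegral α ρ i x y := by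
  have := (integrable_density_point (α := α) hρ₁ hρ₂ i).integrableOn (s := univ ×ˢ Iic y)
  rw [IntegrableOn, ← Measure.prod_restrict, Measure.restrict_univ] at this
  exact this.integral_prod_left

/-- The distribution function of the law. -/
noncomputable def jointCDF (α : Fin 2 → ℝ) (ρ x y : ℝ) : ℝ :=
  (law α ρ).real {z | z 0 ≤ x ∧ z 1 ≤ y}

lemma hasDerivAt_integral_sectionIntegral (hρ₁ : -1 < ρ) (hρ₂ : ρ < 1) (i : Fin 2) (x y : ℝ) :
    HasDerivAt (fun x => ∫ s in Iic x, sectionIntegral α ρ i s y) (sectionIntegral α ρ i x y) x :=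
  hasDerivAt_integral_Iic (integrable_sectionIntegral hρ₁ hρ₂ i y)
    ((continuous_sectionIntegral hρ₁ hρ₂ i).comp (by fun_prop : Continuous fun x : ℝ => (x, y))) x

lemma hasDerivAt_jointCDF_left (hρ₁ : -1 < ρ) (hρ₂ : ρ < 1) (x y : ℝ) :
    HasDerivAt (fun x => jointCDF α ρ x y) (sectionIntegral α ρ 0 x y) x := by
  have h : (fun x => jointCDF α ρ x y) = fun x => ∫ s in Iic x, sectionIntegral α ρ 0 s y := by
    ext x
    have := law_real_rect (α := α) hρ₁ hρ₂ 0 (measurableSet_Iic (a := x))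
      (measurableSet_Iic (a := y))
    simp only [sub_zero, mem_Iic] at this
    exact this
  rw [h]
  exact hasDerivAt_integral_sectionIntegral hρ₁ hρ₂ 0 x y

lemma hasDerivAt_jointCDF_right (hρ₁ : -1 < ρ) (hρ₂ : ρ < 1) (x y : ℝ) :
    HasDerivAt (fun y => jointCDF α ρ x y) (sectionIntegral α ρ 1 y x) y := by
  have h : (fun y => jointCDF α ρ x y) = fun y => ∫ s in Iic y, sectionIntegral α ρ 1 s x := by
    ext y
    have := law_real_rect (α := α) hρ₁ hρ₂ 1 (measurableSet_Iic (a := y))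
      (measurableSet_Iic (a := x))
    simp only [sub_self, mem_Iic] at this
    simp_rw [jointCDF, and_comm (a := _ ≤ x)]
    exact this
  rw [h]
  exact hasDerivAt_integral_sectionIntegral hρ₁ hρ₂ 1 y x

/-- Continuous partial derivatives give a total derivative, as the chain rule along the quantile
curve requires. -/
lemma hasStrictFDerivAt_jointCDF (hρ₁ : -1 < ρ) (hρ₂ : ρ < 1) (u : ℝ × ℝ) :
    HasStrictFDerivAt (fun p : ℝ × ℝ => jointCDF α ρ p.1 p.2)
      ((ContinuousLinearMap.toSpanSingleton ℝ (sectionIntegral α ρ 0 u.1 u.2)).coprod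
        (ContinuousLinearMap.toSpanSingleton ℝ (sectionIntegral α ρ 1 u.2 u.1))) u := by
  have hts : Continuous fun x : ℝ => ContinuousLinearMap.toSpanSingleton ℝ x :=
    (ContinuousLinearMap.toSpanSingletonLIE ℝ ℝ).continuous
  exact hasStrictFDerivAt_uncurry_coprod (f := jointCDF α ρ)
    (f₁ := fun x y => ContinuousLinearMap.toSpanSingleton ℝ (sectionIntegral α ρ 0 x y))
    (f₂ := fun x y => ContinuousLinearMap.toSpanSingleton ℝ (sectionIntegral α ρ 1 y x))
    (Eventually.of_forall fun v => (hasDerivAt_jointCDF_left hρ₁ hρ₂ v.1 v.2).hasFDerivAt)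
    (Eventually.of_forall fun v => (hasDerivAt_jointCDF_right hρ₁ hρ₂ v.1 v.2).hasFDerivAt)
    (hts.comp (continuous_sectionIntegral hρ₁ hρ₂ 0)).continuousAt
    (hts.comp ((continuous_sectionIntegral hρ₁ hρ₂ 1).comp continuous_swap)).continuousAt

lemma condProb_eq (hr : 0 < 1 - ρ ^ 2) (i : Fin 2) (x y : ℝ) :
    condProb α ρ i x y = sectionIntegral α ρ (1 - i) y x / skewPDF (lam α ρ (1 - i)) y := by
  simp_rw [condProb, integral_density_point hr, sectionIntegral, point_one_sub]

/-! ### Marginal quantiles and the derivative of the diagonal. -/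

section RandomVector

variable {Ω : Type*} [MeasurableSpace Ω] {P : Measure Ω} {Z : Ω → Fin 2 → ℝ}

lemma margCDF_eq_integral (hρ₁ : -1 < ρ) (hρ₂ : ρ < 1) (hZ : HasLaw Z (law α ρ) P) (i : Fin 2)
    (x : ℝ) : margCDF P Z i x = ∫ t in Iic x, skewPDF (lam α ρ i) t := by
  rw [margCDF, hZ.measureReal_eq (p := fun z => z i ≤ x)
    (measurableSet_le (measurable_pi_apply i) measurable_const)]
  have h := law_real_rect (α := α) hρ₁ hρ₂ i (measurableSet_Iic (a := x)) MeasurableSet.univ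
  simp only [mem_Iic, mem_univ, and_true, Measure.restrict_univ] at h
  rw [h]
  congr 1 with t
  have h2 := integral_density_point (α := α) (one_sub_sq_pos hρ₁ hρ₂) (1 - i) t
  simp_rw [point_one_sub, sub_sub_cancel] at h2
  exact h2

lemma hasDerivAt_margCDF (hρ₁ : -1 < ρ) (hρ₂ : ρ < 1) (hZ : HasLaw Z (law α ρ) P) (i : Fin 2)
    (x : ℝ) : HasDerivAt (margCDF P Z i) (skewPDF (lam α ρ i) x) x := by
  rw [show margCDF P Z i = fun x => ∫ t in Iic x, skewPDF (lam α ρ i) t from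
    funext (margCDF_eq_integral hρ₁ hρ₂ hZ i)]
  exact hasDerivAt_integral_Iic (integrable_skewPDF _) (continuous_skewPDF _) x

lemma strictMono_margCDF (hρ₁ : -1 < ρ) (hρ₂ : ρ < 1) (hZ : HasLaw Z (law α ρ) P) (i : Fin 2) :
    StrictMono (margCDF P Z i) :=
  strictMono_of_deriv_pos fun x => by
    rw [(hasDerivAt_margCDF hρ₁ hρ₂ hZ i x).deriv]; exact skewPDF_pos _ _

lemma copula_eq_jointCDF (hZ : HasLaw Z (law α ρ) P) (u v : ℝ) :
    copula P Z u v = jointCDF α ρ (quantile P Z 0 u) (quantile P Z 1 v) := by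
  rw [copula, jointCDF]
  exact hZ.measureReal_eq (p := fun z => z 0 ≤ quantile P Z 0 u ∧ z 1 ≤ quantile P Z 1 v)
    ((measurableSet_le (measurable_pi_apply 0) measurable_const).inter
      (measurableSet_le (measurable_pi_apply 1) measurable_const))

lemma copula_diag_nonneg (u : ℝ) : 0 ≤ copula P Z u u := measureReal_nonneg

variable [IsProbabilityMeasure P]

lemma margCDF_eq_cdf (hZ : AEMeasurable Z P) (i : Fin 2) :
    margCDF P Z i = cdf (P.map fun ω => Z ω i) := by
  have hm : AEMeasurable (fun ω => Z ω i) P := (measurable_pi_apply i).comp_aemeasurable hZ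
  have := Measure.isProbabilityMeasure_map hm
  ext x
  rw [cdf_eq_real, map_measureReal_apply_of_aemeasurable hm measurableSet_Iic]; rfl

lemma margCDF_quantile (hρ₁ : -1 < ρ) (hρ₂ : ρ < 1) (hZ : HasLaw Z (law α ρ) P) (i : Fin 2)
    {u : ℝ} (hu : u ∈ Ioo (0 : ℝ) 1) : margCDF P Z i (quantile P Z i u) = u := by
  have hc : Continuous (margCDF P Z i) :=
    continuous_iff_continuousAt.2 fun x => (hasDerivAt_margCDF hρ₁ hρ₂ hZ i x).continuousAt
  have hmono := strictMono_margCDF hρ₁ hρ₂ hZ i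
  have e := margCDF_eq_cdf hZ.aemeasurable i
  obtain ⟨a, ha⟩ : ∃ a, margCDF P Z i a < u := by
    rw [e]; exact ((tendsto_cdf_atBot _).eventually_lt_const hu.1).exists
  obtain ⟨b, hb⟩ : ∃ b, u < margCDF P Z i b := by
    rw [e]; exact ((tendsto_cdf_atTop _).eventually_const_lt hu.2).exists
  obtain ⟨c, hcu⟩ := mem_range_of_exists_le_of_exists_ge hc ⟨a, ha.le⟩ ⟨b, hb.le⟩
  -- Strict monotonicity makes this set a closed half-line whose endpoint has distribution function
  -- value exactly `u`, so the infimum is that endpoint.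
  have : {x | u ≤ margCDF P Z i x} = Ici c := by
    ext x
    rw [mem_ofPred_eq, ← hcu, hmono.le_iff_le, mem_Ici]
  rw [quantile, this, csInf_Ici, hcu]

lemma quantile_lt_iff (hρ₁ : -1 < ρ) (hρ₂ : ρ < 1) (hZ : HasLaw Z (law α ρ) P) (i : Fin 2)
    {u : ℝ} (hu : u ∈ Ioo (0 : ℝ) 1) (x : ℝ) : quantile P Z i u < x ↔ u < margCDF P Z i x := by
  rw [← (strictMono_margCDF hρ₁ hρ₂ hZ i).lt_iff_lt, margCDF_quantile hρ₁ hρ₂ hZ i hu]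

lemma lt_quantile_iff (hρ₁ : -1 < ρ) (hρ₂ : ρ < 1) (hZ : HasLaw Z (law α ρ) P) (i : Fin 2)
    {u : ℝ} (hu : u ∈ Ioo (0 : ℝ) 1) (x : ℝ) : x < quantile P Z i u ↔ margCDF P Z i x < u := by
  rw [← (strictMono_margCDF hρ₁ hρ₂ hZ i).lt_iff_lt, margCDF_quantile hρ₁ hρ₂ hZ i hu]

lemma continuousAt_quantile (hρ₁ : -1 < ρ) (hρ₂ : ρ < 1) (hZ : HasLaw Z (law α ρ) P) (i : Fin 2)
    {u : ℝ} (hu : u ∈ Ioo (0 : ℝ) 1) : ContinuousAt (quantile P Z i) u := by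
  refine tendsto_order.2 ⟨fun a ha => ?_, fun a ha => ?_⟩
  · rw [lt_quantile_iff hρ₁ hρ₂ hZ i hu] at ha
    filter_upwards [lt_mem_nhds ha, isOpen_Ioo.mem_nhds hu] with v hv hv'
    exact (lt_quantile_iff hρ₁ hρ₂ hZ i hv' a).2 hv
  · rw [gt_iff_lt, quantile_lt_iff hρ₁ hρ₂ hZ i hu] at ha
    filter_upwards [gt_mem_nhds ha, isOpen_Ioo.mem_nhds hu] with v hv hv'
    exact (quantile_lt_iff hρ₁ hρ₂ hZ i hv' a).2 hv

lemma hasDerivAt_quantile (hρ₁ : -1 < ρ) (hρ₂ : ρ < 1) (hZ : HasLaw Z (law α ρ) P) (i : Fin 2)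
    {u : ℝ} (hu : u ∈ Ioo (0 : ℝ) 1) :
    HasDerivAt (quantile P Z i) (skewPDF (lam α ρ i) (quantile P Z i u))⁻¹ u :=
  HasDerivAt.of_local_left_inverse (continuousAt_quantile hρ₁ hρ₂ hZ i hu)
    (hasDerivAt_margCDF hρ₁ hρ₂ hZ i _) (skewPDF_pos _ _).ne' (by
      filter_upwards [isOpen_Ioo.mem_nhds hu] with v hv using margCDF_quantile hρ₁ hρ₂ hZ i hv)

lemma eventually_mem_Ioo_zero_one : ∀ᶠ u : ℝ in 𝓝[>] 0, u ∈ Ioo (0 : ℝ) 1 :=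
  Ioo_mem_nhdsGT one_pos

lemma tendsto_quantile (hρ₁ : -1 < ρ) (hρ₂ : ρ < 1) (hZ : HasLaw Z (law α ρ) P) (i : Fin 2) :
    Tendsto (quantile P Z i) (𝓝[>] 0) atBot := by
  refine tendsto_atBot.2 fun b => ?_
  have hb : 0 < margCDF P Z i b := by
    have h := strictMono_margCDF hρ₁ hρ₂ hZ i (show b - 1 < b by linarith)
    exact lt_of_le_of_lt measureReal_nonneg h
  filter_upwards [Ioo_mem_nhdsGT hb, eventually_mem_Ioo_zero_one] with u hu hu'
  exact ((quantile_lt_iff hρ₁ hρ₂ hZ i hu' b).2 hu.2).le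

/-- The derivative of the diagonal section of the copula. -/
lemma hasDerivAt_copula_diag (hρ₁ : -1 < ρ) (hρ₂ : ρ < 1) (hZ : HasLaw Z (law α ρ) P)
    {u : ℝ} (hu : u ∈ Ioo (0 : ℝ) 1) :
    HasDerivAt (fun x => copula P Z x x)
      (condProb α ρ 0 (quantile P Z 0 u) (quantile P Z 1 u) +
        condProb α ρ 1 (quantile P Z 1 u) (quantile P Z 0 u)) u := by
  simp_rw [copula_eq_jointCDF hZ]
  have h := (hasStrictFDerivAt_jointCDF (α := α) hρ₁ hρ₂
    (quantile P Z 0 u, quantile P Z 1 u)).hasFDerivAt.comp_hasDerivAt u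
    ((hasDerivAt_quantile hρ₁ hρ₂ hZ 0 hu).prodMk (hasDerivAt_quantile hρ₁ hρ₂ hZ 1 hu))
  refine h.congr_deriv ?_
  -- Each partial derivative is multiplied by the reciprocal marginal density coming from the
  -- quantile; this product is a conditional probability.
  rw [condProb_eq (one_sub_sq_pos hρ₁ hρ₂), condProb_eq (one_sub_sq_pos hρ₁ hρ₂)]
  simp only [ContinuousLinearMap.coprod_apply, ContinuousLinearMap.toSpanSingleton_apply,
    smul_eq_mul, sub_zero, sub_self]
  ring

lemma copula_diag_le (hρ₁ : -1 < ρ) (hρ₂ : ρ < 1) (hZ : HasLaw Z (law α ρ) P)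
    {u : ℝ} (hu : u ∈ Ioo (0 : ℝ) 1) : copula P Z u u ≤ u := by
  conv_rhs => rw [← margCDF_quantile hρ₁ hρ₂ hZ 0 hu]
  exact measureReal_mono fun ω hω => hω.1

lemma lowerTail_eq (hρ₁ : -1 < ρ) (hρ₂ : ρ < 1) (hZ : HasLaw Z (law α ρ) P)
    {u : ℝ} (hu : u ∈ Ioo (0 : ℝ) 1) : lowerTail P Z u = copula P Z u u / u := by
  have hm : NullMeasurableSet {ω | Z ω 1 ≤ quantile P Z 1 u} P :=
    ((measurable_pi_apply 1).comp_aemeasurable hZ.aemeasurable).nullMeasurableSet_preimage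
      measurableSet_Iic
  have h1 := margCDF_quantile hρ₁ hρ₂ hZ 1 hu
  rw [margCDF, measureReal_def] at h1
  rw [lowerTail, ProbabilityTheory.cond, measureReal_def, Measure.smul_apply,
    Measure.restrict_apply₀' hm, smul_eq_mul, ENNReal.toReal_mul, ENNReal.toReal_inv, h1,
    inv_mul_eq_div]
  rfl

end RandomVector

/-! ### Expansion of the marginal quantiles at zero. -/

/-- `√(1 + λ²)` if `λ > 0` and `1` otherwise. -/
noncomputable def scaleOf (l : ℝ) : ℝ := if 0 < l then √(1 + l ^ 2) else 1

/-- The power of `-log u` in the expansion of the marginal quantile. -/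
noncomputable def quantilePower (l : ℝ) : ℝ := if 0 < l then 2 else 1

/-- The constant term in the expansion of the marginal quantile. -/
noncomputable def quantileConst (l : ℝ) : ℝ :=
  if 0 < l then 2 * Real.log (2 * Real.pi * l) else
    if l = 0 then Real.log (4 * Real.pi) else Real.log Real.pi

lemma scaleOf_pos (l : ℝ) : 0 < scaleOf l := by
  unfold scaleOf; split_ifs <;> positivity

/-- The right side is the rate `A + a * max b 0` of the Laplace lemma with `A = 1` and `a = b = l`,
so one formula serves all signs of `l`. -/
lemma scaleOf_sq (l : ℝ) : scaleOf l ^ 2 = 1 + l * max l 0 := by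
  unfold scaleOf
  split_ifs with h
  · rw [Real.sq_sqrt (by positivity), max_eq_left h.le]; ring
  · rw [max_eq_right (not_lt.1 h)]; ring

lemma tendsto_neg_log_nhdsGT : Tendsto (fun u => -Real.log u) (𝓝[>] 0) atTop :=
  tendsto_neg_atBot_atTop.comp Real.tendsto_log_nhdsGT_zero

lemma log_stdPDF (x : ℝ) : Real.log (stdPDF x) = -(Real.log (2 * Real.pi) / 2) - x ^ 2 / 2 := by
  rw [stdPDF, Real.log_mul (by positivity) (Real.exp_pos _).ne', Real.log_inv,
    Real.log_sqrt (by positivity), Real.log_exp]; ring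

variable {ι : Type*} {F : Filter ι}

/-- Tail asymptotics of the skew normal distribution function at a point tending to `-∞`. -/
lemma tendsto_skewPDF_div [F.IsCountablyGenerated] (l : ℝ) {x : ι → ℝ} (hx : Tendsto x F atBot) :
    Tendsto (fun n => skewPDF l (x n) / ((∫ t in Iic (x n), skewPDF l t) * -x n)) F
      (𝓝 (scaleOf l ^ 2)) := by
  have hs : Tendsto (fun n => -x n) F atTop := tendsto_neg_atBot_atTop.comp hx
  have h := tendsto_integral_Iic_skewKernel hs (x := x) (μ := fun _ => 0) (p := fun _ => 0)
    (r := 1) (a := l) (A := 1) (b := l) one_pos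
    (by
      refine tendsto_const_nhds.congr' ?_
      filter_upwards [hx.eventually_lt_atBot 0] with n hn
      have := hn.ne
      field_simp; simp)
    (by
      refine tendsto_const_nhds.congr' ?_
      filter_upwards [hx.eventually_lt_atBot 0] with n hn
      have := hn.ne
      field_simp; simp)
    (by rw [← scaleOf_sq]; have := scaleOf_pos l; positivity)
  rw [← scaleOf_sq] at h
  have h2 := h.inv₀ (by have := scaleOf_pos l; positivity)
  rw [one_div, inv_inv] at h2
  refine h2.congr fun n => ?_
  simp_rw [skewPDF_eq, integral_const_mul]
  rw [inv_div]
  have : 2 / √(2 * Real.pi) ≠ 0 := by positivity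
  rw [mul_assoc, mul_div_mul_left _ _ this, mul_comm (-x n)]

/-- For `l < 0` the factor `Φ(l x)` tends to `1`, for `l = 0` it is `1/2`, and for `l > 0` Mills'
ratio supplies the quadratic and logarithmic terms, whose coefficients vanish in the other cases. -/
lemma tendsto_log_Phi_mul (l : ℝ) {x : ι → ℝ} (hx : Tendsto x F atBot) :
    Tendsto (fun n => Real.log (Phi (l * x n)) + (scaleOf l ^ 2 - 1) / 2 * x n ^ 2 +
        (quantilePower l - 1) * Real.log (-x n)) F
      (𝓝 (-(if 0 < l then Real.log (2 * Real.pi) / 2 + Real.log l else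
        if l = 0 then Real.log 2 else 0))) := by
  rw [scaleOf_sq, quantilePower]
  rcases lt_trichotomy l 0 with h | rfl | h
  · simp only [not_lt.2 h.le, if_false, h.ne, max_eq_right h.le, neg_zero]
    have h1 : Tendsto (fun n => l * x n) F atTop := hx.const_mul_atBot_of_neg h
    have h2 := (tendsto_Phi_atTop.comp h1).log one_ne_zero
    simpa using h2
  · simp [Phi_zero, tendsto_const_nhds]
  · simp only [h, if_true, max_eq_left h.le]
    have h1 : Tendsto (fun n => l * x n) F atBot := hx.const_mul_atBot h
    have h2 := ((tendsto_Phi_mul_neg_div_stdPDF.comp h1).log one_ne_zero).sub_const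
      (Real.log (2 * Real.pi) / 2 + Real.log l)
    rw [Real.log_one, zero_sub] at h2
    refine h2.congr' ?_
    filter_upwards [hx.eventually_lt_atBot 0] with n hn
    have h3 : 0 < -x n := by linarith
    simp only [Function.comp]
    rw [Real.log_div (mul_pos (Phi_pos _) (by nlinarith)).ne' (stdPDF_pos _).ne', Real.log_mul
      (Phi_pos _).ne' (by nlinarith), log_stdPDF, ← mul_neg, Real.log_mul h.ne' h3.ne']
    ring

/-- Expansion of `x²` when `x → -∞` and the skew normal distribution function at `x` is `u`. -/
lemma tendsto_sq_quantile_expansion (l : ℝ) {x : ℝ → ℝ} (hx : Tendsto x (𝓝[>] 0) atBot)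
    (hF : ∀ᶠ u in 𝓝[>] 0, ∫ t in Iic (x u), skewPDF l t = u) :
    Tendsto (fun u => scaleOf l ^ 2 * x u ^ 2 - 2 * -Real.log u +
      quantilePower l * Real.log (-Real.log u)) (𝓝[>] 0) (𝓝 (-quantileConst l)) := by
  set k := scaleOf l ^ 2 with hk
  set p := quantilePower l with hp
  set η := (if 0 < l then Real.log (2 * Real.pi) / 2 + Real.log l else
        if l = 0 then Real.log 2 else 0) with hη
  have hk0 : 0 < k := by have := scaleOf_pos l; positivity
  have hs : Tendsto (fun n => -x n) (𝓝[>] 0) atTop := tendsto_neg_atBot_atTop.comp hx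
  have h1 := (tendsto_skewPDF_div l hx).log (by rw [← hk]; exact hk0.ne')
  have h2 := h1.sub (tendsto_log_Phi_mul l hx)
  rw [← hη, ← hk, ← hp] at h2
  -- Logarithm of the tail relation `f(x) ∼ κ² (-x) F(x)` with `F(x) = u`.
  have h3 : Tendsto (fun u => -Real.log u - k / 2 * x u ^ 2 - p * Real.log (-x u)) (𝓝[>] 0)
      (𝓝 (Real.log k + η - Real.log 2 + Real.log (2 * Real.pi) / 2)) := by
    have h4 := h2.add_const (-Real.log 2 + Real.log (2 * Real.pi) / 2)
    convert h4.congr' ?_ using 2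
    · ring
    filter_upwards [hF, hx.eventually_lt_atBot 0, self_mem_nhdsWithin] with u hu hxu hu0
    have h5 : 0 < -x u := by linarith
    have hu0 : 0 < u := hu0
    rw [hu, Real.log_div (skewPDF_pos _ _).ne' (by positivity), Real.log_mul hu0.ne' h5.ne',
      skewPDF, Real.log_mul (mul_pos two_pos (stdPDF_pos _)).ne' (Phi_pos _).ne',
      Real.log_mul two_ne_zero (stdPDF_pos _).ne', log_stdPDF]
    ring
  have h6 : Tendsto (fun u => -Real.log u / x u ^ 2) (𝓝[>] 0) (𝓝 (k / 2)) := by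
    have hsq : Tendsto (fun u => (-x u) ^ 2) (𝓝[>] 0) atTop :=
      (tendsto_pow_atTop two_ne_zero).comp hs
    have h7 : Tendsto (fun u => Real.log (-x u) / (-x u) ^ 2) (𝓝[>] 0) (𝓝 0) := by
      have h8 := (isLittleO_log_rpow_atTop (r := 2) two_pos).tendsto_div_nhds_zero
      refine (h8.comp hs).congr fun u => ?_
      simp only [Function.comp]
      norm_cast
    have h9 := ((h3.mul (hsq.const_div_atTop 1)).add_const (k / 2)).add (h7.const_mul p)
    rw [mul_zero, mul_zero, zero_add, add_zero] at h9
    refine h9.congr' ?_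
    filter_upwards [hx.eventually_lt_atBot 0] with u hxu
    have := hxu.ne
    field_simp
    ring
  -- The leading order `-log u ∼ (k/2) x²` allows `log(-x)` to be replaced by half of `log(-log u)`
  -- plus a constant, which makes the expansion explicit in `u`.
  have h10 : Tendsto (fun u => Real.log (-Real.log u) - 2 * Real.log (-x u)) (𝓝[>] 0)
      (𝓝 (Real.log (k / 2))) := by
    refine (h6.log (by positivity)).congr' ?_
    filter_upwards [hx.eventually_lt_atBot 0, tendsto_neg_log_nhdsGT.eventually_gt_atTop 0]
      with u hxu hu
    rw [Real.log_div hu.ne' (by have := hxu.ne; positivity), ← neg_sq, Real.log_pow]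
    norm_num
  have h11 := (h10.const_mul p).sub (h3.const_mul 2)
  have hq : p * Real.log (k / 2) - 2 * (Real.log k + η - Real.log 2 +
      Real.log (2 * Real.pi) / 2) = -quantileConst l := by
    rw [Real.log_div hk0.ne' two_ne_zero, hp, hk, hη, quantileConst, quantilePower]
    have e2 : Real.log (2 * Real.pi) = Real.log 2 + Real.log Real.pi :=
      Real.log_mul two_ne_zero Real.pi_ne_zero
    have e4 : Real.log (4 * Real.pi) = 2 * Real.log 2 + Real.log Real.pi := by
      rw [Real.log_mul (by norm_num) Real.pi_ne_zero, show (4 : ℝ) = 2 ^ 2 by norm_num,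
        Real.log_pow]; norm_num
    rcases lt_trichotomy l 0 with h | rfl | h
    · simp [not_lt.2 h.le, h.ne, scaleOf, e2]; ring
    · simp [scaleOf, e2, e4]; ring
    · simp only [h, if_true]
      rw [Real.log_mul (by positivity) h.ne', e2]; ring
  rw [hq] at h11
  exact h11.congr fun u => by ring

/-- If `S² = 2 L - p log L - q + o(1)` with `L = -log u`, then `S ∼ √(2 L)`. -/
lemma tendsto_div_sqrt_log {S : ℝ → ℝ} {p q : ℝ} (hS : ∀ᶠ u in 𝓝[>] 0, 0 ≤ S u)
    (h : Tendsto (fun u => S u ^ 2 - 2 * -Real.log u + p * Real.log (-Real.log u)) (𝓝[>] 0)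
      (𝓝 (-q))) :
    Tendsto (fun u => S u / √(-Real.log u)) (𝓝[>] 0) (𝓝 √2) := by
  have hL := tendsto_neg_log_nhdsGT
  have h1 : Tendsto (fun u => Real.log (-Real.log u) / -Real.log u) (𝓝[>] 0) (𝓝 0) := by
    have h8 := (isLittleO_log_rpow_atTop (r := 1) one_pos).tendsto_div_nhds_zero
    refine (h8.comp hL).congr fun u => ?_
    simp [Function.comp]
  have h2 : Tendsto (fun u => S u ^ 2 / -Real.log u) (𝓝[>] 0) (𝓝 2) := by
    have h9 := ((h.mul (hL.const_div_atTop 1)).add_const 2).sub (h1.const_mul p)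
    rw [mul_zero, mul_zero, zero_add, sub_zero] at h9
    refine h9.congr' ?_
    filter_upwards [hL.eventually_gt_atTop 0] with u hu
    have : Real.log u ≠ 0 := by linarith
    field_simp
    ring
  refine h2.sqrt.congr' ?_
  filter_upwards [hS] with u hu
  rw [Real.sqrt_div (sq_nonneg _), Real.sqrt_sq hu]

/-- `S - T = (S² - T²) / (S + T)`: with `L = -log u` the numerator is `O(log L)` and the denominator
is of order `√L`. -/
lemma tendsto_sub_zero_of_expansion {S T : ℝ → ℝ} {p q p' q' : ℝ}
    (hS : ∀ᶠ u in 𝓝[>] 0, 0 ≤ S u) (hT : ∀ᶠ u in 𝓝[>] 0, 0 ≤ T u)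
    (h : Tendsto (fun u => S u ^ 2 - 2 * -Real.log u + p * Real.log (-Real.log u)) (𝓝[>] 0)
      (𝓝 (-q)))
    (h' : Tendsto (fun u => T u ^ 2 - 2 * -Real.log u + p' * Real.log (-Real.log u)) (𝓝[>] 0)
      (𝓝 (-q'))) :
    Tendsto (fun u => S u - T u) (𝓝[>] 0) (𝓝 0) := by
  have hL := tendsto_neg_log_nhdsGT
  have hsL : Tendsto (fun u => √(-Real.log u)) (𝓝[>] 0) atTop := Real.tendsto_sqrt_atTop.comp hL
  have h1 : Tendsto (fun u => Real.log (-Real.log u) / √(-Real.log u)) (𝓝[>] 0) (𝓝 0) := by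
    have h8 := (isLittleO_log_rpow_atTop (r := 1 / 2) (by norm_num)).tendsto_div_nhds_zero
    refine (h8.comp hL).congr fun u => ?_
    simp [Function.comp, Real.sqrt_eq_rpow]
  have hST := (tendsto_div_sqrt_log hS h).add (tendsto_div_sqrt_log hT h')
  have hn := ((h.sub h').mul (hsL.const_div_atTop 1)).add (h1.const_mul (p' - p))
  rw [mul_zero, mul_zero, add_zero] at hn
  have h2 := hn.div hST (by positivity)
  rw [zero_div] at h2
  refine h2.congr' ?_
  filter_upwards [hL.eventually_gt_atTop 0, hST.eventually_const_lt
    (show 0 < √2 + √2 by positivity)] with u hu hpos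
  have hs : 0 < √(-Real.log u) := Real.sqrt_pos.2 hu
  rw [← add_div] at hpos
  have hpos2 : 0 < S u + T u := by
    by_contra hneg
    exact absurd hpos (not_lt.2 (div_nonpos_of_nonpos_of_nonneg (not_lt.1 hneg) hs.le))
  simp only [Pi.div_apply]
  rw [div_eq_iff (by rw [← add_div]; exact hpos.ne')]
  field_simp
  ring

/-! ### From the derivative of the diagonal to the diagonal. -/

lemma hasDerivAt_rpow_mul_neg_log_rpow (θ τ : ℝ) {u : ℝ} (hu : u ∈ Ioo (0 : ℝ) 1) :
    HasDerivAt (fun u => u ^ (θ + 1) * (-Real.log u) ^ τ)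
      (u ^ θ * (-Real.log u) ^ τ * (θ + 1 - τ / -Real.log u)) u := by
  have hL : 0 < -Real.log u := by have := Real.log_neg hu.1 hu.2; linarith
  have h1 := Real.hasDerivAt_rpow_const (x := u) (p := θ + 1) (Or.inl hu.1.ne')
  have h2 := ((Real.hasDerivAt_log hu.1.ne').neg).rpow_const (p := τ) (Or.inl hL.ne')
  refine (h1.mul h2).congr_deriv ?_
  simp only [Pi.neg_apply]
  rw [add_sub_cancel_right, Real.rpow_sub_one hL.ne', Real.rpow_add_one hu.1.ne']
  have := hu.1.ne'
  have : Real.log u ≠ 0 := by linarith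
  field_simp
  ring

lemma tendsto_rpow_mul_neg_log_rpow {s : ℝ} (hs : 0 < s) (τ : ℝ) :
    Tendsto (fun u => u ^ s * (-Real.log u) ^ τ) (𝓝[>] 0) (𝓝 0) := by
  refine ((tendsto_rpow_mul_exp_neg_mul_atTop_nhds_zero τ s hs).comp tendsto_neg_log_nhdsGT).congr' ?_
  filter_upwards [self_mem_nhdsWithin] with u hu
  simp only [Function.comp]
  rw [Real.rpow_def_of_pos hu, mul_comm]
  congr 2; ring

/-- Diagonal asymptotics from the asymptotics of the derivative. -/
lemma diagonalAsymptotics_of_tendsto {δ D : ℝ → ℝ} {θ c τ : ℝ}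
    (hD : ∀ u ∈ Ioo (0 : ℝ) 1, HasDerivAt δ (D u) u) (hδ : Tendsto δ (𝓝[>] 0) (𝓝 0))
    (hθ : 0 < θ) (hc : 0 < c)
    (h : Tendsto (fun u => D u / (u ^ θ * (-Real.log u) ^ τ)) (𝓝[>] 0) (𝓝 c)) :
    DiagonalAsymptotics δ θ c τ := by
  have hL := tendsto_neg_log_nhdsGT
  have hI := eventually_mem_Ioo_zero_one
  have hpos : ∀ u ∈ Ioo (0 : ℝ) 1, 0 < -Real.log u := fun u hu => by
    have := Real.log_neg hu.1 hu.2; linarith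
  -- Built from `deriv δ`, which is measurable on the whole line, because nothing is known of `D`
  -- outside `(0, 1)`.
  set Λ : ℝ → ℝ := fun u => deriv δ u * u ^ (-θ) with hΛ
  have hΛe : ∀ u ∈ Ioo (0 : ℝ) 1, Λ u = D u / u ^ θ := fun u hu => by
    rw [hΛ]; simp only; rw [(hD u hu).deriv, Real.rpow_neg hu.1.le]; rfl
  have hΛc : Tendsto (fun u => Λ u / (-Real.log u) ^ τ) (𝓝[>] 0) (𝓝 c) := by
    refine h.congr' ?_
    filter_upwards [hI] with u hu
    rw [hΛe u hu, div_div]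
  refine ⟨hθ, Λ, ⟨?_, ?_, ?_⟩, ?_, ?_, ?_⟩
  · exact (measurable_deriv δ).mul (by fun_prop)
  · filter_upwards [hΛc.eventually_const_lt hc, hI] with u hu hu'
    exact (div_pos_iff_of_pos_right (Real.rpow_pos_of_pos (hpos u hu') _)).1 hu
  · intro a ha
    have ha0 : Tendsto (fun u => a * u) (𝓝[>] 0) (𝓝[>] 0) := by
      refine tendsto_nhdsWithin_iff.2 ⟨?_, ?_⟩
      · have : Tendsto (fun u => a * u) (𝓝 0) (𝓝 (a * 0)) :=
          (continuous_const.mul continuous_id).tendsto 0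
        rw [mul_zero] at this
        exact this.mono_left nhdsWithin_le_nhds
      · filter_upwards [self_mem_nhdsWithin] with u hu using mul_pos ha hu
    have h1 := (hΛc.comp ha0).div hΛc hc.ne'
    have h2 : Tendsto (fun u => (-Real.log (a * u) / -Real.log u) ^ τ) (𝓝[>] 0) (𝓝 1) := by
      have h3 : Tendsto (fun u => 1 + -Real.log a / -Real.log u) (𝓝[>] 0) (𝓝 1) := by
        simpa using (hL.const_div_atTop (-Real.log a)).const_add 1
      have h4 : Tendsto (fun u => -Real.log (a * u) / -Real.log u) (𝓝[>] 0) (𝓝 1) := by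
        refine h3.congr' ?_
        filter_upwards [hI] with u hu
        have := (hpos u hu).ne'
        rw [Real.log_mul ha.ne' hu.1.ne', neg_add, add_div, div_self this, add_comm]
      simpa using h4.rpow_const (p := τ) (Or.inl one_ne_zero)
    have h5 := h1.mul h2
    rw [div_self hc.ne', mul_one] at h5
    refine h5.congr' ?_
    filter_upwards [hI, ha0.eventually hI, hΛc.eventually_const_lt hc] with u hu hu' hcu
    have e1 := Real.rpow_pos_of_pos (hpos u hu) τ
    have e2 := Real.rpow_pos_of_pos (hpos _ hu') τ
    have e3 : 0 < Λ u := (div_pos_iff_of_pos_right e1).1 hcu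
    rw [Real.div_rpow (hpos _ hu').le (hpos u hu).le]
    simp only [Pi.div_apply, Function.comp]
    field_simp
  · intro u hu
    rw [hΛe u hu, (hD u hu).deriv, mul_div_cancel₀ _ (Real.rpow_pos_of_pos hu.1 _).ne']
  · refine (isEquivalent_iff_tendsto_one ?_).2 ?_
    · filter_upwards [hI] with u hu
      exact (mul_pos hc (Real.rpow_pos_of_pos (hpos u hu) _)).ne'
    · have := hΛc.div_const c
      rw [div_self hc.ne'] at this
      refine this.congr fun u => ?_
      simp only [Pi.div_apply]
      rw [div_div, mul_comm c]
  · have hg := fun u hu => hasDerivAt_rpow_mul_neg_log_rpow θ τ (u := u) hu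
    have hfac : Tendsto (fun u => θ + 1 - τ / -Real.log u) (𝓝[>] 0) (𝓝 (θ + 1)) := by
      simpa using (hL.const_div_atTop τ).const_sub (θ + 1)
    have hfac' := hfac.eventually_const_lt (show (0 : ℝ) < θ + 1 by linarith)
    -- The comparison function has derivative `u^θ L^τ` times a factor tending to `θ + 1`, where `L
    -- = -log u`; this is the source of the denominator `θ + 1`.
    have hlop := HasDerivAt.lhopital_zero_nhdsGT (a := 0) (f := δ) (f' := D)
      (g := fun u => u ^ (θ + 1) * (-Real.log u) ^ τ)
      (g' := fun u => u ^ θ * (-Real.log u) ^ τ * (θ + 1 - τ / -Real.log u))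
      (l := 𝓝 (c / (θ + 1)))
      (by filter_upwards [hI] with u hu using hD u hu)
      (by filter_upwards [hI] with u hu using hg u hu)
      (by
        filter_upwards [hI, hfac'] with u hu hf
        exact (mul_pos (mul_pos (Real.rpow_pos_of_pos hu.1 _)
          (Real.rpow_pos_of_pos (hpos u hu) _)) hf).ne')
      hδ (tendsto_rpow_mul_neg_log_rpow (by linarith) τ)
      ((h.div hfac (by linarith)).congr fun u => by simp only [Pi.div_apply]; rw [div_div])
    have hq := (hlop.div hΛc hc.ne').mul_const (θ + 1)
    have e : c / (θ + 1) / c * (θ + 1) = 1 := by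
      have : θ + 1 ≠ 0 := by linarith
      field_simp
    rw [e] at hq
    refine (isEquivalent_iff_tendsto_one ?_).2 ?_
    · filter_upwards [hI, hΛc.eventually_const_lt hc] with u hu hcu
      have e1 := Real.rpow_pos_of_pos (hpos u hu) τ
      have e3 : 0 < Λ u := (div_pos_iff_of_pos_right e1).1 hcu
      have e4 := Real.rpow_pos_of_pos hu.1 (θ + 1)
      have : 0 < θ + 1 := by linarith
      positivity
    · refine hq.congr' ?_
      filter_upwards [hI, hΛc.eventually_const_lt hc] with u hu hcu
      have e1 := Real.rpow_pos_of_pos (hpos u hu) τ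
      have e3 : 0 < Λ u := (div_pos_iff_of_pos_right e1).1 hcu
      have e4 := Real.rpow_pos_of_pos hu.1 (θ + 1)
      have : 0 < θ + 1 := by linarith
      simp only [Pi.div_apply]
      field_simp

/-! ### Conditional probabilities and joint density along the quantile curve. -/

variable {α : Fin 2 → ℝ} {ρ : ℝ}

lemma tailScale_eq_scaleOf (i : Fin 2) : tailScale α ρ i = scaleOf (lam α ρ i) := rfl

lemma tailScale_pos (i : Fin 2) : 0 < tailScale α ρ i := scaleOf_pos _

/-- The exponential rate at which the joint density decays when its `i`-th coordinate moves away
from the origin, relative to the other coordinate. -/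
noncomputable def decayRate (α : Fin 2 → ℝ) (ρ : ℝ) (i : Fin 2) : ℝ :=
  (gam α ρ i - ρ) / (1 - ρ ^ 2) + α i * max (α i * gam α ρ i + α (1 - i)) 0

/-- The scalar product of `α` with the limiting direction of the quantile vector. -/
noncomputable def skewDir (α : Fin 2 → ℝ) (ρ : ℝ) (i : Fin 2) : ℝ :=
  α i / tailScale α ρ i + α (1 - i) / tailScale α ρ (1 - i)

/-- Ties the sign that decides the maximum in `decayRate` to that of `skewDir`, which is symmetric
in the two indices. -/
lemma mul_gam_add (i : Fin 2) :
    α i * gam α ρ i + α (1 - i) = tailScale α ρ (1 - i) * skewDir α ρ i := by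
  have h1 := (tailScale_pos (α := α) (ρ := ρ) i).ne'
  have h2 := (tailScale_pos (α := α) (ρ := ρ) (1 - i)).ne'
  unfold gam skewDir
  field_simp

lemma skewDir_one_sub (i : Fin 2) : skewDir α ρ (1 - i) = skewDir α ρ i := by
  rw [skewDir, skewDir, sub_sub_cancel, add_comm]

lemma decayRate_of_pos {i : Fin 2} (h : 0 < skewDir α ρ i) :
    decayRate α ρ i = bet α ρ i := by
  rw [decayRate, bet, max_eq_left]
  rw [mul_gam_add]
  exact (mul_pos (tailScale_pos _) h).le

lemma decayRate_of_nonpos {i : Fin 2} (h : skewDir α ρ i ≤ 0) :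
    decayRate α ρ i = (gam α ρ i - ρ) / (1 - ρ ^ 2) := by
  rw [decayRate, max_eq_right, mul_zero, add_zero]
  rw [mul_gam_add]
  exact mul_nonpos_of_nonneg_of_nonpos (tailScale_pos _).le h

section Quantiles

variable {x : Fin 2 → ℝ → ℝ}

/-- The functions `x i` have the asymptotic behaviour of the marginal quantile functions. -/
structure IsMarginalQuantile (α : Fin 2 → ℝ) (ρ : ℝ) (x : Fin 2 → ℝ → ℝ) : Prop where
  tendsto : ∀ i, Tendsto (x i) (𝓝[>] 0) atBot
  integral_eq : ∀ i, ∀ᶠ u in 𝓝[>] 0, ∫ t in Iic (x i u), skewPDF (lam α ρ i) t = u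

lemma IsMarginalQuantile.expansion (hx : IsMarginalQuantile α ρ x) (i : Fin 2) :
    Tendsto (fun u => (tailScale α ρ i * -x i u) ^ 2 - 2 * -Real.log u +
      quantilePower (lam α ρ i) * Real.log (-Real.log u)) (𝓝[>] 0)
      (𝓝 (-quantileConst (lam α ρ i))) := by
  refine (tendsto_sq_quantile_expansion _ (hx.tendsto i) (hx.integral_eq i)).congr fun u => ?_
  rw [tailScale_eq_scaleOf]; ring

lemma IsMarginalQuantile.eventually_nonneg (hx : IsMarginalQuantile α ρ x) (i : Fin 2) :
    ∀ᶠ u in 𝓝[>] 0, 0 ≤ tailScale α ρ i * -x i u := by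
  filter_upwards [(hx.tendsto i).eventually_lt_atBot 0] with u hu
  exact mul_nonneg (tailScale_pos _).le (by linarith)

lemma IsMarginalQuantile.tendsto_div_sqrt (hx : IsMarginalQuantile α ρ x) (i : Fin 2) :
    Tendsto (fun u => -x i u / √(-Real.log u)) (𝓝[>] 0) (𝓝 (√2 / tailScale α ρ i)) := by
  refine ((tendsto_div_sqrt_log (hx.eventually_nonneg i) (hx.expansion i)).div_const
    (tailScale α ρ i)).congr fun u => ?_
  have := (tailScale_pos (α := α) (ρ := ρ) i).ne'
  field_simp

lemma IsMarginalQuantile.tendsto_sub (hx : IsMarginalQuantile α ρ x) (i j : Fin 2) :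
    Tendsto (fun u => tailScale α ρ i * -x i u - tailScale α ρ j * -x j u) (𝓝[>] 0) (𝓝 0) :=
  tendsto_sub_zero_of_expansion (hx.eventually_nonneg i) (hx.eventually_nonneg j)
    (hx.expansion i) (hx.expansion j)

lemma IsMarginalQuantile.tendsto_div (hx : IsMarginalQuantile α ρ x) (i : Fin 2) :
    Tendsto (fun u => x i u / -x (1 - i) u) (𝓝[>] 0) (𝓝 (-gam α ρ i)) := by
  have h1 := (tailScale_pos (α := α) (ρ := ρ) i)
  have h2 := (tailScale_pos (α := α) (ρ := ρ) (1 - i))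
  have h := ((hx.tendsto_div_sqrt i).div (hx.tendsto_div_sqrt (1 - i)) (by positivity)).neg
  convert h.congr' ?_ using 2
  · rw [gam]; field_simp
  · filter_upwards [(hx.tendsto (1 - i)).eventually_lt_atBot 0,
      tendsto_neg_log_nhdsGT.eventually_gt_atTop 0] with u hu hL
    have h3 := (Real.sqrt_pos.2 hL).ne'
    have h4 := hu.ne
    simp only [Pi.div_apply]
    field_simp

/-- With `s = -x_j`, `j = 1 - i`, the conditional integral is asymptotic to the endpoint value
divided by `s · decayRate`, and the marginal density to `κ_j² s u`. Their quotient contains `κ_j²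
s²`, which is asymptotic to `-2 log u`, so `κ_j` cancels. -/
lemma IsMarginalQuantile.tendsto_condProb (hx : IsMarginalQuantile α ρ x) (hr : 0 < 1 - ρ ^ 2)
    (i : Fin 2) (hB : 0 < decayRate α ρ i) :
    Tendsto (fun u => condProb α ρ i (x i u) (x (1 - i) u) * (u * -Real.log u) /
      density α ρ (point i (x i u) (x (1 - i) u))) (𝓝[>] 0) (𝓝 (1 / (2 * decayRate α ρ i))) := by
  have hκ := tailScale_pos (α := α) (ρ := ρ) (1 - i)
  have hneg := (hx.tendsto (1 - i)).eventually_lt_atBot 0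
  have hs : Tendsto (fun u => -x (1 - i) u) (𝓝[>] 0) atTop :=
    tendsto_neg_atBot_atTop.comp (hx.tendsto (1 - i))
  have h1 := tendsto_integral_Iic_skewKernel hs (x := x i) (μ := fun u => ρ * x (1 - i) u)
    (p := fun u => α (1 - i) * x (1 - i) u) (r := 1 - ρ ^ 2) (a := α i)
    (A := (gam α ρ i - ρ) / (1 - ρ ^ 2)) (b := α i * gam α ρ i + α (1 - i)) hr
    (by
      have := ((hx.tendsto_div i).add_const ρ).div_const (1 - ρ ^ 2)
      convert this.congr' ?_ using 2
      · ring
      · filter_upwards [hneg] with u hu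
        have := hu.ne
        field_simp
        ring)
    (by
      have := ((hx.tendsto_div i).const_mul (α i)).sub_const (α (1 - i))
      convert this.congr' ?_ using 2
      · ring
      · filter_upwards [hneg] with u hu
        have := hu.ne
        field_simp
        ring) hB
  have h2 := (tendsto_skewPDF_div (lam α ρ (1 - i)) (hx.tendsto (1 - i))).inv₀
    (by rw [← tailScale_eq_scaleOf]; positivity)
  have h3 := ((hx.tendsto_div_sqrt (1 - i)).pow 2).inv₀ (by positivity)
  rw [← tailScale_eq_scaleOf] at h2
  convert ((h1.mul h2).mul h3).congr' ?_ using 2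
  · rw [div_pow, Real.sq_sqrt zero_le_two, decayRate]
    field_simp
  · filter_upwards [hneg, hx.integral_eq (1 - i), eventually_mem_Ioo_zero_one,
      tendsto_neg_log_nhdsGT.eventually_gt_atTop 0] with u hu hi hu' hL
    have e1 := (skewPDF_pos (lam α ρ (1 - i)) (x (1 - i) u)).ne'
    have e2 := (skewKernel_pos (1 - ρ ^ 2) (ρ * x (1 - i) u) (α i) (α (1 - i) * x (1 - i) u)
      (x i u)).ne'
    have e3 := hu.ne
    have e4 : Real.log u ≠ 0 := by linarith
    have e5 := Real.exp_pos (-x (1 - i) u ^ 2 / 2)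
    rw [hi, condProb, integral_density_point hr]
    simp_rw [density_point hr, integral_const_mul]
    rw [div_pow, Real.sq_sqrt hL.le]
    field_simp

/-- Unlike `density_point`, this keeps the quadratic form symmetric, as needed for evaluation at the
quantile vector. -/
lemma density_point_eq_exp (i : Fin 2) (y z : ℝ) :
    density α ρ (point i y z) = 1 / (Real.pi * √(1 - ρ ^ 2)) *
      Real.exp (-((y ^ 2 - 2 * ρ * y * z + z ^ 2) / (1 - ρ ^ 2)) / 2) *
      Phi (α i * y + α (1 - i) * z) := by
  have h : ∀ a b : ℝ, -(a ^ 2 - 2 * ρ * a * b + b ^ 2) / (2 * (1 - ρ ^ 2))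
      = -((a ^ 2 - 2 * ρ * a * b + b ^ 2) / (1 - ρ ^ 2)) / 2 := fun a b => by
    rw [mul_comm (2 : ℝ) (1 - ρ ^ 2), ← div_div, neg_div]
  fin_cases i
  · simp only [density, phi2, point, Fin.isValue, Fin.zero_eta, if_true, one_ne_zero,
      if_false, sub_zero, h]
    field_simp
  · simp only [density, phi2, point, Fin.isValue, Fin.mk_one, if_true, zero_ne_one,
      if_false, sub_self, h]
    rw [add_comm (α 0 * z), show z ^ 2 - 2 * ρ * z * y + y ^ 2 = y ^ 2 - 2 * ρ * y * z + z ^ 2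
      by ring]
    field_simp

/-- With `S = -κ_i x_i` and `T = -κ_j x_j`, the identity `2 S T = S² + T² - (S - T)²` turns the form
into `e₁ S² + e₂ T²` plus a multiple of `(S - T)²`, which tends to zero. The expansions of `S²` and
`T²` give the powers and the constant. -/
lemma IsMarginalQuantile.tendsto_exp_quadratic (hx : IsMarginalQuantile α ρ x) (i j : Fin 2)
    (n₁ n₂ n₃ : ℝ) {e₁ e₂ : ℝ}
    (he₁ : e₁ = (n₁ / tailScale α ρ i + n₂ / tailScale α ρ j) / tailScale α ρ i)
    (he₂ : e₂ = (n₂ / tailScale α ρ i + n₃ / tailScale α ρ j) / tailScale α ρ j) :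
    Tendsto (fun u => Real.exp (-(n₁ * x i u ^ 2 + 2 * n₂ * x i u * x j u + n₃ * x j u ^ 2) / 2) /
      (u ^ (e₁ + e₂) * (-Real.log u) ^ ((quantilePower (lam α ρ i) * e₁ +
        quantilePower (lam α ρ j) * e₂) / 2))) (𝓝[>] 0)
      (𝓝 (Real.exp ((quantileConst (lam α ρ i) * e₁ + quantileConst (lam α ρ j) * e₂) / 2))) := by
  have h1 := (tailScale_pos (α := α) (ρ := ρ) i).ne'
  have h2 := (tailScale_pos (α := α) (ρ := ρ) j).ne'
  have h3 := ((((hx.expansion i).mul_const e₁).add ((hx.expansion j).mul_const e₂)).sub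
    (((hx.tendsto_sub i j).pow 2).mul_const (n₂ / (tailScale α ρ i * tailScale α ρ j)))).mul_const
    (-(1 / 2) : ℝ)
  convert h3.rexp.congr' ?_ using 2
  · congr 1; ring
  · filter_upwards [eventually_mem_Ioo_zero_one,
      tendsto_neg_log_nhdsGT.eventually_gt_atTop 0] with u hu hL
    rw [Real.rpow_def_of_pos hu.1, Real.rpow_def_of_pos hL, ← Real.exp_add, ← Real.exp_sub]
    congr 1
    rw [he₁, he₂]
    field_simp
    ring

lemma IsMarginalQuantile.tendsto_linear_div_sqrt (hx : IsMarginalQuantile α ρ x) (i : Fin 2) :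
    Tendsto (fun u => -(α i * x i u + α (1 - i) * x (1 - i) u) / √(-Real.log u)) (𝓝[>] 0)
      (𝓝 (√2 * skewDir α ρ i)) := by
  convert ((hx.tendsto_div_sqrt i).const_mul (α i)).add
    ((hx.tendsto_div_sqrt (1 - i)).const_mul (α (1 - i))) using 2
  · ring
  · rw [skewDir]; ring

lemma tendsto_sqrt_neg_log : Tendsto (fun u => √(-Real.log u)) (𝓝[>] 0) atTop :=
  Real.tendsto_sqrt_atTop.comp tendsto_neg_log_nhdsGT

lemma IsMarginalQuantile.tendsto_linear_atBot (hx : IsMarginalQuantile α ρ x) {i : Fin 2}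
    (h : 0 < skewDir α ρ i) :
    Tendsto (fun u => α i * x i u + α (1 - i) * x (1 - i) u) (𝓝[>] 0) atBot := by
  have h1 := tendsto_neg_atTop_atBot.comp
    (tendsto_sqrt_neg_log.atTop_mul_pos (by positivity) (hx.tendsto_linear_div_sqrt i))
  refine h1.congr' ?_
  filter_upwards [tendsto_sqrt_neg_log.eventually_gt_atTop 0] with u hu
  simp only [Function.comp]
  field_simp

lemma IsMarginalQuantile.tendsto_linear_atTop (hx : IsMarginalQuantile α ρ x) {i : Fin 2}
    (h : skewDir α ρ i < 0) :
    Tendsto (fun u => α i * x i u + α (1 - i) * x (1 - i) u) (𝓝[>] 0) atTop := by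
  have h1 := tendsto_neg_atBot_atTop.comp
    (tendsto_sqrt_neg_log.atTop_mul_neg (mul_neg_of_pos_of_neg (by positivity) h)
      (hx.tendsto_linear_div_sqrt i))
  refine h1.congr' ?_
  filter_upwards [tendsto_sqrt_neg_log.eventually_gt_atTop 0] with u hu
  simp only [Function.comp]
  field_simp

/-- `tendsto_linear_div_sqrt` would only give `o(√(-log u))`. When `skewDir` vanishes, however, the
linear form is an exact multiple of the difference of the scaled quantiles. -/
lemma IsMarginalQuantile.tendsto_linear_zero (hx : IsMarginalQuantile α ρ x) {i : Fin 2}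
    (h : skewDir α ρ i = 0) :
    Tendsto (fun u => α i * x i u + α (1 - i) * x (1 - i) u) (𝓝[>] 0) (𝓝 0) := by
  have h1 := (tailScale_pos (α := α) (ρ := ρ) i).ne'
  have h2 := (tailScale_pos (α := α) (ρ := ρ) (1 - i)).ne'
  have h3 := (hx.tendsto_sub i (1 - i)).mul_const (-(α i / tailScale α ρ i))
  rw [zero_mul] at h3
  refine h3.congr fun u => ?_
  have h4 : α (1 - i) = -(α i / tailScale α ρ i) * tailScale α ρ (1 - i) := by
    rw [skewDir] at h
    have : α (1 - i) / tailScale α ρ (1 - i) = -(α i / tailScale α ρ i) := by linarith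
    rw [← this]; field_simp
  rw [h4]
  field_simp
  ring

/-- The joint density at the quantile vector when its skewing factor decays. -/
lemma IsMarginalQuantile.tendsto_density_of_pos (hx : IsMarginalQuantile α ρ x)
    (hr : 0 < 1 - ρ ^ 2) {i : Fin 2} (h : 0 < skewDir α ρ i) {e₁ e₂ : ℝ}
    (he₁ : e₁ = ((1 / tailScale α ρ i - ρ / tailScale α ρ (1 - i)) / (1 - ρ ^ 2) +
      α i * skewDir α ρ i) / tailScale α ρ i)
    (he₂ : e₂ = ((1 / tailScale α ρ (1 - i) - ρ / tailScale α ρ i) / (1 - ρ ^ 2) +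
      α (1 - i) * skewDir α ρ i) / tailScale α ρ (1 - i)) :
    Tendsto (fun u => density α ρ (point i (x i u) (x (1 - i) u)) * √(-Real.log u) /
      (u ^ (e₁ + e₂) * (-Real.log u) ^ ((quantilePower (lam α ρ i) * e₁ +
        quantilePower (lam α ρ (1 - i)) * e₂) / 2))) (𝓝[>] 0)
      (𝓝 (1 / (Real.pi * √(1 - ρ ^ 2)) * (1 / (√(2 * Real.pi) * (√2 * skewDir α ρ i))) *
        Real.exp ((quantileConst (lam α ρ i) * e₁ +
          quantileConst (lam α ρ (1 - i)) * e₂) / 2))) := by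
  have k1 := (tailScale_pos (α := α) (ρ := ρ) i).ne'
  have k2 := (tailScale_pos (α := α) (ρ := ρ) (1 - i)).ne'
  -- Mills' ratio replaces `Φ(m)` by `φ(m) / (-m)` for the linear form `m`, so the matrix of the
  -- quadratic form is `R⁻¹ + α αᵀ`; `-m` accounts for the factor `√(-log u)`.
  have h1 := hx.tendsto_exp_quadratic i (1 - i) (1 / (1 - ρ ^ 2) + α i ^ 2)
    (-ρ / (1 - ρ ^ 2) + α i * α (1 - i)) (1 / (1 - ρ ^ 2) + α (1 - i) ^ 2) (e₁ := e₁) (e₂ := e₂)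
    (by rw [he₁, skewDir]; field_simp; ring) (by rw [he₂, skewDir]; field_simp; ring)
  have h2 := tendsto_Phi_mul_neg_div_stdPDF.comp (hx.tendsto_linear_atBot h)
  have h3 := (hx.tendsto_linear_div_sqrt i).inv₀ (by positivity)
  have h4 := (((h2.mul h3).mul h1).const_mul (√(2 * Real.pi))⁻¹).const_mul
    (1 / (Real.pi * √(1 - ρ ^ 2)))
  convert h4.congr' ?_ using 2
  · field_simp
  · filter_upwards [eventually_mem_Ioo_zero_one, tendsto_neg_log_nhdsGT.eventually_gt_atTop 0,
      tendsto_sqrt_neg_log.eventually_gt_atTop 0,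
      (hx.tendsto_linear_atBot h).eventually_lt_atBot 0] with u hu hL hsL hm
    rw [density_point_eq_exp]
    simp only [Function.comp, stdPDF]
    set m := α i * x i u + α (1 - i) * x (1 - i) u with hmdef
    have e1 : Real.exp (-((1 / (1 - ρ ^ 2) + α i ^ 2) * x i u ^ 2 + 2 * (-ρ / (1 - ρ ^ 2) +
        α i * α (1 - i)) * x i u * x (1 - i) u +
        (1 / (1 - ρ ^ 2) + α (1 - i) ^ 2) * x (1 - i) u ^ 2) / 2) =
        Real.exp (-((x i u ^ 2 - 2 * ρ * x i u * x (1 - i) u + x (1 - i) u ^ 2) /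
          (1 - ρ ^ 2)) / 2) * Real.exp (-m ^ 2 / 2) := by
      rw [← Real.exp_add, hmdef]
      congr 1
      field_simp
      ring
    rw [e1]
    have e2 := Real.exp_pos (-m ^ 2 / 2)
    have e3 := hm.ne
    have e4 := Real.rpow_pos_of_pos hL ((quantilePower (lam α ρ i) * e₁ +
        quantilePower (lam α ρ (1 - i)) * e₂) / 2)
    have e5 := Real.rpow_pos_of_pos hu.1 (e₁ + e₂)
    field_simp

/-- The joint density at the quantile vector when its skewing factor converges. -/
lemma IsMarginalQuantile.tendsto_density_of_tendsto (hx : IsMarginalQuantile α ρ x)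
    (hr : 0 < 1 - ρ ^ 2) {i : Fin 2} {f : ℝ}
    (h : Tendsto (fun u => Phi (α i * x i u + α (1 - i) * x (1 - i) u)) (𝓝[>] 0) (𝓝 f))
    {e₁ e₂ : ℝ}
    (he₁ : e₁ = (1 / tailScale α ρ i - ρ / tailScale α ρ (1 - i)) / (1 - ρ ^ 2) /
      tailScale α ρ i)
    (he₂ : e₂ = (1 / tailScale α ρ (1 - i) - ρ / tailScale α ρ i) / (1 - ρ ^ 2) /
      tailScale α ρ (1 - i)) :
    Tendsto (fun u => density α ρ (point i (x i u) (x (1 - i) u)) /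
      (u ^ (e₁ + e₂) * (-Real.log u) ^ ((quantilePower (lam α ρ i) * e₁ +
        quantilePower (lam α ρ (1 - i)) * e₂) / 2))) (𝓝[>] 0)
      (𝓝 (1 / (Real.pi * √(1 - ρ ^ 2)) * f *
        Real.exp ((quantileConst (lam α ρ i) * e₁ +
          quantileConst (lam α ρ (1 - i)) * e₂) / 2))) := by
  have k1 := (tailScale_pos (α := α) (ρ := ρ) i).ne'
  have k2 := (tailScale_pos (α := α) (ρ := ρ) (1 - i)).ne'
  have h1 := hx.tendsto_exp_quadratic i (1 - i) (1 / (1 - ρ ^ 2)) (-ρ / (1 - ρ ^ 2))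
    (1 / (1 - ρ ^ 2)) (e₁ := e₁) (e₂ := e₂)
    (by rw [he₁]; field_simp; ring) (by rw [he₂]; field_simp; ring)
  refine ((h.const_mul (1 / (Real.pi * √(1 - ρ ^ 2)))).mul h1).congr fun u => ?_
  rw [density_point_eq_exp, show -(1 / (1 - ρ ^ 2) * x i u ^ 2 + 2 * (-ρ / (1 - ρ ^ 2)) * x i u *
    x (1 - i) u + 1 / (1 - ρ ^ 2) * x (1 - i) u ^ 2) = -((x i u ^ 2 - 2 * ρ * x i u *
    x (1 - i) u + x (1 - i) u ^ 2) / (1 - ρ ^ 2)) by field_simp; ring]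
  ring

lemma IsMarginalQuantile.tendsto_condProb_add (hx : IsMarginalQuantile α ρ x)
    (hr : 0 < 1 - ρ ^ 2) {i : Fin 2} (hB : 0 < decayRate α ρ i)
    (hB' : 0 < decayRate α ρ (1 - i)) :
    Tendsto (fun u => (condProb α ρ i (x i u) (x (1 - i) u) +
      condProb α ρ (1 - i) (x (1 - i) u) (x i u)) * (u * -Real.log u) /
      density α ρ (point i (x i u) (x (1 - i) u))) (𝓝[>] 0)
      (𝓝 ((1 / decayRate α ρ i + 1 / decayRate α ρ (1 - i)) / 2)) := by
  have h1 := hx.tendsto_condProb hr (1 - i) hB'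
  simp_rw [sub_sub_cancel, point_one_sub] at h1
  convert (hx.tendsto_condProb hr i hB).add h1 using 2
  · ring
  · field_simp

end Quantiles

/-! ### The diagonal in the two regimes of the skewing factor. -/

section RandomVector

variable {Ω : Type*} [MeasurableSpace Ω] {P : Measure Ω} [IsProbabilityMeasure P]
  {Z : Ω → Fin 2 → ℝ}

lemma isMarginalQuantile_quantile (hρ₁ : -1 < ρ) (hρ₂ : ρ < 1) (hZ : HasLaw Z (law α ρ) P) :
    IsMarginalQuantile α ρ (quantile P Z) where
  tendsto := tendsto_quantile hρ₁ hρ₂ hZ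
  integral_eq i := by
    filter_upwards [eventually_mem_Ioo_zero_one] with u hu
    rw [← margCDF_eq_integral hρ₁ hρ₂ hZ, margCDF_quantile hρ₁ hρ₂ hZ i hu]

lemma tendsto_copula_diag (hρ₁ : -1 < ρ) (hρ₂ : ρ < 1) (hZ : HasLaw Z (law α ρ) P) :
    Tendsto (fun u => copula P Z u u) (𝓝[>] 0) (𝓝 0) := by
  refine tendsto_of_tendsto_of_tendsto_of_le_of_le' tendsto_const_nhds
    (tendsto_id.mono_left nhdsWithin_le_nhds) (Eventually.of_forall fun u =>
      copula_diag_nonneg u) ?_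
  filter_upwards [eventually_mem_Ioo_zero_one] with u hu using copula_diag_le hρ₁ hρ₂ hZ hu

lemma hasDerivAt_copula_diag' (hρ₁ : -1 < ρ) (hρ₂ : ρ < 1) (hZ : HasLaw Z (law α ρ) P)
    (i : Fin 2) {u : ℝ} (hu : u ∈ Ioo (0 : ℝ) 1) :
    HasDerivAt (fun x => copula P Z x x)
      (condProb α ρ i (quantile P Z i u) (quantile P Z (1 - i) u) +
        condProb α ρ (1 - i) (quantile P Z (1 - i) u) (quantile P Z i u)) u := by
  have h := hasDerivAt_copula_diag hρ₁ hρ₂ hZ hu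
  fin_cases i
  · exact h
  · rw [add_comm] at h; exact h

/-- The diagonal section when the skewing factor decays along the quantile curve. -/
lemma diagonalAsymptotics_of_pos (hρ₁ : -1 < ρ) (hρ₂ : ρ < 1) (hZ : HasLaw Z (law α ρ) P)
    {i : Fin 2} (h : 0 < skewDir α ρ i) (hB : 0 < bet α ρ i) (hB' : 0 < bet α ρ (1 - i))
    {e₁ e₂ : ℝ}
    (he₁ : e₁ = ((1 / tailScale α ρ i - ρ / tailScale α ρ (1 - i)) / (1 - ρ ^ 2) +
      α i * skewDir α ρ i) / tailScale α ρ i)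
    (he₂ : e₂ = ((1 / tailScale α ρ (1 - i) - ρ / tailScale α ρ i) / (1 - ρ ^ 2) +
      α (1 - i) * skewDir α ρ i) / tailScale α ρ (1 - i)) (hθ : 1 < e₁ + e₂) :
    DiagonalAsymptotics (fun x => copula P Z x x) (e₁ + e₂ - 1)
      ((1 / bet α ρ i + 1 / bet α ρ (1 - i)) / 2 * (1 / (Real.pi * √(1 - ρ ^ 2)) *
        (1 / (√(2 * Real.pi) * (√2 * skewDir α ρ i))) *
        Real.exp ((quantileConst (lam α ρ i) * e₁ + quantileConst (lam α ρ (1 - i)) * e₂) / 2)))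
      ((quantilePower (lam α ρ i) * e₁ + quantilePower (lam α ρ (1 - i)) * e₂) / 2 - 3 / 2) := by
  have hr := one_sub_sq_pos hρ₁ hρ₂
  have hx := isMarginalQuantile_quantile hρ₁ hρ₂ hZ
  have r1 := decayRate_of_pos h
  have r2 := decayRate_of_pos ((skewDir_one_sub (α := α) (ρ := ρ) i).symm ▸ h)
  have h1 := hx.tendsto_condProb_add hr (i := i) (by rwa [r1]) (by rwa [r2])
  rw [r1, r2] at h1
  refine diagonalAsymptotics_of_tendsto (fun u hu => hasDerivAt_copula_diag' hρ₁ hρ₂ hZ i hu)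
    (tendsto_copula_diag hρ₁ hρ₂ hZ) (by linarith) (by positivity)
    ((h1.mul (hx.tendsto_density_of_pos hr h he₁ he₂)).congr' ?_)
  filter_upwards [eventually_mem_Ioo_zero_one, tendsto_neg_log_nhdsGT.eventually_gt_atTop 0,
    tendsto_sqrt_neg_log.eventually_gt_atTop 0] with u hu hL hsL
  have e0 : density α ρ (point i (quantile P Z i u) (quantile P Z (1 - i) u)) ≠ 0 := by
    rw [density_point_eq_exp]
    exact mul_ne_zero (by positivity) (Phi_pos _).ne'
  -- Of the power `3/2` of `-log u` that is lost, `1` comes from the conditional probabilities and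
  -- `1/2` from Mills' ratio.
  rw [Real.rpow_sub_one hu.1.ne', show ∀ s : ℝ, s - 3 / 2 = s - 1 - 1 / 2 by intro s; ring,
    Real.rpow_sub hL, Real.rpow_sub_one hL.ne', ← Real.sqrt_eq_rpow]
  have e1 := hu.1.ne'
  have e2 := (Real.rpow_pos_of_pos hL ((quantilePower (lam α ρ i) * e₁ +
        quantilePower (lam α ρ (1 - i)) * e₂) / 2)).ne'
  have e3 := (Real.rpow_pos_of_pos hu.1 (e₁ + e₂)).ne'
  have e4 : Real.log u ≠ 0 := by linarith
  field_simp

/-- The diagonal section when the skewing factor converges along the quantile curve. -/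
lemma diagonalAsymptotics_of_tendsto_Phi (hρ₁ : -1 < ρ) (hρ₂ : ρ < 1)
    (hZ : HasLaw Z (law α ρ) P) {i : Fin 2} (h : skewDir α ρ i ≤ 0) {f : ℝ} (hf0 : 0 < f)
    (hf : Tendsto (fun u => Phi (α i * quantile P Z i u + α (1 - i) * quantile P Z (1 - i) u))
      (𝓝[>] 0) (𝓝 f)) (hB : ρ < gam α ρ i) (hB' : ρ < gam α ρ (1 - i)) {e₁ e₂ : ℝ}
    (he₁ : e₁ = (1 / tailScale α ρ i - ρ / tailScale α ρ (1 - i)) / (1 - ρ ^ 2) /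
      tailScale α ρ i)
    (he₂ : e₂ = (1 / tailScale α ρ (1 - i) - ρ / tailScale α ρ i) / (1 - ρ ^ 2) /
      tailScale α ρ (1 - i)) (hθ : 1 < e₁ + e₂) :
    DiagonalAsymptotics (fun x => copula P Z x x) (e₁ + e₂ - 1)
      ((1 / (gam α ρ i - ρ) + 1 / (gam α ρ (1 - i) - ρ)) * √(1 - ρ ^ 2) * f / (2 * Real.pi) *
        Real.exp ((quantileConst (lam α ρ i) * e₁ + quantileConst (lam α ρ (1 - i)) * e₂) / 2))
      ((quantilePower (lam α ρ i) * e₁ + quantilePower (lam α ρ (1 - i)) * e₂) / 2 - 1) := by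
  have hr := one_sub_sq_pos hρ₁ hρ₂
  have hx := isMarginalQuantile_quantile hρ₁ hρ₂ hZ
  have hb1 := sub_pos.2 hB
  have hb2 := sub_pos.2 hB'
  have r1 := decayRate_of_nonpos h
  have r2 := decayRate_of_nonpos ((skewDir_one_sub (α := α) (ρ := ρ) i).symm ▸ h)
  have h1 := hx.tendsto_condProb_add hr (i := i) (by rw [r1]; positivity) (by rw [r2]; positivity)
  rw [r1, r2] at h1
  refine diagonalAsymptotics_of_tendsto (fun u hu => hasDerivAt_copula_diag' hρ₁ hρ₂ hZ i hu)
    (tendsto_copula_diag hρ₁ hρ₂ hZ) (by linarith) (by positivity) ?_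
  have h2 := h1.mul (hx.tendsto_density_of_tendsto hr hf he₁ he₂)
  have e : (1 / (gam α ρ i - ρ) + 1 / (gam α ρ (1 - i) - ρ)) * √(1 - ρ ^ 2) * f / (2 * Real.pi) *
        Real.exp ((quantileConst (lam α ρ i) * e₁ + quantileConst (lam α ρ (1 - i)) * e₂) / 2) =
      (1 / ((gam α ρ i - ρ) / (1 - ρ ^ 2)) + 1 / ((gam α ρ (1 - i) - ρ) / (1 - ρ ^ 2))) / 2 *
      (1 / (Real.pi * √(1 - ρ ^ 2)) * f * Real.exp ((quantileConst (lam α ρ i) * e₁ +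
          quantileConst (lam α ρ (1 - i)) * e₂) / 2)) := by
    nth_rw 1 [← Real.div_sqrt (x := 1 - ρ ^ 2)]
    rw [one_div_div, one_div_div]
    ring
  rw [e]
  refine h2.congr' ?_
  filter_upwards [eventually_mem_Ioo_zero_one, tendsto_neg_log_nhdsGT.eventually_gt_atTop 0]
    with u hu hL
  have e0 : density α ρ (point i (quantile P Z i u) (quantile P Z (1 - i) u)) ≠ 0 := by
    rw [density_point_eq_exp]
    exact mul_ne_zero (by positivity) (Phi_pos _).ne'
  rw [Real.rpow_sub_one hu.1.ne', Real.rpow_sub_one hL.ne']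
  have e1 := hu.1.ne'
  have e2 := (Real.rpow_pos_of_pos hL ((quantilePower (lam α ρ i) * e₁ +
        quantilePower (lam α ρ (1 - i)) * e₂) / 2)).ne'
  have e3 := (Real.rpow_pos_of_pos hu.1 (e₁ + e₂)).ne'
  have e4 : Real.log u ≠ 0 := by linarith
  field_simp

end RandomVector

/-! ### Inequalities between the parameters. -/

section Parameters

variable {α : Fin 2 → ℝ} {ρ : ℝ}

lemma lam_denom_pos (hr : 0 < 1 - ρ ^ 2) (a : ℝ) : 0 < √(1 + a ^ 2 * (1 - ρ ^ 2)) := by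
  positivity

lemma lam_neg_iff (hr : 0 < 1 - ρ ^ 2) (i : Fin 2) :
    lam α ρ i < 0 ↔ α i + ρ * α (1 - i) < 0 := by
  rw [lam, div_lt_iff₀ (lam_denom_pos hr _), zero_mul]

lemma lam_eq_zero_iff (hr : 0 < 1 - ρ ^ 2) (i : Fin 2) :
    lam α ρ i = 0 ↔ α i + ρ * α (1 - i) = 0 := by
  rw [lam, div_eq_zero_iff, or_iff_left (lam_denom_pos hr _).ne']

lemma lam_pos_iff (hr : 0 < 1 - ρ ^ 2) (i : Fin 2) :
    0 < lam α ρ i ↔ 0 < α i + ρ * α (1 - i) := by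
  rw [lam, div_pos_iff_of_pos_right (lam_denom_pos hr _)]

lemma tailScale_of_nonpos {i : Fin 2} (h : lam α ρ i ≤ 0) : tailScale α ρ i = 1 :=
  if_neg (not_lt.2 h)

lemma tailScale_of_pos {i : Fin 2} (h : 0 < lam α ρ i) :
    tailScale α ρ i = √(1 + lam α ρ i ^ 2) := if_pos h

/-- The right side is `1 + αᵀRα`, symmetric in the indices; this links `λ_i` with `λ_j`. -/
lemma one_add_lam_sq_mul (hr : 0 < 1 - ρ ^ 2) (i : Fin 2) :
    (1 + lam α ρ i ^ 2) * (1 + α (1 - i) ^ 2 * (1 - ρ ^ 2)) =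
      1 + α i ^ 2 + α (1 - i) ^ 2 + 2 * ρ * α i * α (1 - i) := by
  have h := lam_denom_pos hr (α (1 - i))
  have h2 : √(1 + α (1 - i) ^ 2 * (1 - ρ ^ 2)) ^ 2 = 1 + α (1 - i) ^ 2 * (1 - ρ ^ 2) :=
    Real.sq_sqrt (by positivity)
  rw [lam, div_pow, h2]
  field_simp
  ring

lemma one_add_quadratic_pos (hρ₁ : -1 < ρ) (hρ₂ : ρ < 1) (a b : ℝ) :
    0 < 1 + a ^ 2 + b ^ 2 + 2 * ρ * a * b := by
  nlinarith [sq_nonneg (a + ρ * b), mul_nonneg (sq_nonneg b) (one_sub_sq_pos hρ₁ hρ₂).le]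

/-- With `r = 1 - ρ²`, `(1 + a²r)(1 + b²r) - (ρ - abr)² = r (1 + a² + b² + 2ρab) > 0`, and the
hypothesis bounds the product by `(γ (1 + a²r))²`. -/
lemma sub_mul_lt_mul_of_sq (hρ₁ : -1 < ρ) (hρ₂ : ρ < 1) {a b γ : ℝ} (hγ : 0 < γ)
    (h : 1 + b ^ 2 * (1 - ρ ^ 2) ≤ γ ^ 2 * (1 + a ^ 2 * (1 - ρ ^ 2))) :
    |ρ - a * b * (1 - ρ ^ 2)| < γ * (1 + a ^ 2 * (1 - ρ ^ 2)) := by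
  have hr := one_sub_sq_pos hρ₁ hρ₂
  have hs := one_add_quadratic_pos hρ₁ hρ₂ a b
  have hA : 0 < 1 + a ^ 2 * (1 - ρ ^ 2) := by positivity
  refine abs_lt_of_sq_lt_sq ?_ (by positivity)
  have h1 := mul_le_mul_of_nonneg_right h hA.le
  have h2 := mul_pos hr hs
  nlinarith

lemma bet_pos_of_sq (hρ₁ : -1 < ρ) (hρ₂ : ρ < 1) (i : Fin 2)
    (h : 1 + α (1 - i) ^ 2 * (1 - ρ ^ 2) ≤ gam α ρ i ^ 2 * (1 + α i ^ 2 * (1 - ρ ^ 2))) :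
    0 < bet α ρ i := by
  have hr := one_sub_sq_pos hρ₁ hρ₂
  have hγ : 0 < gam α ρ i := div_pos (tailScale_pos _) (tailScale_pos _)
  have h1 := (abs_lt.1 (sub_mul_lt_mul_of_sq hρ₁ hρ₂ hγ h)).2
  have : bet α ρ i = (gam α ρ i * (1 + α i ^ 2 * (1 - ρ ^ 2)) -
      (ρ - α i * α (1 - i) * (1 - ρ ^ 2))) / (1 - ρ ^ 2) := by
    rw [bet]; field_simp; ring
  rw [this]
  exact div_pos (by linarith) hr

lemma gam_sq_mul_of_pos (hr : 0 < 1 - ρ ^ 2) {i : Fin 2} (h : 0 < lam α ρ (1 - i)) :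
    (gam α ρ i * tailScale α ρ i) ^ 2 * (1 + α i ^ 2 * (1 - ρ ^ 2)) =
      1 + α i ^ 2 + α (1 - i) ^ 2 + 2 * ρ * α i * α (1 - i) := by
  have h1 := one_add_lam_sq_mul (α := α) hr (1 - i)
  rw [sub_sub_cancel] at h1
  rw [gam, div_mul_cancel₀ _ (tailScale_pos i).ne', tailScale_of_pos h,
    Real.sq_sqrt (by positivity), h1]
  ring

lemma bet_pos_of_nonpos_of_pos (hρ₁ : -1 < ρ) (hρ₂ : ρ < 1) {i : Fin 2} (hi : lam α ρ i ≤ 0)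
    (hj : 0 < lam α ρ (1 - i)) : 0 < bet α ρ i := by
  refine bet_pos_of_sq hρ₁ hρ₂ i ?_
  have h := gam_sq_mul_of_pos (one_sub_sq_pos hρ₁ hρ₂) hj
  rw [tailScale_of_nonpos hi, mul_one] at h
  rw [h]
  -- The two sides differ by exactly `(α_i + ρ α_j)²`.
  nlinarith [sq_nonneg (α i + ρ * α (1 - i))]

lemma bet_pos_of_pos_of_pos (hρ₁ : -1 < ρ) (hρ₂ : ρ < 1) {i : Fin 2} (hi : 0 < lam α ρ i)
    (hj : 0 < lam α ρ (1 - i)) : 0 < bet α ρ i := by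
  have hr := one_sub_sq_pos hρ₁ hρ₂
  refine bet_pos_of_sq hρ₁ hρ₂ i ?_
  have h := gam_sq_mul_of_pos hr hj
  have h2 := one_add_lam_sq_mul (α := α) hr i
  rw [mul_pow, tailScale_of_pos hi, Real.sq_sqrt (by positivity), ← h2] at h
  have h3 : 0 < 1 + lam α ρ i ^ 2 := by positivity
  nlinarith

/-- Write `a = α_i`, `c = α_j`, `r = 1 - ρ²`. Only `ρ > 0` matters. Then `1 + αᵀRα = 1 + a²r + (c +
ρa)²`, and `λ_i ≤ 0` gives `ρ(c + ρa) ≤ -ra`, so `ρ² (1 + αᵀRα) ≤ ρ² + a²r < 1 + a²r`. -/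
lemma inv_sqrt_gt_of_nonpos_of_pos (hρ₁ : -1 < ρ) (hρ₂ : ρ < 1) {i : Fin 2} (hi : lam α ρ i ≤ 0)
    (hj : 0 < lam α ρ (1 - i)) : ρ < 1 / √(1 + lam α ρ (1 - i) ^ 2) := by
  have hr := one_sub_sq_pos hρ₁ hρ₂
  rcases le_or_gt ρ 0 with h0 | h0
  · exact h0.trans_lt (by positivity)
  rw [lt_div_iff₀ (by positivity)]
  have h1 := one_add_lam_sq_mul (α := α) hr (1 - i)
  rw [lam_pos_iff hr] at hj
  have hi' : α i + ρ * α (1 - i) ≤ 0 := by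
    by_contra hc
    exact absurd ((lam_pos_iff hr i).2 (not_le.1 hc)) (not_lt.2 hi)
  rw [sub_sub_cancel] at h1 hj
  have h2 : √(1 + lam α ρ (1 - i) ^ 2) ^ 2 = 1 + lam α ρ (1 - i) ^ 2 :=
    Real.sq_sqrt (by positivity)
  rw [← h2] at h1
  set w := √(1 + lam α ρ (1 - i) ^ 2)
  set a := α i
  set c := α (1 - i)
  refine lt_of_pow_lt_pow_left₀ 2 one_pos.le ?_
  have hA : 0 < 1 + a ^ 2 * (1 - ρ ^ 2) := by positivity
  have hB : ρ * (c + ρ * a) ≤ (1 - ρ ^ 2) * -a := by nlinarith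
  have hB0 : 0 ≤ ρ * (c + ρ * a) := by positivity
  have hB2 := pow_le_pow_left₀ hB0 hB 2
  have key : (ρ * w) ^ 2 * (1 + a ^ 2 * (1 - ρ ^ 2)) < 1 * (1 + a ^ 2 * (1 - ρ ^ 2)) := by
    rw [mul_pow, mul_assoc, h1]
    nlinarith
  simpa using lt_of_mul_lt_mul_right key hA.le

/-- If one coefficient `a` of `α` is negative, adding the two sign conditions shows that the other,
`c`, exceeds `-a`. By `one_add_lam_sq_mul` the squared comparison reduces to `a²(1 + c²r) < c²(1 +
a²r)`, `r = 1 - ρ²`, that is to `a² < c²`. -/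
lemma skewDir_pos_of_pos_of_pos (hρ₁ : -1 < ρ) (hρ₂ : ρ < 1) {i : Fin 2} (hi : 0 < lam α ρ i)
    (hj : 0 < lam α ρ (1 - i)) : 0 < skewDir α ρ i := by
  have hr := one_sub_sq_pos hρ₁ hρ₂
  have key : ∀ i : Fin 2, 0 < lam α ρ i → 0 < lam α ρ (1 - i) → α i < 0 → 0 < skewDir α ρ i := by
    intro i hi hj hneg
    have e1 := one_add_lam_sq_mul (α := α) hr i
    have e2 := one_add_lam_sq_mul (α := α) hr (1 - i)
    have k1 := tailScale_pos (α := α) (ρ := ρ) i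
    have k2 := tailScale_pos (α := α) (ρ := ρ) (1 - i)
    have q1 : tailScale α ρ i ^ 2 = 1 + lam α ρ i ^ 2 := by
      rw [tailScale_of_pos hi, Real.sq_sqrt (by positivity)]
    have q2 : tailScale α ρ (1 - i) ^ 2 = 1 + lam α ρ (1 - i) ^ 2 := by
      rw [tailScale_of_pos hj, Real.sq_sqrt (by positivity)]
    rw [lam_pos_iff hr] at hi hj
    rw [sub_sub_cancel] at hj e2
    rw [← q1] at e1
    rw [← q2] at e2
    rw [skewDir]
    set s := tailScale α ρ i
    set t := tailScale α ρ (1 - i)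
    set a := α i
    set c := α (1 - i)
    have hac : 0 < a + c := by
      have : 0 < (1 + ρ) * (a + c) := by nlinarith
      exact pos_of_mul_pos_right this (by linarith)
    have hc : 0 < c := by linarith
    have hA : 0 < 1 + a ^ 2 * (1 - ρ ^ 2) := by positivity
    have hC : 0 < 1 + c ^ 2 * (1 - ρ ^ 2) := by positivity
    have hs : 0 < 1 + a ^ 2 + c ^ 2 + 2 * ρ * a * c := one_add_quadratic_pos hρ₁ hρ₂ a c
    have hlt : -a * t < c * s := by
      refine lt_of_pow_lt_pow_left₀ 2 (by positivity) ?_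
      have h1 : a ^ 2 < c ^ 2 := by nlinarith
      have h2 : (-a * t) ^ 2 * ((1 + a ^ 2 * (1 - ρ ^ 2)) * (1 + c ^ 2 * (1 - ρ ^ 2))) <
          (c * s) ^ 2 * ((1 + a ^ 2 * (1 - ρ ^ 2)) * (1 + c ^ 2 * (1 - ρ ^ 2))) := by
        calc _ = a ^ 2 * (1 + c ^ 2 * (1 - ρ ^ 2)) * (1 + a ^ 2 + c ^ 2 + 2 * ρ * a * c) := by
              linear_combination a ^ 2 * (1 + c ^ 2 * (1 - ρ ^ 2)) * e2
          _ < c ^ 2 * (1 + a ^ 2 * (1 - ρ ^ 2)) * (1 + a ^ 2 + c ^ 2 + 2 * ρ * a * c) :=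
              mul_lt_mul_of_pos_right (by linarith) hs
          _ = _ := by linear_combination -c ^ 2 * (1 + a ^ 2 * (1 - ρ ^ 2)) * e1
      exact lt_of_mul_lt_mul_right h2 (by positivity)
    rw [div_add_div _ _ k1.ne' k2.ne']
    exact div_pos (by linarith) (by positivity)
  rcases lt_or_ge (α i) 0 with h | h
  · exact key i hi hj h
  rcases lt_or_ge (α (1 - i)) 0 with h' | h'
  · rw [← skewDir_one_sub]
    exact key (1 - i) hj (by rwa [sub_sub_cancel]) h'
  have k1 := tailScale_pos (α := α) (ρ := ρ) i
  have k2 := tailScale_pos (α := α) (ρ := ρ) (1 - i)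
  rw [lam_pos_iff hr] at hi
  rw [skewDir]
  rcases h.eq_or_lt with h0 | h0
  · have : 0 < α (1 - i) := by
      refine h'.lt_of_ne fun h1 => ?_
      rw [← h0, ← h1] at hi; simp at hi
    positivity
  · positivity

/-- The exponent of the diagonal is positive when both margins are positively skewed. -/
lemma quadratic_gt_one (hρ₁ : -1 < ρ) (hρ₂ : ρ < 1) {i : Fin 2} (hi : 0 < lam α ρ i)
    (hj : 0 < lam α ρ (1 - i)) {g₁ g₂ b : ℝ} (hg₁ : g₁ = 1 / √(1 + lam α ρ i ^ 2))
    (hg₂ : g₂ = 1 / √(1 + lam α ρ (1 - i) ^ 2)) (hb : b = α i * g₁ + α (1 - i) * g₂) :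
    1 < (g₁ ^ 2 - 2 * ρ * g₁ * g₂ + g₂ ^ 2) / (1 - ρ ^ 2) + b ^ 2 := by
  have hr := one_sub_sq_pos hρ₁ hρ₂
  have e1 := one_add_lam_sq_mul (α := α) hr i
  have e2 := one_add_lam_sq_mul (α := α) hr (1 - i)
  rw [sub_sub_cancel] at e2
  have p1 : 0 < g₁ := by rw [hg₁]; positivity
  have p2 : 0 < g₂ := by rw [hg₂]; positivity
  have q1 : g₁ ^ 2 * (1 + lam α ρ i ^ 2) = 1 := by
    rw [hg₁, div_pow, Real.sq_sqrt (by positivity)]; field_simp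
  have q2 : g₂ ^ 2 * (1 + lam α ρ (1 - i) ^ 2) = 1 := by
    rw [hg₂, div_pow, Real.sq_sqrt (by positivity)]; field_simp
  set a := α i
  set c := α (1 - i)
  have hs : 0 < 1 + a ^ 2 + c ^ 2 + 2 * ρ * a * c := one_add_quadratic_pos hρ₁ hρ₂ a c
  set s := 1 + a ^ 2 + c ^ 2 + 2 * ρ * a * c with hsdef
  have f1 : 1 + c ^ 2 * (1 - ρ ^ 2) = g₁ ^ 2 * s := by
    rw [← e1]; linear_combination -(1 + c ^ 2 * (1 - ρ ^ 2)) * q1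
  have f2 : 1 + a ^ 2 * (1 - ρ ^ 2) = g₂ ^ 2 * s := by
    rw [show s = 1 + c ^ 2 + a ^ 2 + 2 * ρ * c * a by rw [hsdef]; ring, ← e2]
    linear_combination -(1 + a ^ 2 * (1 - ρ ^ 2)) * q2
  have hT := sub_mul_lt_mul_of_sq hρ₁ hρ₂ (a := a) (b := c) (γ := g₁ / g₂) (by positivity)
    (by rw [f1, f2]; exact le_of_eq (by field_simp))
  rw [f2, show g₁ / g₂ * (g₂ ^ 2 * s) = g₁ * g₂ * s by field_simp] at hT
  have hT' := (abs_lt.1 hT).2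
  set T := ρ - a * c * (1 - ρ ^ 2) with hTdef
  -- The identity `(1 + a²r)(1 + c²r) - T² = r s`, with `r = 1 - ρ²`. It makes the excess of the
  -- exponent over `1` a positive multiple of `(g₁ g₂ s - T)²`.
  have h3 : 1 - ρ ^ 2 = ((g₁ * g₂ * s) ^ 2 - T ^ 2) / s := by
    rw [eq_div_iff hs.ne', show (g₁ * g₂ * s) ^ 2 = (g₁ ^ 2 * s) * (g₂ ^ 2 * s) by ring, ← f1,
      ← f2, hTdef, hsdef]
    ring
  have h4 : (g₁ ^ 2 - 2 * ρ * g₁ * g₂ + g₂ ^ 2) / (1 - ρ ^ 2) + b ^ 2 =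
      (2 * (g₁ * g₂) * (g₁ * g₂ * s - T)) / (1 - ρ ^ 2) := by
    rw [div_add' _ _ _ hr.ne']
    congr 1
    rw [hb, hTdef]
    linear_combination g₁ ^ 2 * f2 + g₂ ^ 2 * f1
  rw [h4, one_lt_div hr]
  have h5 : 2 * (g₁ * g₂) * (g₁ * g₂ * s - T) - (1 - ρ ^ 2) = (g₁ * g₂ * s - T) ^ 2 / s := by
    rw [h3]; field_simp; ring
  have h6 : 0 < (g₁ * g₂ * s - T) ^ 2 / s := by
    have : 0 < g₁ * g₂ * s - T := by linarith
    positivity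
  linarith

end Parameters

/-! ### The sign cases of the skewness parameters. -/

section Cases

variable {α : Fin 2 → ℝ} {ρ : ℝ} {Ω : Type*} [MeasurableSpace Ω] {P : Measure Ω}
  [IsProbabilityMeasure P] {Z : Ω → Fin 2 → ℝ}

lemma quantilePower_of_nonpos {l : ℝ} (h : l ≤ 0) : quantilePower l = 1 := if_neg (not_lt.2 h)

lemma quantilePower_of_pos {l : ℝ} (h : 0 < l) : quantilePower l = 2 := if_pos h

lemma quantileConst_of_pos {l : ℝ} (h : 0 < l) :
    quantileConst l = 2 * (Real.log 2 + Real.log Real.pi + Real.log l) := by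
  rw [quantileConst, if_pos h, Real.log_mul (by positivity) h.ne',
    Real.log_mul two_ne_zero Real.pi_ne_zero]

lemma quantileConst_of_neg {l : ℝ} (h : l < 0) : quantileConst l = Real.log Real.pi := by
  rw [quantileConst, if_neg (not_lt.2 h.le), if_neg h.ne]

lemma quantileConst_zero : quantileConst 0 = 2 * Real.log 2 + Real.log Real.pi := by
  rw [quantileConst, if_neg (lt_irrefl _), if_pos rfl, Real.log_mul (by norm_num) Real.pi_ne_zero,
    show (4 : ℝ) = 2 ^ 2 by norm_num, Real.log_pow]
  norm_num

lemma rpow_eq_exp_log {x : ℝ} (hx : 0 < x) (y : ℝ) : x ^ y = Real.exp (Real.log x * y) :=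
  Real.rpow_def_of_pos hx y

/-- The diagonal section when no margin is positively skewed. -/
lemma diagonalAsymptotics_of_nonpos_of_neg (hρ₁ : -1 < ρ) (hρ₂ : ρ < 1)
    (hZ : HasLaw Z (law α ρ) P) {i : Fin 2} (hi : lam α ρ i ≤ 0) (hj : lam α ρ (1 - i) < 0) :
    DiagonalAsymptotics (fun x => copula P Z x x) ((1 - ρ) / (1 + ρ))
      (√((1 + ρ) / (1 - ρ)) * Real.pi⁻¹ *
        Real.exp ((quantileConst (lam α ρ i) + Real.log Real.pi) / (2 * (1 + ρ))))
      (-ρ / (1 + ρ)) := by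
  have hr := one_sub_sq_pos hρ₁ hρ₂
  have h1 : 0 < 1 + ρ := by linarith
  have h2 : 0 < 1 - ρ := by linarith
  have hi' : α i + ρ * α (1 - i) ≤ 0 := by
    by_contra hc
    exact absurd ((lam_pos_iff hr i).2 (not_le.1 hc)) (not_lt.2 hi)
  have hj' := (lam_neg_iff hr (1 - i)).1 hj
  rw [sub_sub_cancel] at hj'
  have t1 := tailScale_of_nonpos hi
  have t2 := tailScale_of_nonpos hj.le
  have hneg : skewDir α ρ i < 0 := by
    rw [skewDir, t1, t2, div_one, div_one]
    have : (1 + ρ) * (α i + α (1 - i)) < 0 := by nlinarith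
    exact (pos_iff_neg_of_mul_neg this).1 h1
  have g1 : gam α ρ i = 1 := by rw [gam, t1, t2, div_one]
  have g2 : gam α ρ (1 - i) = 1 := by rw [gam, sub_sub_cancel, t1, t2, div_one]
  have hf := (isMarginalQuantile_quantile hρ₁ hρ₂ hZ).tendsto_linear_atTop hneg
  have he : 1 / (1 + ρ) = (1 / 1 - ρ / 1) / (1 - ρ ^ 2) / 1 := by
    rw [show 1 - ρ ^ 2 = (1 - ρ) * (1 + ρ) by ring]; field_simp
  have h := diagonalAsymptotics_of_tendsto_Phi hρ₁ hρ₂ hZ hneg.le one_pos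
    (tendsto_Phi_atTop.comp hf) (by rwa [g1]) (by rwa [g2])
    (e₁ := 1 / (1 + ρ)) (e₂ := 1 / (1 + ρ)) (by rw [t1, t2]; exact he)
    (by rw [t1, t2]; exact he) (by
      rw [← add_div, lt_div_iff₀ h1]; linarith)
  convert h using 1
  · field_simp; ring
  · rw [g1, g2, quantileConst_of_neg hj, show 1 - ρ ^ 2 = (1 - ρ) * (1 + ρ) by ring,
      Real.sqrt_mul h2.le, Real.sqrt_div h1.le]
    have e1 : √(1 - ρ) / (1 - ρ) = (√(1 - ρ))⁻¹ := Real.sqrt_div_self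
    rw [div_eq_mul_inv, ← e1]
    have e2 : (quantileConst (lam α ρ i) * (1 / (1 + ρ)) + Real.log Real.pi * (1 / (1 + ρ))) / 2 =
      (quantileConst (lam α ρ i) + Real.log Real.pi) / (2 * (1 + ρ)) := by field_simp
    rw [e2]
    field_simp
    ring
  · rw [quantilePower_of_nonpos hi, quantilePower_of_nonpos hj.le]; field_simp; ring

/-- The parameters of the limiting quadratic form when exactly the second margin is positively
skewed. -/
lemma mixed_scales {i : Fin 2} (hi : lam α ρ i ≤ 0) (hj : 0 < lam α ρ (1 - i)) {w : ℝ}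
    (hw : w = √(1 + lam α ρ (1 - i) ^ 2)) :
    tailScale α ρ i = 1 ∧ tailScale α ρ (1 - i) = w ∧ gam α ρ i = w ∧
      gam α ρ (1 - i) = 1 / w ∧ skewDir α ρ i = α i + α (1 - i) * (1 / w) := by
  have t1 := tailScale_of_nonpos hi
  have t2 := tailScale_of_pos hj
  rw [← hw] at t2
  refine ⟨t1, t2, ?_, ?_, ?_⟩
  · rw [gam, t1, t2, div_one]
  · rw [gam, sub_sub_cancel, t1, t2]
  · rw [skewDir, t1, t2]; ring

/-- The constant is left as an exponential containing `quantileConst (lam α ρ i)`, so that `λ_i < 0`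
and `λ_i = 0` are covered together. -/
lemma diagonalAsymptotics_mixed_of_pos (hρ₁ : -1 < ρ) (hρ₂ : ρ < 1)
    (hZ : HasLaw Z (law α ρ) P) {i : Fin 2} (hi : lam α ρ i ≤ 0) {l w g b r : ℝ}
    (hl : l = lam α ρ (1 - i)) (hw : w = √(1 + l ^ 2)) (hg : g = 1 / w)
    (hb : b = α i + α (1 - i) * g) (hr : r = 1 - ρ ^ 2) (hl0 : 0 < l) (hb0 : 0 < b) :
    0 < bet α ρ i ∧ 0 < bet α ρ (1 - i) ∧
    DiagonalAsymptotics (fun x => copula P Z x x) ((g - ρ) ^ 2 / r + b ^ 2)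
      ((1 / bet α ρ (1 - i) + 1 / bet α ρ i) / (4 * √r * b) *
        Real.exp (-(3 / 2) * Real.log Real.pi + quantileConst (lam α ρ i) *
            (1 + (g - ρ) ^ 2 / r - g * (g - ρ) / r + α i * b) / 2 +
          (Real.log 2 + Real.log Real.pi + Real.log l) * (g * (g - ρ) / r + b ^ 2 - α i * b)))
      ((g - ρ) ^ 2 / (2 * r) + g * (g - ρ) / (2 * r) + b ^ 2 - α i * b / 2 - 1) := by
  subst hl
  have hr0 := one_sub_sq_pos hρ₁ hρ₂
  obtain ⟨t1, t2, g1, g2, hd⟩ := mixed_scales hi hl0 hw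
  rw [← hg] at g2 hd
  rw [← hb] at hd
  have hgρ : ρ < g := by
    rw [hg, hw]; exact inv_sqrt_gt_of_nonpos_of_pos hρ₁ hρ₂ hi hl0
  have hw0 : 0 < w := by rw [hw]; positivity
  have hg0 : 0 < g := by rw [hg]; positivity
  have hi' : α i + ρ * α (1 - i) ≤ 0 := by
    by_contra hc
    exact absurd ((lam_pos_iff hr0 i).2 (not_le.1 hc)) (not_lt.2 hi)
  -- Subtracting `α_i + ρ α_j ≤ 0` from `b = α_i + α_j g > 0` leaves `α_j (g - ρ) > 0`.
  have hαj : 0 < α (1 - i) := by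
    have : 0 < α (1 - i) * (g - ρ) := by nlinarith
    exact pos_of_mul_pos_left this (by linarith)
  have hB := bet_pos_of_nonpos_of_pos hρ₁ hρ₂ hi hl0
  have hB' : 0 < bet α ρ (1 - i) := by
    rw [bet, sub_sub_cancel, g2]
    have e1 : 0 < (g - ρ) / (1 - ρ ^ 2) := div_pos (by linarith) hr0
    have e2 : 0 < α (1 - i) * (α (1 - i) * g + α i) := mul_pos hαj (by linarith)
    linarith
  refine ⟨hB, hB', ?_⟩
  rw [← hr] at hr0
  have hwg : 1 / w = g := hg.symm
  have hρr : ρ ^ 2 = 1 - r := by linarith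
  have hθ : (1 - ρ * g) / r + α i * b + g * ((g - ρ) / r + α (1 - i) * b) =
      1 + ((g - ρ) ^ 2 / r + b ^ 2) := by
    rw [hb]; field_simp; linear_combination -hρr
  have h := diagonalAsymptotics_of_pos hρ₁ hρ₂ hZ (hd ▸ hb0) hB hB'
    (e₁ := (1 - ρ * g) / r + α i * b) (e₂ := g * ((g - ρ) / r + α (1 - i) * b))
    (by rw [t1, t2, hd, ← hr, ← hwg]; field_simp)
    (by rw [t1, t2, hd, ← hr, ← hwg]; field_simp)
    (by rw [hθ]; have : 0 < b ^ 2 := by positivity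
        have : 0 ≤ (g - ρ) ^ 2 / r := by positivity
        linarith)
  have he₂ : g * ((g - ρ) / r + α (1 - i) * b) = g * (g - ρ) / r + b ^ 2 - α i * b := by
    rw [hb]; ring
  have he₁ : (1 - ρ * g) / r + α i * b = 1 + (g - ρ) ^ 2 / r - g * (g - ρ) / r + α i * b := by
    field_simp; linear_combination -hρr
  convert h using 1
  · rw [hθ]; ring
  · rw [he₂, he₁, hd, quantileConst_of_pos hl0, ← hr]
    have e3 : Real.exp (-(3 / 2) * Real.log Real.pi) * (Real.pi * √Real.pi) = 1 := by
      have : √Real.pi = Real.exp (Real.log Real.pi / 2) := by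
        rw [Real.sqrt_eq_rpow, rpow_eq_exp_log Real.pi_pos]; congr 1; ring
      nth_rw 2 [← Real.exp_log Real.pi_pos]
      rw [this, ← Real.exp_add, ← Real.exp_add, ← Real.exp_zero]
      congr 1; ring
    have e4 : √(2 * Real.pi) * √2 = 2 * √Real.pi := by
      rw [Real.sqrt_mul zero_le_two, mul_right_comm, Real.mul_self_sqrt zero_le_two]
    rw [add_assoc (-(3 / 2) * Real.log Real.pi), Real.exp_add, ← mul_assoc (√(2 * Real.pi)), e4,
      eq_div_of_mul_eq (by positivity) e3]
    have e5 : ∀ q A B C : ℝ, q * A / 2 + C * B = (q * A + 2 * C * B) / 2 := by intros; ring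
    rw [e5]
    field_simp
    ring
  · rw [he₂, he₁, quantilePower_of_nonpos hi, quantilePower_of_pos hl0]; ring

/-- `f` is the limit of the skewing factor `Φ(αᵀq)`; it is the only difference between `b = 0` and
`b < 0`, hence the doubled constant. -/
lemma diagonalAsymptotics_mixed_of_nonpos (hρ₁ : -1 < ρ) (hρ₂ : ρ < 1)
    (hZ : HasLaw Z (law α ρ) P) {i : Fin 2} (hi : lam α ρ i ≤ 0) {l w g b r f : ℝ}
    (hl : l = lam α ρ (1 - i)) (hw : w = √(1 + l ^ 2)) (hg : g = 1 / w)
    (hb : b = α i + α (1 - i) * g) (hr : r = 1 - ρ ^ 2) (hl0 : 0 < l)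
    (hf : b = 0 ∧ f = 1 / 2 ∨ b < 0 ∧ f = 1) :
    ρ < g ∧
    DiagonalAsymptotics (fun x => copula P Z x x) ((g - ρ) ^ 2 / r)
      ((1 / (w - ρ) + 1 / (g - ρ)) * √r * f / 2 *
        Real.exp (-Real.log Real.pi + quantileConst (lam α ρ i) *
            (1 + (g - ρ) ^ 2 / r - g * (g - ρ) / r) / 2 +
          (Real.log 2 + Real.log Real.pi + Real.log l) * (g * (g - ρ) / r)))
      ((g - ρ) ^ 2 / (2 * r) + g * (g - ρ) / (2 * r) - 1 / 2) := by
  subst hl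
  have hr0 := one_sub_sq_pos hρ₁ hρ₂
  obtain ⟨t1, t2, g1, g2, hd⟩ := mixed_scales hi hl0 hw
  rw [← hg] at g2 hd
  rw [← hb] at hd
  have hgρ : ρ < g := by
    rw [hg, hw]; exact inv_sqrt_gt_of_nonpos_of_pos hρ₁ hρ₂ hi hl0
  refine ⟨hgρ, ?_⟩
  have hw1 : 1 < w := by rw [hw]; exact Real.lt_sqrt_of_sq_lt (by nlinarith)
  have hw0 : 0 < w := by linarith
  have hg0 : 0 < g := by rw [hg]; positivity
  rw [← hr] at hr0
  have hwg : 1 / w = g := hg.symm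
  have hρr : ρ ^ 2 = 1 - r := by linarith
  have hx := isMarginalQuantile_quantile hρ₁ hρ₂ hZ
  have hf0 : 0 < f := by rcases hf with ⟨-, rfl⟩ | ⟨-, rfl⟩ <;> norm_num
  have hb0 : b ≤ 0 := by rcases hf with ⟨h, -⟩ | ⟨h, -⟩ <;> exact h.le
  have hlim : Tendsto (fun u => Phi (α i * quantile P Z i u +
      α (1 - i) * quantile P Z (1 - i) u)) (𝓝[>] 0) (𝓝 f) := by
    rcases hf with ⟨h, rfl⟩ | ⟨h, rfl⟩
    · rw [← Phi_zero]
      exact (continuous_Phi.tendsto 0).comp (hx.tendsto_linear_zero (hd.trans h))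
    · exact tendsto_Phi_atTop.comp (hx.tendsto_linear_atTop (hd.trans_lt h))
  have hθ : (1 - ρ * g) / r + g * ((g - ρ) / r) = 1 + (g - ρ) ^ 2 / r := by
    field_simp; linear_combination -hρr
  have h := diagonalAsymptotics_of_tendsto_Phi hρ₁ hρ₂ hZ (hd.trans_le hb0) hf0 hlim
    (by rw [g1]; linarith) (by rwa [g2])
    (e₁ := (1 - ρ * g) / r) (e₂ := g * ((g - ρ) / r))
    (by rw [t1, t2, ← hr, ← hwg]; field_simp)
    (by rw [t1, t2, ← hr, ← hwg]; field_simp)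
    (by rw [hθ]
        have : 0 < g - ρ := by linarith
        have : 0 < (g - ρ) ^ 2 / r := by positivity
        linarith)
  have he₂ : g * ((g - ρ) / r) = g * (g - ρ) / r := by ring
  have he₁ : (1 - ρ * g) / r = 1 + (g - ρ) ^ 2 / r - g * (g - ρ) / r := by
    field_simp; linear_combination -hρr
  convert h using 1
  · rw [hθ]; ring
  · rw [he₂, he₁, g1, g2, quantileConst_of_pos hl0, ← hr]
    rw [add_assoc (-Real.log Real.pi), Real.exp_add, Real.exp_neg, Real.exp_log Real.pi_pos]
    have e5 : ∀ q A B C : ℝ, q * A / 2 + C * B = (q * A + 2 * C * B) / 2 := by intros; ring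
    rw [e5]
    ring
  · rw [he₂, he₁, quantilePower_of_nonpos hi, quantilePower_of_pos hl0]; ring

/-- The diagonal section when both margins are positively skewed. -/
lemma diagonalAsymptotics_of_pos_of_pos (hρ₁ : -1 < ρ) (hρ₂ : ρ < 1)
    (hZ : HasLaw Z (law α ρ) P) {i : Fin 2} {l₁ l₂ g₁ g₂ b r θ : ℝ} (hl₁ : l₁ = lam α ρ i)
    (hl₂ : l₂ = lam α ρ (1 - i)) (hg₁ : g₁ = 1 / √(1 + l₁ ^ 2)) (hg₂ : g₂ = 1 / √(1 + l₂ ^ 2))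
    (hb : b = α i * g₁ + α (1 - i) * g₂) (hr : r = 1 - ρ ^ 2)
    (hθ : θ = (g₂ - ρ * g₁) ^ 2 / r + b ^ 2 - l₁ ^ 2 / (1 + l₁ ^ 2)) (h₁ : 0 < l₁)
    (h₂ : 0 < l₂) :
    DiagonalAsymptotics (fun x => copula P Z x x) θ
      ((1 / bet α ρ i + 1 / bet α ρ (1 - i)) *
        ((2 * Real.pi) ^ (θ - 1 / 2) / (√(2 * r) * |b|)) *
        l₁ ^ (g₁ * (g₁ - ρ * g₂) / r + α i * g₁ * b) *
        l₂ ^ (g₂ * (g₂ - ρ * g₁) / r + α (1 - i) * g₂ * b))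
      (θ - 1 / 2) := by
  subst hl₁ hl₂
  have hr0 := one_sub_sq_pos hρ₁ hρ₂
  have t1 := tailScale_of_pos h₁
  have t2 := tailScale_of_pos h₂
  have t1' : 1 / tailScale α ρ i = g₁ := by rw [t1, hg₁]
  have t2' : 1 / tailScale α ρ (1 - i) = g₂ := by rw [t2, hg₂]
  have hd : skewDir α ρ i = b := by
    rw [skewDir, hb, ← t1', ← t2']; ring
  have hb0 : 0 < b := hd ▸ skewDir_pos_of_pos_of_pos hρ₁ hρ₂ h₁ h₂
  have hB := bet_pos_of_pos_of_pos hρ₁ hρ₂ h₁ h₂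
  have hB' := bet_pos_of_pos_of_pos hρ₁ hρ₂ (i := 1 - i) h₂ (by rwa [sub_sub_cancel])
  have hq := quadratic_gt_one hρ₁ hρ₂ h₁ h₂ hg₁ hg₂ hb
  rw [← hr] at hr0 hq
  have hg1sq : g₁ ^ 2 = 1 - lam α ρ i ^ 2 / (1 + lam α ρ i ^ 2) := by
    rw [hg₁, div_pow, Real.sq_sqrt (by positivity)]; field_simp; ring
  have hsum : (g₁ * (g₁ - ρ * g₂) / r + α i * g₁ * b) +
      (g₂ * (g₂ - ρ * g₁) / r + α (1 - i) * g₂ * b) = θ + 1 := by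
    have : θ = (g₂ - ρ * g₁) ^ 2 / r + b ^ 2 + g₁ ^ 2 - 1 := by rw [hθ, hg1sq]; ring
    rw [this]
    have hρr : ρ ^ 2 = 1 - r := by linarith
    have e : α i * g₁ * b + α (1 - i) * g₂ * b = b ^ 2 := by
      rw [← add_mul, ← hb]; ring
    rw [add_add_add_comm, e]
    field_simp
    linear_combination -g₁ ^ 2 * hρr
  have hsum' : g₁ * (g₁ - ρ * g₂) / r + α i * g₁ * b +
      (g₂ * (g₂ - ρ * g₁) / r + α (1 - i) * g₂ * b) =
      (g₁ ^ 2 - 2 * ρ * g₁ * g₂ + g₂ ^ 2) / r + b ^ 2 := by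
    rw [show b ^ 2 = b * b by ring]
    nth_rw 3 [hb]
    ring
  have h := diagonalAsymptotics_of_pos hρ₁ hρ₂ hZ (hd ▸ hb0) hB hB'
    (e₁ := g₁ * (g₁ - ρ * g₂) / r + α i * g₁ * b)
    (e₂ := g₂ * (g₂ - ρ * g₁) / r + α (1 - i) * g₂ * b)
    (by rw [hd, ← hr, ← t1', ← t2']; ring)
    (by rw [hd, ← hr, ← t1', ← t2']; ring)
    (by rw [hsum']; exact hq)
  convert h using 1
  · linarith
  · rw [quantileConst_of_pos h₁, quantileConst_of_pos h₂, hd, ← hr, abs_of_pos hb0,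
      rpow_eq_exp_log h₁, rpow_eq_exp_log h₂, rpow_eq_exp_log (by positivity),
      Real.log_mul two_ne_zero Real.pi_ne_zero]
    set e₁ := g₁ * (g₁ - ρ * g₂) / r + α i * g₁ * b
    set e₂ := g₂ * (g₂ - ρ * g₁) / r + α (1 - i) * g₂ * b
    -- As `e₁ + e₂ = θ + 1`, the common factor is `(2π)^(θ + 1)`; splitting off `(2π)^(3/2)` cancels
    -- the normalising constants of the density and of Mills' ratio.
    have e3 : (2 * (Real.log 2 + Real.log Real.pi + Real.log (lam α ρ i)) * e₁ +
        2 * (Real.log 2 + Real.log Real.pi + Real.log (lam α ρ (1 - i))) * e₂) / 2 =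
        (Real.log 2 + Real.log Real.pi) * (3 / 2) +
        (Real.log 2 + Real.log Real.pi) * (θ - 1 / 2) + Real.log (lam α ρ i) * e₁ +
        Real.log (lam α ρ (1 - i)) * e₂ := by
      linear_combination (Real.log 2 + Real.log Real.pi) * hsum
    have e4 : Real.exp ((Real.log 2 + Real.log Real.pi) * (3 / 2)) =
        2 * Real.pi * √(2 * Real.pi) := by
      rw [← Real.log_mul two_ne_zero Real.pi_ne_zero, ← rpow_eq_exp_log (by positivity),
        show (3 / 2 : ℝ) = 1 + 1 / 2 by norm_num, Real.rpow_add (by positivity), Real.rpow_one,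
        Real.sqrt_eq_rpow]
    rw [e3, Real.exp_add, Real.exp_add, Real.exp_add, e4, Real.sqrt_mul zero_le_two]
    have : √(2 * Real.pi) ≠ 0 := by positivity
    field_simp
  · rw [quantilePower_of_pos h₁, quantilePower_of_pos h₂]; linarith

end Cases

/-! ### Logarithms of the constants. -/

section Constants

lemma inv_pi_eq_exp : Real.pi⁻¹ = Real.exp (-Real.log Real.pi) := by
  rw [Real.exp_neg, Real.exp_log Real.pi_pos]

lemma log_two_mul {l : ℝ} (hl : 0 < l) : Real.log (2 * l) = Real.log 2 + Real.log l :=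
  Real.log_mul two_ne_zero hl.ne'

lemma log_two_pi_mul {l : ℝ} (hl : 0 < l) :
    Real.log (2 * Real.pi * l) = Real.log 2 + Real.log Real.pi + Real.log l := by
  rw [Real.log_mul (by positivity) hl.ne', log_two_mul Real.pi_pos]

lemma log_mul_sqrt_pi {l : ℝ} (hl : 0 < l) :
    Real.log (l * √Real.pi) = Real.log l + Real.log Real.pi / 2 := by
  rw [Real.log_mul hl.ne' (by positivity), Real.log_sqrt Real.pi_pos.le]

lemma inv_sqrt_pi_eq_exp : (√Real.pi)⁻¹ = Real.exp (-(Real.log Real.pi / 2)) := by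
  rw [Real.exp_neg, ← Real.log_sqrt Real.pi_pos.le, Real.exp_log (by positivity)]

end Constants

/-! ### The lower tail function and equal skewness parameters. -/

variable {α : Fin 2 → ℝ} {ρ : ℝ} {Ω : Type*} [MeasurableSpace Ω] {P : Measure Ω}
  [IsProbabilityMeasure P] {Z : Ω → Fin 2 → ℝ}

lemma lowerTail_isEquivalent (hρ₁ : -1 < ρ) (hρ₂ : ρ < 1) (hZ : HasLaw Z (law α ρ) P)
    {θ c τ : ℝ} (h : DiagonalAsymptotics (fun x => copula P Z x x) θ c τ) :
    (fun u => lowerTail P Z u) ~[𝓝[>] 0] fun u => u ^ θ * (c / (θ + 1)) * (-Real.log u) ^ τ := by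
  obtain ⟨hθ, Λ, -, -, h1, h2⟩ := h
  have h3 : (fun u : ℝ => u ^ (θ + 1) / (θ + 1) / u) ~[𝓝[>] 0]
      fun u => u ^ (θ + 1) / (θ + 1) / u := IsEquivalent.refl
  have h4 : (fun u : ℝ => u⁻¹) ~[𝓝[>] 0] fun u => u⁻¹ := IsEquivalent.refl
  have h5 := (h2.mul h4).trans ((h3.mul h1).congr_left (Eventually.of_forall fun u => by
    simp only [Pi.mul_apply]; ring))
  refine (h5.congr_left ?_).congr_right ?_
  · filter_upwards [eventually_mem_Ioo_zero_one] with u hu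
    rw [lowerTail_eq hρ₁ hρ₂ hZ hu, div_eq_mul_inv]; rfl
  · filter_upwards [eventually_mem_Ioo_zero_one] with u hu
    have := hu.1.ne'
    simp only [Pi.mul_apply]
    rw [Real.rpow_add_one this]
    field_simp

lemma lowerTail_isEquivalent_of_pos (hρ₁ : -1 < ρ) (hρ₂ : ρ < 1) (hZ : HasLaw Z (law α ρ) P)
    {a l β : ℝ} (h0 : α 0 = a) (h1 : α 1 = a) (ha : 0 < a)
    (hl : l = a * (1 + ρ) / √(1 + a ^ 2 * (1 - ρ ^ 2)))
    (hβ : β = √((1 - ρ) * (1 + 2 * a ^ 2 * (1 + ρ)) / (1 + ρ))) :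
    (fun u => lowerTail P Z u) ~[𝓝[>] 0] fun u =>
      u ^ (β ^ 2) * ((2 * Real.pi * l) ^ (β ^ 2) / (√Real.pi * β * (1 + β ^ 2) ^ 2)) *
        (-Real.log u) ^ (β ^ 2 - 1 / 2) := by
  have hr := one_sub_sq_pos hρ₁ hρ₂
  have p1 : 0 < 1 + ρ := by linarith
  have p2 : 0 < 1 - ρ := by linarith
  have e0 : lam α ρ 0 = l := by rw [lam, sub_zero, h0, h1, hl]; ring
  have e1 : lam α ρ (1 - 0) = l := by rw [sub_zero, lam, sub_self, h0, h1, hl]; ring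
  have hl0 : 0 < l := by rw [hl]; positivity
  have hβ0 : 0 < β := by rw [hβ]; positivity
  set q := √(1 + a ^ 2 * (1 - ρ ^ 2)) with hq
  set K := 1 + 2 * a ^ 2 * (1 + ρ) with hK
  have hK0 : 0 < K := by positivity
  have hq0 : 0 < q := by positivity
  have hq2 : q ^ 2 = 1 + a ^ 2 * (1 - ρ ^ 2) := Real.sq_sqrt (by positivity)
  have hβ2 : β ^ 2 = (1 - ρ) * K / (1 + ρ) := by rw [hβ, Real.sq_sqrt (by positivity)]
  have hl2 : 1 + l ^ 2 = K / q ^ 2 := by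
    rw [hl, eq_div_iff (by positivity), div_pow, add_mul, div_mul_cancel₀ _ (by positivity), hq2,
      hK]; ring
  have hg : 1 / √(1 + l ^ 2) = q / √K := by
    rw [hl2, Real.sqrt_div hK0.le, Real.sqrt_sq hq0.le, one_div_div]
  set g := 1 / √(1 + l ^ 2) with hgdef
  have hg0 : 0 < g := by positivity
  have hg2 : g ^ 2 = q ^ 2 / K := by rw [hg, div_pow, Real.sq_sqrt hK0.le]
  have hl2' : l ^ 2 / (1 + l ^ 2) = 1 - g ^ 2 := by
    rw [hgdef, div_pow, Real.sq_sqrt (by positivity)]; field_simp; ring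
  have hrf : 1 - ρ ^ 2 = (1 - ρ) * (1 + ρ) := by ring
  have hθ : β ^ 2 = (g - ρ * g) ^ 2 / (1 - ρ ^ 2) + (2 * a * g) ^ 2 - l ^ 2 / (1 + l ^ 2) := by
    rw [hl2', show (g - ρ * g) ^ 2 = g ^ 2 * (1 - ρ) ^ 2 by ring, mul_pow, hg2, hβ2, hq2, hrf, hK]
    field_simp
    ring
  have hD := diagonalAsymptotics_of_pos_of_pos hρ₁ hρ₂ hZ (i := 0) e0.symm e1.symm rfl rfl
    (show 2 * a * g = α 0 * g + α (1 - 0) * g by rw [sub_zero, h0, h1]; ring) rfl hθ hl0 hl0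
  have hmain := lowerTail_isEquivalent hρ₁ hρ₂ hZ hD
  have hgam : ∀ i : Fin 2, gam α ρ i = 1 := fun i => by
    have : tailScale α ρ (1 - i) = tailScale α ρ i := by
      fin_cases i
      · simp only [tailScale_eq_scaleOf, Fin.zero_eta, e0, e1]
      · simp only [tailScale_eq_scaleOf, Fin.mk_one, sub_self]
        rw [e0, ← e1, sub_zero]
    rw [gam, this, div_self (tailScale_pos i).ne']
  have hα : ∀ i : Fin 2, α i = a := fun i => by fin_cases i <;> assumption
  -- This common value of `β_i` is not the `β` of the statement, for which `β² = (1 - ρ) K / (1 +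
  -- ρ)`.
  have hbet : ∀ i : Fin 2, bet α ρ i = K / (1 + ρ) := fun i => by
    rw [bet, hgam, hα, hα, hrf, hK]; field_simp; ring
  have hexp : g * (g - ρ * g) / (1 - ρ ^ 2) + a * g * (2 * a * g) +
      (g * (g - ρ * g) / (1 - ρ ^ 2) + a * g * (2 * a * g)) = β ^ 2 + 1 := by
    rw [hθ, hl2', hrf]; field_simp; ring
  -- Accounts for the square of `1 + β²` in the constant: one factor is `θ + 1`, the other arises
  -- from `|b|`, `l` and `β_i`.
  have hβ1 : β ^ 2 + 1 = 2 * q ^ 2 / (1 + ρ) := by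
    rw [hβ2, hq2, hK]; field_simp; ring
  have hβr : β * (1 + ρ) = √K * √(1 - ρ ^ 2) := by
    rw [← Real.sqrt_mul hK0.le, eq_comm, Real.sqrt_eq_iff_mul_self_eq (by positivity)
      (by positivity)]
    rw [show β * (1 + ρ) * (β * (1 + ρ)) = β ^ 2 * (1 + ρ) ^ 2 by ring, hβ2]
    field_simp; ring
  have hconst : (1 / bet α ρ 0 + 1 / bet α ρ (1 - 0)) *
        ((2 * Real.pi) ^ (β ^ 2 - 1 / 2) / (√(2 * (1 - ρ ^ 2)) * |2 * a * g|)) *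
        l ^ (g * (g - ρ * g) / (1 - ρ ^ 2) + α 0 * g * (2 * a * g)) *
        l ^ (g * (g - ρ * g) / (1 - ρ ^ 2) + α (1 - 0) * g * (2 * a * g)) / (β ^ 2 + 1) =
      (2 * Real.pi * l) ^ (β ^ 2) / (√Real.pi * β * (1 + β ^ 2) ^ 2) := by
    rw [hα, hα, mul_assoc _ (l ^ _) (l ^ _), ← Real.rpow_add hl0, hexp, hbet, hbet,
      Real.rpow_add_one hl0.ne', Real.rpow_sub (by positivity), ← Real.sqrt_eq_rpow,
      Real.mul_rpow (by positivity) hl0.le, abs_of_pos (by positivity), Real.sqrt_mul zero_le_two,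
      Real.sqrt_mul zero_le_two, add_comm 1 (β ^ 2), hβ1, hg, hl]
    have s2 : √2 ^ 2 = 2 := Real.sq_sqrt zero_le_two
    have sK : √K ^ 2 = K := Real.sq_sqrt hK0.le
    have hsr : √(1 - ρ ^ 2) = β * (1 + ρ) / √K := by
      rw [eq_div_iff (by positivity), hβr]; ring
    rw [hsr]
    have : √K ≠ 0 := by positivity
    field_simp
    rw [s2, sK]
    ring
  refine hmain.congr_right (Eventually.of_forall fun u => ?_)
  simp only
  rw [← hconst]

lemma lowerTail_isEquivalent_of_neg (hρ₁ : -1 < ρ) (hρ₂ : ρ < 1) (hZ : HasLaw Z (law α ρ) P)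
    {a : ℝ} (h0 : α 0 = a) (h1 : α 1 = a) (ha : a < 0) :
    (fun u => lowerTail P Z u) ~[𝓝[>] 0] fun u =>
      u ^ ((1 - ρ) / (1 + ρ)) * ((1 + ρ) / 2 * √((1 + ρ) / (1 - ρ))) *
        (-Real.pi * Real.log u) ^ (-ρ / (1 + ρ)) := by
  have hr := one_sub_sq_pos hρ₁ hρ₂
  have p1 : 0 < 1 + ρ := by linarith
  have e : ∀ i, lam α ρ i < 0 := fun i => by
    have hα : ∀ i : Fin 2, α i = a := fun i => by fin_cases i <;> assumption
    rw [lam_neg_iff hr, hα, hα]; nlinarith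
  have hD := diagonalAsymptotics_of_nonpos_of_neg hρ₁ hρ₂ hZ (i := 0) (e 0).le (e _)
  refine (lowerTail_isEquivalent hρ₁ hρ₂ hZ hD).congr_right ?_
  filter_upwards [tendsto_neg_log_nhdsGT.eventually_gt_atTop 0] with u hL
  rw [show -Real.pi * Real.log u = Real.pi * -Real.log u by ring,
    Real.mul_rpow Real.pi_pos.le hL.le, rpow_eq_exp_log Real.pi_pos, quantileConst_of_neg (e 0),
    inv_pi_eq_exp]
  have h2 : Real.exp (Real.log Real.pi * (-ρ / (1 + ρ))) = Real.exp (-Real.log Real.pi) *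
      Real.exp ((Real.log Real.pi + Real.log Real.pi) / (2 * (1 + ρ))) := by
    rw [← Real.exp_add]; congr 1; field_simp; ring
  rw [h2, show (1 - ρ) / (1 + ρ) + 1 = 2 / (1 + ρ) by field_simp; ring]
  field_simp

end SkewNormal

/-! ### Assembly of the cases. -/

open SkewNormal in
theorem theorem3 {Ω : Type*} [MeasurableSpace Ω] (P : Measure Ω) [IsProbabilityMeasure P]
    (Z : Ω → Fin 2 → ℝ) (α : Fin 2 → ℝ) (ρ : ℝ) (hρ₁ : -1 < ρ) (hρ₂ : ρ < 1)
    (hZ : HasLaw Z (law α ρ) P) :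
    -- the derivative of the diagonal is the sum of the two conditional probabilities
    (∀ u ∈ Ioo (0 : ℝ) 1, HasDerivAt (fun x => copula P Z x x)
      (condProb α ρ 0 (quantile P Z 0 u) (quantile P Z 1 u) +
        condProb α ρ 1 (quantile P Z 1 u) (quantile P Z 0 u)) u) ∧
    -- the sign of `λ_i` is the sign of `α_i + ρ α_j`
    (∀ i j : Fin 2, i ≠ j →
      ((lam α ρ i < 0 ↔ α i + ρ * α j < 0) ∧ (lam α ρ i = 0 ↔ α i + ρ * α j = 0) ∧
        (0 < lam α ρ i ↔ 0 < α i + ρ * α j))) ∧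
    -- the asymptotics in the various sign cases
    (∀ i j : Fin 2, i ≠ j →
      -- both skewness parameters negative
      (lam α ρ i < 0 → lam α ρ j < 0 →
        (1 - ρ) / (1 + ρ) = 2 / (1 + ρ) - 1 ∧
        DiagonalAsymptotics (fun x => copula P Z x x) ((1 - ρ) / (1 + ρ))
          (√((1 + ρ) / (1 - ρ)) * Real.pi ^ (-ρ / (1 + ρ)))
          (-ρ / (1 + ρ))) ∧
      -- one zero, the other negative
      (lam α ρ i = 0 → lam α ρ j < 0 →
        (1 - ρ) / (1 + ρ) = 2 / (1 + ρ) - 1 ∧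
        DiagonalAsymptotics (fun x => copula P Z x x) ((1 - ρ) / (1 + ρ))
          (√((1 + ρ) / (1 - ρ)) * Real.pi ^ (-ρ / (1 + ρ)) * (2 : ℝ) ^ (1 / (1 + ρ)))
          (-ρ / (1 + ρ))) ∧
      -- one positive, the other negative or zero
      (∀ l w g b r : ℝ, l = lam α ρ j → w = √(1 + l ^ 2) → g = 1 / w → b = α i + α j * g →
          r = 1 - ρ ^ 2 → 0 < l →
        (g - ρ) ^ 2 / r = (r + (w - ρ) ^ 2) / (r * (1 + l ^ 2)) - 1 ∧
        (lam α ρ i < 0 →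
          (0 < b → DiagonalAsymptotics (fun x => copula P Z x x)
            ((g - ρ) ^ 2 / r + b ^ 2)
            ((2 * l) ^ (b ^ 2 - α i * b + g * (g - ρ) / r) / (4 * √r * |b|) *
              Real.pi ^ (b ^ 2 - α i * b / 2 + g * (g - ρ) / (2 * r) +
                (g - ρ) ^ 2 / (2 * r) - 1) *
              (1 / |bet α ρ j| + 1 / |bet α ρ i|))
            ((g - ρ) ^ 2 / (2 * r) + g * (g - ρ) / (2 * r) + b ^ 2 - α i * b / 2 - 1)) ∧
          (b = 0 → DiagonalAsymptotics (fun x => copula P Z x x)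
            ((g - ρ) ^ 2 / r)
            (√r / 4 * (2 * l) ^ (g * (g - ρ) / r) *
              Real.pi ^ ((g - ρ) ^ 2 / (2 * r) + g * (g - ρ) / (2 * r) - 1 / 2) *
              (1 / (w - ρ) + 1 / |g - ρ|))
            ((g - ρ) ^ 2 / (2 * r) + g * (g - ρ) / (2 * r) - 1 / 2)) ∧
          (b < 0 → DiagonalAsymptotics (fun x => copula P Z x x)
            ((g - ρ) ^ 2 / r)
            (√r / 2 * (2 * l) ^ (g * (g - ρ) / r) *
              Real.pi ^ ((g - ρ) ^ 2 / (2 * r) + g * (g - ρ) / (2 * r) - 1 / 2) *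
              (1 / (w - ρ) + 1 / |g - ρ|))
            ((g - ρ) ^ 2 / (2 * r) + g * (g - ρ) / (2 * r) - 1 / 2))) ∧
        (lam α ρ i = 0 →
          (0 < b → DiagonalAsymptotics (fun x => copula P Z x x)
            ((g - ρ) ^ 2 / r + b ^ 2)
            ((2 * Real.pi * l) ^ (b ^ 2) *
              (l * √Real.pi) ^ (g * (g - ρ) / r - α i * b) *
              (2 * √Real.pi) ^ ((g - ρ) ^ 2 / r) / (2 * √(Real.pi * r) * |b|) *
              (1 / (√Real.pi * bet α ρ j) + 1 / (√Real.pi * bet α ρ i)))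
            ((g - ρ) ^ 2 / (2 * r) + g * (g - ρ) / (2 * r) + b ^ 2 - α i * b / 2 - 1)) ∧
          (b = 0 → DiagonalAsymptotics (fun x => copula P Z x x)
            ((g - ρ) ^ 2 / r)
            (√r / (2 * √Real.pi) * (l * √Real.pi) ^ (g * (g - ρ) / r) *
              (2 * √Real.pi) ^ ((g - ρ) ^ 2 / r) * (1 / (w - ρ) + 1 / |g - ρ|))
            ((g - ρ) ^ 2 / (2 * r) + g * (g - ρ) / (2 * r) - 1 / 2)) ∧
          (b < 0 → DiagonalAsymptotics (fun x => copula P Z x x)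
            ((g - ρ) ^ 2 / r)
            (√r / √Real.pi * (l * √Real.pi) ^ (g * (g - ρ) / r) *
              (2 * √Real.pi) ^ ((g - ρ) ^ 2 / r) * (1 / (w - ρ) + 1 / |g - ρ|))
            ((g - ρ) ^ 2 / (2 * r) + g * (g - ρ) / (2 * r) - 1 / 2)))) ∧
      -- both positive
      (∀ l₁ l₂ g₁ g₂ b r θ : ℝ, l₁ = lam α ρ i → l₂ = lam α ρ j →
          g₁ = 1 / √(1 + l₁ ^ 2) → g₂ = 1 / √(1 + l₂ ^ 2) →
          b = α i * g₁ + α j * g₂ → r = 1 - ρ ^ 2 →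
          θ = (g₂ - ρ * g₁) ^ 2 / r + b ^ 2 - l₁ ^ 2 / (1 + l₁ ^ 2) →
          0 < l₁ → 0 < l₂ →
        θ = 1 / r * ((1 + α i ^ 2 * r) / (1 + l₁ ^ 2) + (1 + α j ^ 2 * r) / (1 + l₂ ^ 2) +
            2 * (α i * α j * r - ρ) / √((1 + l₁ ^ 2) * (1 + l₂ ^ 2))) - 1 ∧
        DiagonalAsymptotics (fun x => copula P Z x x) θ
          ((1 / bet α ρ i + 1 / bet α ρ j) *
            ((2 * Real.pi) ^ (θ - 1 / 2) / (√(2 * r) * |b|)) *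
            l₁ ^ (g₁ * (g₁ - ρ * g₂) / r + α i * g₁ * b) *
            l₂ ^ (g₂ * (g₂ - ρ * g₁) / r + α j * g₂ * b))
          (θ - 1 / 2))) ∧
    -- the equi-skew case
    (∀ a : ℝ, α 0 = a → α 1 = a →
      (0 < a → ∀ l β : ℝ, l = a * (1 + ρ) / √(1 + a ^ 2 * (1 - ρ ^ 2)) →
        β = √((1 - ρ) * (1 + 2 * a ^ 2 * (1 + ρ)) / (1 + ρ)) →
        (fun u => lowerTail P Z u) ~[𝓝[>] 0] fun u =>
          u ^ (β ^ 2) * ((2 * Real.pi * l) ^ (β ^ 2) / (√Real.pi * β * (1 + β ^ 2) ^ 2)) *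
            (-Real.log u) ^ (β ^ 2 - 1 / 2)) ∧
      (a < 0 →
        (fun u => lowerTail P Z u) ~[𝓝[>] 0] fun u =>
          u ^ ((1 - ρ) / (1 + ρ)) * ((1 + ρ) / 2 * √((1 + ρ) / (1 - ρ))) *
            (-Real.pi * Real.log u) ^ (-ρ / (1 + ρ)))) := by
  have hr0 := one_sub_sq_pos hρ₁ hρ₂
  have p1 : 0 < 1 + ρ := by linarith
  have other : ∀ i j : Fin 2, i ≠ j → j = 1 - i := by decide
  refine ⟨fun u hu => hasDerivAt_copula_diag hρ₁ hρ₂ hZ hu, ?_, ?_, ?_⟩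
  · intro i j hij
    rw [other i j hij]
    exact ⟨lam_neg_iff hr0 i, lam_eq_zero_iff hr0 i, lam_pos_iff hr0 i⟩
  · intro i j hij
    rw [other i j hij]
    refine ⟨fun hi hj => ⟨by field_simp; ring, ?_⟩, fun hi hj => ⟨by field_simp; ring, ?_⟩,
      fun l w g b r hl hw hg hb hr hl0 => ⟨?_, fun hi => ⟨fun hb0 => ?_, fun hb0 => ?_,
      fun hb0 => ?_⟩, fun hi => ⟨fun hb0 => ?_, fun hb0 => ?_, fun hb0 => ?_⟩⟩,
      fun l₁ l₂ g₁ g₂ b r θ hl₁ hl₂ hg₁ hg₂ hb hr hθ h₁ h₂ => ⟨?_,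
        diagonalAsymptotics_of_pos_of_pos hρ₁ hρ₂ hZ hl₁ hl₂ hg₁ hg₂ hb hr hθ h₁ h₂⟩⟩
    -- Only the constants have to be matched, here and in the mixed cases: real powers are written
    -- as exponentials of logarithms and the exponents compared.
    · convert diagonalAsymptotics_of_nonpos_of_neg hρ₁ hρ₂ hZ hi.le hj using 1
      rw [quantileConst_of_neg hi, inv_pi_eq_exp, rpow_eq_exp_log Real.pi_pos, mul_assoc,
        ← Real.exp_add]
      congr 2; field_simp; ring
    · convert diagonalAsymptotics_of_nonpos_of_neg hρ₁ hρ₂ hZ hi.le hj using 1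
      rw [hi, quantileConst_zero, inv_pi_eq_exp, rpow_eq_exp_log Real.pi_pos,
        rpow_eq_exp_log two_pos, mul_assoc, mul_assoc, ← Real.exp_add, ← Real.exp_add]
      congr 2; field_simp; ring
    · have hw0 : 0 < w := by rw [hw]; positivity
      have hw2 : 1 + l ^ 2 = w ^ 2 := by rw [hw, Real.sq_sqrt (by positivity)]
      rw [hw2, hg, hr]
      field_simp
      ring
    · obtain ⟨B, B', h⟩ :=
        diagonalAsymptotics_mixed_of_pos hρ₁ hρ₂ hZ hi.le hl hw hg hb hr hl0 hb0
      convert h using 1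
      rw [abs_of_pos hb0, abs_of_pos B, abs_of_pos B', rpow_eq_exp_log Real.pi_pos,
        rpow_eq_exp_log (by positivity), log_two_mul hl0, quantileConst_of_neg hi,
        div_mul_eq_mul_div, ← Real.exp_add, div_mul_eq_mul_div, mul_comm, mul_div_right_comm]
      congr 2; field_simp; ring
    · obtain ⟨hgρ, h⟩ := diagonalAsymptotics_mixed_of_nonpos hρ₁ hρ₂ hZ hi.le hl hw hg hb hr hl0
        (Or.inl ⟨hb0, rfl⟩)
      convert h using 1
      rw [abs_of_pos (sub_pos.2 hgρ), rpow_eq_exp_log Real.pi_pos,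
        rpow_eq_exp_log (by positivity), log_two_mul hl0, quantileConst_of_neg hi,
        mul_assoc (√r / 4), ← Real.exp_add]
      rw [show ∀ x y z : ℝ, x / 4 * y * z = z * x * (1 / 2) / 2 * y by intros; ring]
      congr 2; field_simp; ring
    · obtain ⟨hgρ, h⟩ := diagonalAsymptotics_mixed_of_nonpos hρ₁ hρ₂ hZ hi.le hl hw hg hb hr hl0
        (Or.inr ⟨hb0, rfl⟩)
      convert h using 1
      rw [abs_of_pos (sub_pos.2 hgρ), rpow_eq_exp_log Real.pi_pos,
        rpow_eq_exp_log (by positivity), log_two_mul hl0, quantileConst_of_neg hi,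
        mul_assoc (√r / 2), ← Real.exp_add]
      rw [show ∀ x y z : ℝ, x / 2 * y * z = z * x * 1 / 2 * y by intros; ring]
      congr 2; field_simp; ring
    · obtain ⟨B, B', h⟩ :=
        diagonalAsymptotics_mixed_of_pos hρ₁ hρ₂ hZ hi.le hl hw hg hb hr hl0 hb0
      convert h using 1
      rw [← hr] at hr0
      have e : Real.exp (-(3 / 2) * Real.log Real.pi + quantileConst (lam α ρ i) *
            (1 + (g - ρ) ^ 2 / r - g * (g - ρ) / r + α i * b) / 2 +
          (Real.log 2 + Real.log Real.pi + Real.log l) * (g * (g - ρ) / r + b ^ 2 - α i * b)) =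
          Real.exp (Real.log 2) * (√Real.pi)⁻¹ * (√Real.pi)⁻¹ * ((2 * Real.pi * l) ^ (b ^ 2) *
            (l * √Real.pi) ^ (g * (g - ρ) / r - α i * b) *
            (2 * √Real.pi) ^ ((g - ρ) ^ 2 / r)) := by
        rw [hi, quantileConst_zero, rpow_eq_exp_log (by positivity),
          rpow_eq_exp_log (by positivity), rpow_eq_exp_log (by positivity), log_two_pi_mul hl0,
          log_mul_sqrt_pi hl0, log_mul_sqrt_pi two_pos, inv_sqrt_pi_eq_exp]
        simp only [← Real.exp_add]
        congr 1; field_simp; ring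
      rw [e, Real.exp_log two_pos, abs_of_pos hb0, Real.sqrt_mul Real.pi_pos.le]
      field_simp
      ring
    · obtain ⟨hgρ, h⟩ := diagonalAsymptotics_mixed_of_nonpos hρ₁ hρ₂ hZ hi.le hl hw hg hb hr hl0
        (Or.inl ⟨hb0, rfl⟩)
      convert h using 1
      rw [← hr] at hr0
      have e : Real.exp (-Real.log Real.pi + quantileConst (lam α ρ i) *
            (1 + (g - ρ) ^ 2 / r - g * (g - ρ) / r) / 2 +
          (Real.log 2 + Real.log Real.pi + Real.log l) * (g * (g - ρ) / r)) =
          Real.exp (Real.log 2) * (√Real.pi)⁻¹ * ((l * √Real.pi) ^ (g * (g - ρ) / r) *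
            (2 * √Real.pi) ^ ((g - ρ) ^ 2 / r)) := by
        rw [hi, quantileConst_zero, rpow_eq_exp_log (by positivity),
          rpow_eq_exp_log (by positivity),
          log_mul_sqrt_pi hl0, log_mul_sqrt_pi two_pos, inv_sqrt_pi_eq_exp]
        simp only [← Real.exp_add]
        congr 1; field_simp; ring
      rw [e, Real.exp_log two_pos, abs_of_pos (sub_pos.2 hgρ)]
      ring
    · obtain ⟨hgρ, h⟩ := diagonalAsymptotics_mixed_of_nonpos hρ₁ hρ₂ hZ hi.le hl hw hg hb hr hl0
        (Or.inr ⟨hb0, rfl⟩)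
      convert h using 1
      rw [← hr] at hr0
      have e : Real.exp (-Real.log Real.pi + quantileConst (lam α ρ i) *
            (1 + (g - ρ) ^ 2 / r - g * (g - ρ) / r) / 2 +
          (Real.log 2 + Real.log Real.pi + Real.log l) * (g * (g - ρ) / r)) =
          Real.exp (Real.log 2) * (√Real.pi)⁻¹ * ((l * √Real.pi) ^ (g * (g - ρ) / r) *
            (2 * √Real.pi) ^ ((g - ρ) ^ 2 / r)) := by
        rw [hi, quantileConst_zero, rpow_eq_exp_log (by positivity),
          rpow_eq_exp_log (by positivity),
          log_mul_sqrt_pi hl0, log_mul_sqrt_pi two_pos, inv_sqrt_pi_eq_exp]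
        simp only [← Real.exp_add]
        congr 1; field_simp; ring
      rw [e, Real.exp_log two_pos, abs_of_pos (sub_pos.2 hgρ)]
      ring
    · rw [← hr] at hr0
      have q1 : g₁ ^ 2 = 1 / (1 + l₁ ^ 2) := by
        rw [hg₁, div_pow, Real.sq_sqrt (by positivity), one_pow]
      have q2 : g₂ ^ 2 = 1 / (1 + l₂ ^ 2) := by
        rw [hg₂, div_pow, Real.sq_sqrt (by positivity), one_pow]
      have q3 : ∀ x : ℝ, x / √((1 + l₁ ^ 2) * (1 + l₂ ^ 2)) = x * (g₁ * g₂) := fun x => by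
        rw [Real.sqrt_mul (by positivity), hg₁, hg₂]; field_simp
      have q4 : l₁ ^ 2 / (1 + l₁ ^ 2) = 1 - g₁ ^ 2 := by rw [q1]; field_simp; ring
      have q5 : ∀ x l : ℝ, x / (1 + l ^ 2) = x * (1 / (1 + l ^ 2)) := fun x l => by ring
      rw [hθ, q4, q3, q5, q5 _ l₂, ← q1, ← q2, hb]
      have hρr : ρ ^ 2 = 1 - r := by linarith
      field_simp
      linear_combination g₁ ^ 2 * hρr
  · exact fun a h0 h1 => ⟨fun ha l β hl hβ =>
      lowerTail_isEquivalent_of_pos hρ₁ hρ₂ hZ h0 h1 ha hl hβ,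
      fun ha => lowerTail_isEquivalent_of_neg hρ₁ hρ₂ hZ h0 h1 ha⟩
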